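/- Notation. Let $\mathbb T=\mathbb R/\mathbb Z$. For $t\in\mathbb R$, $\nu\in\mathbb C$ write $\{t,\nu\}=\begin{pmatrix} it&\nu\\ \bar\nu&-it\end{pmatrix}\in su(1,1)$ and $|\{t,\nu\}|=\max(|t|,|\nu|)$. For smooth $U:\mathbb T\to su(1,1)$ and an integer $s\ge 0$ let $\|U\|_s=\|U\|_{C^s}=\max_{0\le j\le s}\max_{\theta\in\mathbb T}|\partial_\theta^jU(\theta)|$. Let $E_r(\theta)=\mathrm{diag}(e^{2\pi ir\theta},e^{-2\pi ir\theta})$. For $\alpha\in\mathbb T$ and $A:\mathbb T\to SU(1,1)$ let, for $n\ge 1$, $A_n(\theta)=A(\theta+(n-1)\alpha)\cdots A(\theta)$, $A_{-n}(\theta)=A(\theta-n\alpha)^{-1}\cdots A(\theta-\alpha)^{-1}$, and $A_0=\mathrm{Id}$; the cocycle $(\alpha,A)$ has $C^0$-bounded fibered products if $\sup_{n\in\mathbb Z}\max_{\theta\in\mathbb T}\|A_n(\theta)\|<\infty$. For $U=\{t,\nu\}$, with Fourier coefficients $\hat t(k),\hat\nu(k)$, put $$\Lambda_{2r}U=\Bigl\{\hat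 t(0),\ \sum_{k=-(2r-1)}^{0}\hat\nu(k)e^{2\pi ik\theta}\Bigr\}.$$ Theorem. Let $r\ge 1$ be an integer. There are constants $C_{s,r}$ ($s\ge 1$ an integer), depending only on $s$ and $r$, such that for every $\alpha\in\mathbb T$ there is $\epsilon_1>0$ with the following property. If $U=\{t,\nu\}\in C^\infty(\mathbb T,su(1,1))$ satisfies $\hat t(0)=0$ and $\|U\|_{C^2}\le\epsilon_1$, and if $(\alpha,E_r e^{U})$ has $C^0$-bounded fibered products, then for every integer $s\ge 1$ $$\|\Lambda_{2r}U\|_s\le C_{s,r}\,\|U-\Lambda_{2r}U\|_s .$$ -/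

import Mathlib

open scoped ContDiff

noncomputable section

namespace QPCocycle

/-- Coordinates `{t, ν}` on the Lie algebra `su(1,1)`, with the norm `max |t| |ν|`. -/
abbrev SU11Coord := ℝ × ℂ

/-- The element `{t, ν}` of `su(1,1)` as a matrix. -/
def toMatrix (u : SU11Coord) : Matrix (Fin 2) (Fin 2) ℂ :=
  !![Complex.I * (u.1 : ℂ), u.2; (starRingEnd ℂ) u.2, -(Complex.I * (u.1 : ℂ))]

/-- Smoothness of a map defined on the circle `ℝ/ℤ`. -/
def Smooth (U : UnitAddCircle → SU11Coord) : Prop :=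
  ContDiff ℝ ∞ (fun x : ℝ => U (x : UnitAddCircle))

/-- The `C^s` norm `max_{j ≤ s} max_θ ‖∂^j U(θ)‖` of a smooth map on the circle. -/
def cNorm (s : ℕ) (U : UnitAddCircle → SU11Coord) : ℝ :=
  ⨆ j : Fin (s + 1), ⨆ x : ℝ, ‖iteratedDeriv (j : ℕ) (fun y : ℝ => U (y : UnitAddCircle)) x‖

/-- The mean value `t̂(0)` of the first component of `U = {t, ν}`. -/
def meanT (U : UnitAddCircle → SU11Coord) : ℝ :=
  ∫ θ : UnitAddCircle, (U θ).1 ∂AddCircle.haarAddCircle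

/-- `Λ_{2r} {t, ν} = {t̂(0), ∑_{k = -(2r-1)}^{0} ν̂(k) e^{2πikθ}}`. -/
def resonantPart (r : ℕ) (U : UnitAddCircle → SU11Coord) : UnitAddCircle → SU11Coord :=
  fun θ => (meanT U,
    ∑ k ∈ Finset.Icc (-(2 * (r : ℤ) - 1)) 0,
      fourierCoeff (fun φ : UnitAddCircle => (U φ).2) k * fourier k θ)

/-- `E_r(θ) = diag(e^{2πirθ}, e^{-2πirθ})`. -/
def E (r : ℕ) (θ : UnitAddCircle) : Matrix (Fin 2) (Fin 2) ℂ :=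
  !![fourier (r : ℤ) θ, 0; 0, fourier (-(r : ℤ)) θ]

/-- The `SU(1,1)`-valued map `θ ↦ E_r(θ) e^{U(θ)}`. -/
def perturbedE (r : ℕ) (U : UnitAddCircle → SU11Coord) (θ : UnitAddCircle) :
    Matrix (Fin 2) (Fin 2) ℂ :=
  E r θ * NormedSpace.exp (toMatrix (U θ))

/-- `A_n(θ) = A(θ + (n-1)α) ⋯ A(θ)` for `n ≥ 0`. -/
def forwardProduct (α : UnitAddCircle) (A : UnitAddCircle → Matrix (Fin 2) (Fin 2) ℂ) :
    ℕ → UnitAddCircle → Matrix (Fin 2) (Fin 2) ℂ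
  | 0, _ => 1
  | n + 1, θ => A (θ + n • α) * forwardProduct α A n θ

/-- `A_{-n}(θ) = A(θ - nα)⁻¹ ⋯ A(θ - α)⁻¹` for `n ≥ 0`. -/
def backwardProduct (α : UnitAddCircle) (A : UnitAddCircle → Matrix (Fin 2) (Fin 2) ℂ) :
    ℕ → UnitAddCircle → Matrix (Fin 2) (Fin 2) ℂ
  | 0, _ => 1
  | n + 1, θ => (A (θ - (n + 1) • α))⁻¹ * backwardProduct α A n θ

/-- The fibered products `A_n`, `n ∈ ℤ`, of the cocycle `(α, A)`. -/
def fiberedProduct (α : UnitAddCircle) (A : UnitAddCircle → Matrix (Fin 2) (Fin 2) ℂ) :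
    ℤ → UnitAddCircle → Matrix (Fin 2) (Fin 2) ℂ
  | Int.ofNat n => forwardProduct α A n
  | Int.negSucc n => backwardProduct α A (n + 1)

/-- The fibered products of `(α, A)` are `C⁰`-bounded: all entries of all `A_n(θ)`,
`n ∈ ℤ`, are bounded by a common constant. -/
def BoundedFiberedProducts (α : UnitAddCircle)
    (A : UnitAddCircle → Matrix (Fin 2) (Fin 2) ℂ) : Prop :=
  ∃ M : ℝ, ∀ (n : ℤ) (θ : UnitAddCircle) (i j : Fin 2), ‖fiberedProduct α A n θ i j‖ ≤ M

/-- The matrices `E_r(θ) e^{U(θ)}` are invertible, so their inverses are genuine. -/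
theorem isUnit_perturbedE (r : ℕ) (U : UnitAddCircle → SU11Coord) (θ : UnitAddCircle) :
    IsUnit (perturbedE r U θ) := by
  refine IsUnit.mul ?_ (Matrix.isUnit_exp _)
  rw [Matrix.isUnit_iff_isUnit_det]
  have h : (E r θ).det = 1 := by
    rw [E, Matrix.det_fin_two_of, ← fourier_add]
    simp
  rw [h]
  exact isUnit_one

end QPCocycle

end

/-! ### Bounded orbits and the SU(1,1)-equivariant disc root. -/

open scoped ContDiff
noncomputable section
namespace QPCocycle

open MeasureTheory Matrix ComplexConjugate

/-! The group SU(1,1) acts on the unit disc. Bounded fibered products produce an invariant section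
`z` with `|z| ≤ ρ < 1`, only measurable in general
(`BoundedFiberedProducts.exists_invariant_section`). It is read off from the second moments of the
set of vectors whose whole orbit stays in the unit polydisc.

Write `e^U` with first row `(a, b)` and put `m = 4πr`. The section satisfies two exact integral
identities. The energy identity (`energy_identity`) integrates the SU(1,1)-equivariant connection
form `Im(z̄ dz)/(1 - |z|²)`: the rotation `E_r` contributes `m ∫ |az+b|²/(1-|z|²)`, which the
logarithmic derivative of `e^U` must balance. The exponent identity
(`integrable_and_integral_log_denom_eq_zero`) says that `log |b̄z+ā|²` has mean zero, being a
coboundary of `log (1-|z|²)`.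

Subtract `π` times the second from the first and expand to second order in `z, ν, ν'`. The term `t'`
integrates to zero, and what remains is `∫ quadForm ≤ error`, the error being `O(ε)` times the
squared norms (`quadForm_le`, `BoundedFiberedProducts.exists_integral_quadForm_le`).

On the Fourier mode `k` the form equals `(m - π + 2πk)|ẑ(k) + ν̂(k)|² + (π - 2πk)|ẑ(k)|²`. Both
coefficients are positive exactly for `-(2r-1) ≤ k ≤ 0`, the resonant band; the multiple `π` of the
exponent identity keeps the two end modes nondegenerate. Hence the form is coercive on the resonant
part of `ν` (`integrable_quadForm_trigPoly`). Young's inequality absorbs the cross terms with the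
nonresonant part, which bounds the resonant coefficients in `ℓ²` by the `C¹` size of `U - ΛU`
(`sum_normSq_le_of_boundedFiberedProducts`). Since `ΛU` is a trigonometric polynomial of bounded
degree, all its `C^s` norms are controlled by these coefficients. -/

theorem forwardProduct_add_mul (α : UnitAddCircle) (A : UnitAddCircle → Matrix (Fin 2) (Fin 2) ℂ)
    (n : ℕ) (θ : UnitAddCircle) :
    forwardProduct α A n (θ + α) * A θ = forwardProduct α A (n + 1) θ := by
  induction n with
  | zero => simp [forwardProduct]
  | succ n ih =>
    rw [forwardProduct, mul_assoc, ih]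
    conv_rhs => rw [forwardProduct]
    congr 2
    rw [add_assoc, succ_nsmul']

theorem backwardProduct_add_mul (α : UnitAddCircle) (A : UnitAddCircle → Matrix (Fin 2) (Fin 2) ℂ)
    (hA : ∀ θ, IsUnit (A θ)) (n : ℕ) (θ : UnitAddCircle) :
    backwardProduct α A (n + 1) (θ + α) * A θ = backwardProduct α A n θ := by
  have h1 : (A θ)⁻¹ * A θ = 1 :=
    Matrix.nonsing_inv_mul _ ((Matrix.isUnit_iff_isUnit_det _).1 (hA θ))
  induction n with
  | zero => simp [backwardProduct, h1]
  | succ n ih =>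
    rw [backwardProduct, mul_assoc, ih]
    conv_rhs => rw [backwardProduct]
    congr 2
    rw [show n + 1 + 1 = (n + 1) + 1 from rfl, succ_nsmul (n := n + 1)]
    congr 1
    abel

theorem fiberedProduct_add_mul (α : UnitAddCircle) (A : UnitAddCircle → Matrix (Fin 2) (Fin 2) ℂ)
    (hA : ∀ θ, IsUnit (A θ)) (n : ℤ) (θ : UnitAddCircle) :
    fiberedProduct α A n (θ + α) * A θ = fiberedProduct α A (n + 1) θ := by
  rcases n with n | n
  · exact forwardProduct_add_mul α A n θ
  · rcases n with _ | n
    · exact backwardProduct_add_mul α A hA 0 θ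
    · exact backwardProduct_add_mul α A hA (n + 1) θ

theorem continuous_fiberedProduct (α : UnitAddCircle)
    (A : UnitAddCircle → Matrix (Fin 2) (Fin 2) ℂ) (hA : ∀ θ, IsUnit (A θ)) (hc : Continuous A)
    (n : ℤ) : Continuous (fiberedProduct α A n) := by
  have hinv : Continuous fun θ => (A θ)⁻¹ := by
    refine continuous_iff_continuousAt.2 fun θ => ?_
    have := (Matrix.isUnit_iff_isUnit_det _).1 (hA θ)
    exact ContinuousAt.comp (g := Inv.inv)
      (continuousAt_matrix_inv _ (NormedRing.inverse_continuousAt this.unit)) hc.continuousAt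
  have hf : ∀ n, Continuous (forwardProduct α A n) := by
    intro n
    induction n with
    | zero => exact continuous_const
    | succ n ih => exact (hc.comp (continuous_id.add continuous_const)).mul ih
  have hb : ∀ n, Continuous (backwardProduct α A n) := by
    intro n
    induction n with
    | zero => exact continuous_const
    | succ n ih => exact (hinv.comp (continuous_id.sub continuous_const)).mul ih
  rcases n with n | n
  · exact hf n
  · exact hb (n + 1)

/-- The vectors whose whole orbit under the cocycle stays in the unit polydisc. -/
def boundedVectors (α : UnitAddCircle) (A : UnitAddCircle → Matrix (Fin 2) (Fin 2) ℂ)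
    (θ : UnitAddCircle) : Set (Fin 2 → ℂ) :=
  {v | ∀ (n : ℤ) (i : Fin 2), ‖(fiberedProduct α A n θ *ᵥ v) i‖ ≤ 1}

/-- One step of the dynamics shifts the time index, and the defining condition ranges over all of
`ℤ`. Two-sided boundedness is what makes this an equivalence. -/
theorem mulVec_mem_boundedVectors {α : UnitAddCircle}
    {A : UnitAddCircle → Matrix (Fin 2) (Fin 2) ℂ} (hA : ∀ θ, IsUnit (A θ)) (θ : UnitAddCircle)
    (v : Fin 2 → ℂ) :
    A θ *ᵥ v ∈ boundedVectors α A (θ + α) ↔ v ∈ boundedVectors α A θ := by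
  simp only [boundedVectors, Set.mem_ofPred_eq, Matrix.mulVec_mulVec, fiberedProduct_add_mul α A hA]
  refine ⟨fun h n i => ?_, fun h n i => h (n + 1) i⟩
  simpa using h (n - 1) i

/-- The graph is a countable intersection of closed sets. Joint measurability makes the moments
below measurable in `θ`. -/
theorem measurableSet_boundedVectors {α : UnitAddCircle}
    {A : UnitAddCircle → Matrix (Fin 2) (Fin 2) ℂ} (hA : ∀ θ, IsUnit (A θ)) (hc : Continuous A) :
    MeasurableSet {p : UnitAddCircle × (Fin 2 → ℂ) | p.2 ∈ boundedVectors α A p.1} := by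
  have : {p : UnitAddCircle × (Fin 2 → ℂ) | p.2 ∈ boundedVectors α A p.1} =
      ⋂ n : ℤ, ⋂ i : Fin 2, {p | ‖(fiberedProduct α A n p.1 *ᵥ p.2) i‖ ≤ 1} := by
    ext p
    simp [boundedVectors]
  rw [this]
  refine MeasurableSet.iInter fun n => MeasurableSet.iInter fun i => IsClosed.measurableSet ?_
  refine isClosed_le (Continuous.norm ?_) continuous_const
  exact (continuous_apply i).comp
    (((continuous_fiberedProduct α A hA hc n).comp continuous_fst).matrix_mulVec continuous_snd)

theorem boundedVectors_subset (α : UnitAddCircle) (A : UnitAddCircle → Matrix (Fin 2) (Fin 2) ℂ)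
    (θ : UnitAddCircle) : boundedVectors α A θ ⊆ Metric.closedBall 0 1 := by
  intro v hv
  rw [mem_closedBall_zero_iff, pi_norm_le_iff_of_nonneg zero_le_one]
  intro i
  simpa [fiberedProduct, forwardProduct] using hv (Int.ofNat 0) i

theorem BoundedFiberedProducts.exists_closedBall_subset {α : UnitAddCircle}
    {A : UnitAddCircle → Matrix (Fin 2) (Fin 2) ℂ} (h : BoundedFiberedProducts α A) :
    ∃ η : ℝ, 0 < η ∧ ∀ θ, Metric.closedBall 0 η ⊆ boundedVectors α A θ := by
  obtain ⟨M, hM⟩ := h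
  have hM0 : 0 ≤ M := (norm_nonneg _).trans (hM 0 0 0 0)
  -- Each coordinate is a sum of two products, so it is at most `2M/(2M+1) ≤ 1`; the `+ 1` covers `M
  -- = 0`.
  refine ⟨1 / (2 * M + 1), by positivity, fun θ v hv n i => ?_⟩
  rw [mem_closedBall_zero_iff] at hv
  have hb : ∀ j, ‖fiberedProduct α A n θ i j * v j‖ ≤ M * (1 / (2 * M + 1)) := fun j => by
    rw [norm_mul]
    exact mul_le_mul (hM n θ i j) ((norm_le_pi_norm v j).trans hv) (norm_nonneg _) hM0
  rw [Matrix.mulVec, dotProduct, Fin.sum_univ_two]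
  refine (norm_add_le _ _).trans ((add_le_add (hb 0) (hb 1)).trans ?_)
  rw [← mul_add, ← add_div, mul_div_assoc', div_le_one (by positivity)]
  linarith

/-- A `2 × 2` complex matrix in the parametrised form of `SU(1,1)`. -/
def su11 (x y : ℂ) : Matrix (Fin 2) (Fin 2) ℂ := !![x, y; conj y, conj x]

theorem isUnit_su11 {x y : ℂ} (h : x * conj x - y * conj y = 1) : IsUnit (su11 x y) := by
  rw [Matrix.isUnit_iff_isUnit_det, su11, Matrix.det_fin_two_of, h]
  exact isUnit_one

/-- The integral of a function over the image of a set under an invertible matrix. -/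
theorem exists_setIntegral_mulVec {A : Matrix (Fin 2) (Fin 2) ℂ} (hA : IsUnit A) :
    ∃ m : ℝ, 0 < m ∧ ∀ {F : Type} [NormedAddCommGroup F] [NormedSpace ℝ F] (S S' : Set (Fin 2 → ℂ))
      (_ : MeasurableSet S) (_ : MeasurableSet S') (_ : ∀ v, A *ᵥ v ∈ S' ↔ v ∈ S)
      (f : (Fin 2 → ℂ) → F), ∫ v in S, f (A *ᵥ v) = m • ∫ v in S', f v := by
  have hdet := (Matrix.isUnit_iff_isUnit_det _).1 hA
  let e : (Fin 2 → ℂ) ≃ₗ[ℂ] (Fin 2 → ℂ) := LinearEquiv.ofBijective A.mulVecLin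
    ⟨Matrix.mulVec_injective_iff_isUnit.2 hA, Matrix.mulVec_surjective_iff_isUnit.2 hA⟩
  let l : (Fin 2 → ℂ) ≃ₗ[ℝ] (Fin 2 → ℂ) := e.restrictScalars ℝ
  have hl : ∀ v, l v = A *ᵥ v := fun v => rfl
  have hld : LinearMap.det (l : (Fin 2 → ℂ) →ₗ[ℝ] (Fin 2 → ℂ)) ≠ 0 := l.isUnit_det'.ne_zero
  -- The Jacobian factor depends on `A` alone. All moments therefore scale by the same factor, which
  -- cancels in the root of a homogeneous quadratic equation.
  refine ⟨|(LinearMap.det (l : (Fin 2 → ℂ) →ₗ[ℝ] (Fin 2 → ℂ)))⁻¹|, by positivity, ?_⟩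
  intro F _ _ S S' hS hS' hSS f
  have hemb : MeasurableEmbedding l :=
    l.toContinuousLinearEquiv.toHomeomorph.measurableEmbedding
  have hmap := Measure.map_linearMap_addHaar_eq_smul_addHaar (volume : Measure (Fin 2 → ℂ)) hld
  rw [← integral_indicator hS, ← integral_indicator hS']
  have : (fun v => S.indicator (fun v => f (A *ᵥ v)) v) = fun v => S'.indicator f (l v) := by
    funext v
    by_cases hv : v ∈ S
    · rw [Set.indicator_of_mem hv, hl, Set.indicator_of_mem ((hSS v).2 hv)]
    · rw [Set.indicator_of_notMem hv, hl, Set.indicator_of_notMem (fun h => hv ((hSS v).1 h))]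
  rw [this, ← hemb.integral_map (fun v => S'.indicator f v)]
  erw [hmap]
  rw [integral_smul_measure, ENNReal.toReal_ofReal (abs_nonneg _)]

/-- A root in the open unit disc of `q̄ z² - T z + q`. -/
def discRoot (T : ℝ) (q : ℂ) : ℂ := 2 * q / ((T + √(T ^ 2 - 4 * ‖q‖ ^ 2) : ℝ) : ℂ)

/-- With `R` the square root in the definition, `4|q|² = T² - R²`. The root is the smaller one, `(T
- R)/(2q̄)`, in rationalised form, which still makes sense at `q = 0`. -/
theorem discRoot_eq {T : ℝ} {q : ℂ} (h : 2 * ‖q‖ < T) :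
    conj q * discRoot T q ^ 2 - T * discRoot T q + q = 0 := by
  have hT : 0 < T := (by positivity : (0 : ℝ) ≤ 2 * ‖q‖).trans_lt h
  have hs : 0 ≤ T ^ 2 - 4 * ‖q‖ ^ 2 := by nlinarith [norm_nonneg q]
  have hsq := Real.sq_sqrt hs
  rw [discRoot]
  set R := √(T ^ 2 - 4 * ‖q‖ ^ 2) with hR
  have hR0 : 0 ≤ R := Real.sqrt_nonneg _
  have hne : ((T + R : ℝ) : ℂ) ≠ 0 := by exact_mod_cast (by positivity : T + R ≠ 0)
  have hq : conj q * q = ((‖q‖ ^ 2 : ℝ) : ℂ) := by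
    rw [mul_comm, Complex.mul_conj, Complex.normSq_eq_norm_sq]
  have h4 : 4 * (conj q * q) = (T : ℂ) ^ 2 - (R : ℂ) ^ 2 := by
    rw [hq]
    have : (4 * ‖q‖ ^ 2 : ℝ) = T ^ 2 - R ^ 2 := by rw [hsq]; ring
    exact_mod_cast this
  field_simp
  push_cast
  linear_combination q * h4

theorem norm_discRoot_le {T : ℝ} {q : ℂ} (h : 2 * ‖q‖ < T) : ‖discRoot T q‖ ≤ 2 * ‖q‖ / T := by
  have hT : 0 < T := (by positivity : (0 : ℝ) ≤ 2 * ‖q‖).trans_lt h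
  have hR0 : 0 ≤ √(T ^ 2 - 4 * ‖q‖ ^ 2) := Real.sqrt_nonneg _
  rw [discRoot, norm_div, Complex.norm_real, Real.norm_of_nonneg (by positivity), norm_mul]
  simp only [Complex.norm_ofNat]
  gcongr
  linarith

/-- Subtracting the equations of two roots leaves a product. The second factor cannot vanish, since
`|q̄(z+w)| ≤ 2|q| < T` for `z, w` in the closed disc. -/
theorem eq_discRoot {T : ℝ} {q z : ℂ} (h : 2 * ‖q‖ < T) (hz : ‖z‖ ≤ 1)
    (hr : conj q * z ^ 2 - T * z + q = 0) : z = discRoot T q := by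
  have hT : 0 < T := (by positivity : (0 : ℝ) ≤ 2 * ‖q‖).trans_lt h
  have h1 := discRoot_eq h
  have h2 : ‖discRoot T q‖ ≤ 1 := (norm_discRoot_le h).trans ((div_le_one hT).2 h.le)
  set w := discRoot T q
  have h3 : (z - w) * (conj q * (z + w) - T) = 0 := by linear_combination hr - h1
  rcases mul_eq_zero.1 h3 with h4 | h4
  · exact sub_eq_zero.1 h4
  · exfalso
    have h5 : ‖conj q * (z + w)‖ = T := by
      rw [sub_eq_zero.1 h4, Complex.norm_real, Real.norm_of_nonneg hT.le]
    have h6 : ‖conj q * (z + w)‖ ≤ ‖q‖ * 2 := by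
      rw [norm_mul, RCLike.norm_conj]
      gcongr
      exact (norm_add_le _ _).trans (by linarith)
    linarith

/-- Elements of SU(1,1) preserve the form `|v₁|² - |v₀|²`; here it is evaluated at `v = (z, 1)`. -/
theorem normSq_mobius {x y z : ℂ} (h : x * conj x - y * conj y = 1) :
    ‖conj y * z + conj x‖ ^ 2 - ‖x * z + y‖ ^ 2 = 1 - ‖z‖ ^ 2 := by
  have : ((‖conj y * z + conj x‖ ^ 2 - ‖x * z + y‖ ^ 2 : ℝ) : ℂ) = ((1 - ‖z‖ ^ 2 : ℝ) : ℂ) := by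
    simp only [Complex.ofReal_sub, Complex.ofReal_one, ← Complex.normSq_eq_norm_sq,
      ← Complex.mul_conj, map_add, map_mul, Complex.conj_conj]
    linear_combination (1 - z * conj z) * h
  exact_mod_cast this

theorem mobius_denom_ne_zero {x y z : ℂ} (h : x * conj x - y * conj y = 1) (hz : ‖z‖ < 1) :
    conj y * z + conj x ≠ 0 := by
  intro h0
  have := normSq_mobius (z := z) h
  rw [h0, norm_zero] at this
  nlinarith [sq_nonneg ‖x * z + y‖, norm_nonneg z]

/-- The disc root is equivariant under the action of `SU(1,1)` on Hermitian forms. -/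
theorem discRoot_mobius {x y q q' : ℂ} {T T' m : ℝ} (hm : 0 < m)
    (hxy : x * conj x - y * conj y = 1) (h : 2 * ‖q‖ < T) (h' : 2 * ‖q'‖ < T')
    (hT' : ((m * T' : ℝ) : ℂ) = (x * conj x + y * conj y) * T + 2 * (x * conj y * q)
      + 2 * (conj x * y * conj q))
    (hq' : m * q' = x * y * T + x ^ 2 * q + y ^ 2 * conj q) :
    discRoot T' q' * (conj y * discRoot T q + conj x) = x * discRoot T q + y := by
  have hT : 0 < T := (by positivity : (0 : ℝ) ≤ 2 * ‖q‖).trans_lt h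
  have hz : ‖discRoot T q‖ < 1 := (norm_discRoot_le h).trans_lt ((div_lt_one hT).2 h)
  have hroot := discRoot_eq h
  set z := discRoot T q
  have hne := mobius_denom_ne_zero hxy hz
  have hn := normSq_mobius (z := z) hxy
  have hle : ‖(x * z + y) / (conj y * z + conj x)‖ ≤ 1 := by
    rw [norm_div, div_le_one (norm_pos_iff.2 hne)]
    refine abs_le_of_sq_le_sq' ?_ (norm_nonneg _) |>.2
    nlinarith [norm_nonneg z]
  have hcq' : m * conj q' = conj x * conj y * T + conj x ^ 2 * conj q + conj y ^ 2 * q := by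
    have := congrArg conj hq'
    simpa using this
  have hm' : (m : ℂ) ≠ 0 := by exact_mod_cast hm.ne'
  have hw : (x * z + y) / (conj y * z + conj x) * (conj y * z + conj x) = x * z + y :=
    div_mul_cancel₀ _ hne
  set w := (x * z + y) / (conj y * z + conj x)
  -- For a moment matrix `M` with trace `T` and off-diagonal entry `q`, the root says that `(z, 1)`
  -- is an eigenvector of `MJ`, `J = diag(1, -1)`. Since `A*J = JA⁻¹`, replacing `M` by `AMA*`
  -- conjugates `MJ` by `A`, so the Möbius image of `z` is a root for the new data. The identity is
  -- checked after clearing `m` and the squared denominator.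
  have key := eq_discRoot h' hle (by
    refine mul_left_cancel₀ (mul_ne_zero hm' (pow_ne_zero 2 hne)) ?_
    push_cast at hT'
    linear_combination (x * z + y) ^ 2 * hcq' - (x * z + y) * (conj y * z + conj x) * hT'
      + (conj y * z + conj x) ^ 2 * hq' + (x * conj x - y * conj y) ^ 2 * hroot
      + (m * conj q' * (w * (conj y * z + conj x) + (x * z + y))
        - m * T' * (conj y * z + conj x)) * hw)
  rw [← key, hw]

end QPCocycle
end

/-! ### The invariant measurable section. -/

open scoped ContDiff
noncomputable section
namespace QPCocycle

open MeasureTheory Matrix ComplexConjugate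

theorem integral_closedBall_sq_sub_pos {η : ℝ} (hη : 0 < η) :
    0 < ∫ v in Metric.closedBall (0 : Fin 2 → ℂ) η, (‖v 0‖ - ‖v 1‖) ^ 2 := by
  have hcont : Continuous fun v : Fin 2 → ℂ => (‖v 0‖ - ‖v 1‖) ^ 2 := by fun_prop
  rw [setIntegral_pos_iff_support_of_nonneg_ae (Filter.Eventually.of_forall fun v => sq_nonneg _)
    (hcont.continuousOn.integrableOn_compact (isCompact_closedBall 0 η))]
  have hopen : IsOpen ({v : Fin 2 → ℂ | (‖v 0‖ - ‖v 1‖) ^ 2 ≠ 0} ∩ Metric.ball 0 η) :=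
    (isOpen_ne_fun hcont continuous_const).inter Metric.isOpen_ball
  refine (hopen.measure_pos volume ⟨![(η / 2 : ℝ), 0], ?_, ?_⟩).trans_le
    (measure_mono (Set.inter_subset_inter (fun v hv => hv) Metric.ball_subset_closedBall))
  · simp [hη.ne']
  · rw [mem_ball_zero_iff, pi_norm_lt_iff hη]
    intro i
    fin_cases i
    · simp [abs_of_pos hη, hη]
    · simp [hη]

/-- A cocycle in `SU(1,1)` with bounded fibered products preserves a measurable section with values
in a compact subset of the unit disc. -/
theorem BoundedFiberedProducts.exists_invariant_section {α : UnitAddCircle} {x y : UnitAddCircle → ℂ}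
    (hx : Continuous x) (hy : Continuous y) (hxy : ∀ θ, x θ * conj (x θ) - y θ * conj (y θ) = 1)
    (h : BoundedFiberedProducts α fun θ => su11 (x θ) (y θ)) :
    ∃ z : UnitAddCircle → ℂ, Measurable z ∧ (∃ ρ < 1, ∀ θ, ‖z θ‖ ≤ ρ) ∧
      ∀ θ, z (θ + α) * (conj (y θ) * z θ + conj (x θ)) = x θ * z θ + y θ := by
  set A : UnitAddCircle → Matrix (Fin 2) (Fin 2) ℂ := fun θ => su11 (x θ) (y θ) with hAdef
  have hA : ∀ θ, IsUnit (A θ) := fun θ => isUnit_su11 (hxy θ)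
  have hc : Continuous A := by
    refine continuous_matrix fun i j => ?_
    fin_cases i <;> fin_cases j <;> simp [A, su11] <;> fun_prop
  set K := boundedVectors α A with hK
  have hmeas := measurableSet_boundedVectors hA hc (α := α)
  have hKm : ∀ θ, MeasurableSet (K θ) := fun θ => measurable_prodMk_left hmeas
  obtain ⟨η, hη, hball⟩ := h.exists_closedBall_subset
  have hint : ∀ {F : Type} [NormedAddCommGroup F] (f : (Fin 2 → ℂ) → F), Continuous f → ∀ θ,
      IntegrableOn f (K θ) := fun f hf θ =>
    (hf.continuousOn.integrableOn_compact (isCompact_closedBall 0 1)).mono_set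
      (boundedVectors_subset α A θ)
  have hsm : ∀ {F : Type} [NormedAddCommGroup F] [NormedSpace ℝ F] [SecondCountableTopology F]
      [MeasurableSpace F] [BorelSpace F]
      (f : (Fin 2 → ℂ) → F), Continuous f → Measurable fun θ => ∫ v in K θ, f v := by
    intro F _ _ _ _ _ f hf
    have h1 : StronglyMeasurable fun p : UnitAddCircle × (Fin 2 → ℂ) => (K p.1).indicator f p.2 := by
      have : (fun p : UnitAddCircle × (Fin 2 → ℂ) => (K p.1).indicator f p.2) =
          {p : UnitAddCircle × (Fin 2 → ℂ) | p.2 ∈ K p.1}.indicator fun p => f p.2 := by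
        funext p
        simp [Set.indicator]
      rw [this]
      exact (hf.comp continuous_snd).stronglyMeasurable.indicator hmeas
    simp only [← integral_indicator (hKm _)]
    exact (h1.integral_prod_right' (ν := volume)).measurable
  set T : UnitAddCircle → ℝ := fun θ => ∫ v in K θ, (‖v 0‖ ^ 2 + ‖v 1‖ ^ 2) with hT
  set q : UnitAddCircle → ℂ := fun θ => ∫ v in K θ, v 0 * conj (v 1) with hq
  set δ := ∫ v in Metric.closedBall (0 : Fin 2 → ℂ) η, (‖v 0‖ - ‖v 1‖) ^ 2 with hδ
  have hδ0 : 0 < δ := integral_closedBall_sq_sub_pos hη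
  -- `T - 2|q|` dominates the integral of `(|v₀| - |v₁|)²` over `K θ`, hence over a ball of radius
  -- `η` independent of `θ`. The gap is thus uniform.
  have hgap : ∀ θ, 2 * ‖q θ‖ + δ ≤ T θ := by
    intro θ
    have h1 : ‖q θ‖ ≤ ∫ v in K θ, ‖v 0‖ * ‖v 1‖ := by
      refine (norm_integral_le_integral_norm _).trans (le_of_eq ?_)
      simp
    have h2 : δ ≤ ∫ v in K θ, (‖v 0‖ - ‖v 1‖) ^ 2 :=
      setIntegral_mono_set (hint _ (by fun_prop) θ)
        (Filter.Eventually.of_forall fun v => sq_nonneg _) (hball θ).eventuallyLE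
    have h3 : T θ - 2 * ∫ v in K θ, ‖v 0‖ * ‖v 1‖ = ∫ v in K θ, (‖v 0‖ - ‖v 1‖) ^ 2 := by
      rw [← integral_const_mul, ← integral_sub (hint _ (by fun_prop) θ) (hint _ (by fun_prop) θ)]
      congr 1
      funext v
      ring
    linarith
  have hgap' : ∀ θ, 2 * ‖q θ‖ < T θ := fun θ => by linarith [hgap θ]
  set B := ∫ v in Metric.closedBall (0 : Fin 2 → ℂ) 1, (‖v 0‖ ^ 2 + ‖v 1‖ ^ 2) with hB
  have hTB : ∀ θ, T θ ≤ B := fun θ =>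
    setIntegral_mono_set (Continuous.continuousOn (by fun_prop)
        |>.integrableOn_compact (isCompact_closedBall 0 1))
      (Filter.Eventually.of_forall fun v => by positivity)
      (boundedVectors_subset α A θ).eventuallyLE
  -- The radius `1 - δ/B` comes from `2|q|/T ≤ 1 - δ/T` and `T ≤ B`.
  refine ⟨fun θ => discRoot (T θ) (q θ), ?_, ⟨1 - δ / B, ?_, fun θ => ?_⟩, fun θ => ?_⟩
  · have hTm : Measurable T := hsm _ (by fun_prop)
    have hqm : Measurable q := hsm _ (by fun_prop)
    unfold discRoot
    fun_prop
  · have : 0 < B := by linarith [hgap 0, hTB 0, norm_nonneg (q 0)]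
    linarith [div_pos hδ0 this]
  · have hT0 : 0 < T θ := by linarith [hgap θ, norm_nonneg (q θ)]
    refine (norm_discRoot_le (hgap' θ)).trans ?_
    have h1 : 2 * ‖q θ‖ / T θ ≤ (T θ - δ) / T θ := by
      gcongr
      linarith [hgap θ]
    rw [sub_div, div_self hT0.ne'] at h1
    have h2 : δ / B ≤ δ / T θ := by
      gcongr
      exact hTB θ
    linarith
  · obtain ⟨m, hm, hmi⟩ := exists_setIntegral_mulVec (hA θ)
    have hmi' := fun {F : Type} [NormedAddCommGroup F] [NormedSpace ℝ F] (f : (Fin 2 → ℂ) → F) =>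
      hmi (K θ) (K (θ + α)) (hKm _) (hKm _) (mulVec_mem_boundedVectors hA θ) f
    have hTc : ∀ θ, ((T θ : ℝ) : ℂ) = ∫ v in K θ, (v 0 * conj (v 0) + v 1 * conj (v 1)) := by
      intro θ
      rw [hT, ← integral_complex_ofReal]
      congr 1
      funext v
      simp [Complex.mul_conj, Complex.normSq_eq_norm_sq]
    have hcq : ∀ θ, conj (q θ) = ∫ v in K θ, v 1 * conj (v 0) := by
      intro θ
      rw [hq, ← integral_conj]
      simp [mul_comm]
    have e0 : ∀ v : Fin 2 → ℂ, (A θ *ᵥ v) 0 = x θ * v 0 + y θ * v 1 := fun v => by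
      simp [A, su11, Matrix.mulVec, dotProduct, Fin.sum_univ_two]
    have e1 : ∀ v : Fin 2 → ℂ, (A θ *ᵥ v) 1 = conj (y θ) * v 0 + conj (x θ) * v 1 := fun v => by
      simp [A, su11, Matrix.mulVec, dotProduct, Fin.sum_univ_two]
    refine discRoot_mobius hm (hxy θ) (hgap' θ) (hgap' _) ?_ ?_
    · have := hmi' fun v => v 0 * conj (v 0) + v 1 * conj (v 1)
      rw [← hTc] at this
      simp only [e0, e1] at this
      rw [Complex.ofReal_mul, ← Complex.real_smul, ← this, hTc, hcq]
      simp only [hq]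
      simp only [← integral_const_mul]
      rw [← integral_add, ← integral_add]
      · congr 1
        funext v
        simp
        ring
      all_goals exact hint _ (by fun_prop) θ
    · have := hmi' fun v => v 0 * conj (v 1)
      simp only [e0, e1] at this
      rw [← Complex.real_smul, ← this, hTc, hcq]
      simp only [hq]
      simp only [← integral_const_mul]
      rw [← integral_add, ← integral_add]
      · congr 1
        funext v
        simp
        ring
      all_goals exact hint _ (by fun_prop) θ

end QPCocycle
end

/-! ### Closed form of the exponential on su(1,1). -/

open scoped ContDiff
noncomputable section
namespace QPCocycle

open Matrix ComplexConjugate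

/-- The entire function `∑ d ^ k / (2k)!`, i.e. `cosh √d`. -/
def coshSqrt (d : ℝ) : ℝ := ∑' k : ℕ, d ^ k / (2 * k).factorial

/-- The entire function `∑ d ^ k / (2k + 1)!`, i.e. `sinh √d / √d`. -/
def sinhcSqrt (d : ℝ) : ℝ := ∑' k : ℕ, d ^ k / (2 * k + 1).factorial

/-- The derivative of `sinhcSqrt`. -/
def sinhcSqrt' (d : ℝ) : ℝ := ∑' k : ℕ, k * d ^ (k - 1) / (2 * k + 1).factorial

/-- Gives a geometric majorant on `|d| ≤ 1`, also for the termwise differentiated series. -/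
theorem mul_two_pow_le_factorial (k : ℕ) : k * 2 ^ k ≤ (2 * k).factorial := by
  induction k with
  | zero => simp
  | succ k ih =>
    rcases Nat.eq_zero_or_pos k with rfl | hk
    · simp
    · rw [show 2 * (k + 1) = 2 * k + 1 + 1 by ring, Nat.factorial_succ, Nat.factorial_succ]
      calc (k + 1) * 2 ^ (k + 1) ≤ (2 * k + 1 + 1) * ((2 * k + 1) * (k * 2 ^ k)) := by
            rw [pow_succ]
            have : 1 ≤ (2 * k + 1) * k := Nat.mul_pos (by omega) hk
            nlinarith [Nat.mul_le_mul_left ((2 * k + 1 + 1) * 2 ^ k) this]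
        _ ≤ _ := by gcongr

theorem mul_two_pow_succ_le_factorial (k : ℕ) : k * 2 ^ (k + 1) ≤ (2 * k + 1).factorial := by
  rcases Nat.eq_zero_or_pos k with rfl | hk
  · simp
  · rw [Nat.factorial_succ]
    calc k * 2 ^ (k + 1) = 2 * (k * 2 ^ k) := by ring
      _ ≤ (2 * k + 1) * (2 * k).factorial :=
        Nat.mul_le_mul (by omega) (mul_two_pow_le_factorial k)

theorem two_pow_le_factorial (k : ℕ) : 2 ^ k ≤ (2 * k).factorial := by
  rcases Nat.eq_zero_or_pos k with rfl | hk
  · simp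
  · exact (Nat.le_mul_of_pos_left _ hk).trans (mul_two_pow_le_factorial k)

theorem two_pow_le_factorial_succ (k : ℕ) : 2 ^ k ≤ (2 * k + 1).factorial :=
  (two_pow_le_factorial k).trans (Nat.factorial_le (by omega))

theorem abs_mul_pow_div_le {d : ℝ} (hd : |d| ≤ 1) {c : ℝ} (hc : 0 ≤ c) (j k : ℕ) {N : ℕ}
    (hN : 0 < N) (h : c * 2 ^ k ≤ N) : ‖c * d ^ j / N‖ ≤ (1 / 2) ^ k := by
  rw [norm_div, norm_mul, norm_pow, Real.norm_natCast, Real.norm_of_nonneg hc, Real.norm_eq_abs,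
    div_le_iff₀ (by exact_mod_cast hN)]
  calc c * |d| ^ j ≤ c * 1 := by gcongr; exact pow_le_one₀ (abs_nonneg _) hd
    _ = (1 / 2) ^ k * (c * 2 ^ k) := by
      rw [mul_left_comm, ← mul_pow]; norm_num
    _ ≤ _ := by gcongr

theorem summable_half_pow : Summable fun k : ℕ => (1 / 2 : ℝ) ^ k := summable_geometric_two

theorem summable_coshSqrt {d : ℝ} (hd : |d| ≤ 1) :
    Summable fun k : ℕ => d ^ k / (2 * k).factorial :=
  Summable.of_norm_bounded summable_half_pow fun k => by
    simpa using abs_mul_pow_div_le hd zero_le_one k k (Nat.factorial_pos _)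
      (by rw [one_mul]; exact_mod_cast two_pow_le_factorial k)

theorem norm_sinhcSqrt_term_le {d : ℝ} (hd : |d| ≤ 1) (k : ℕ) :
    ‖d ^ k / ((2 * k + 1).factorial : ℝ)‖ ≤ (1 / 2) ^ k := by
  simpa using abs_mul_pow_div_le hd zero_le_one k k (Nat.factorial_pos _)
      (by rw [one_mul]; exact_mod_cast two_pow_le_factorial_succ k)

theorem summable_sinhcSqrt {d : ℝ} (hd : |d| ≤ 1) :
    Summable fun k : ℕ => d ^ k / (2 * k + 1).factorial :=
  Summable.of_norm_bounded summable_half_pow fun k => norm_sinhcSqrt_term_le hd k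

theorem norm_sinhcSqrt'_term_le {d : ℝ} (hd : |d| ≤ 1) (k : ℕ) :
    ‖(k : ℝ) * d ^ (k - 1) / ((2 * k + 1).factorial : ℝ)‖ ≤ (1 / 2) ^ (k + 1) :=
  abs_mul_pow_div_le hd k.cast_nonneg (k - 1) (k + 1) (Nat.factorial_pos _)
    (by exact_mod_cast mul_two_pow_succ_le_factorial k)

theorem hasDerivAt_coshSqrt {d : ℝ} (hd : |d| < 1) : HasDerivAt coshSqrt (sinhcSqrt d / 2) d := by
  have h := hasDerivAt_tsum_of_isPreconnected (𝕜 := ℝ) (F := ℝ)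
    (g := fun (k : ℕ) (d : ℝ) => d ^ k / (2 * k).factorial)
    (g' := fun (k : ℕ) (d : ℝ) => k * d ^ (k - 1) / (2 * k).factorial) (t := Metric.ball 0 1)
    (y₀ := d) (y := d) summable_half_pow Metric.isOpen_ball (convex_ball 0 1).isPreconnected
    (fun k y _ => (hasDerivAt_pow k y).div_const _)
    (fun k y hy => abs_mul_pow_div_le (by simpa using (mem_ball_zero_iff.1 hy).le) k.cast_nonneg
      (k - 1) k (Nat.factorial_pos _) (by exact_mod_cast mul_two_pow_le_factorial k))
    (by simpa using hd) (summable_coshSqrt hd.le) (by simpa using hd)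
  convert! h using 1
  -- The term `k = 0` vanishes, and `(k+1)/(2k+2)! = 1/(2·(2k+1)!)` identifies the shifted series.
  rw [Summable.tsum_eq_zero_add, sinhcSqrt, ← tsum_div_const]
  · simp only [CharP.cast_eq_zero, zero_mul, zero_div, zero_add]
    congr 1
    funext k
    rw [show 2 * (k + 1) = 2 * k + 1 + 1 by ring, Nat.factorial_succ (2 * k + 1)]
    have : ((2 * k + 1).factorial : ℝ) ≠ 0 := by positivity
    push_cast
    field_simp
    ring
  · exact Summable.of_norm_bounded summable_half_pow fun k => abs_mul_pow_div_le hd.le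
      k.cast_nonneg (k - 1) k (Nat.factorial_pos _) (by exact_mod_cast mul_two_pow_le_factorial k)

theorem hasDerivAt_sinhcSqrt {d : ℝ} (hd : |d| < 1) : HasDerivAt sinhcSqrt (sinhcSqrt' d) d :=
  hasDerivAt_tsum_of_isPreconnected (𝕜 := ℝ) (F := ℝ)
    (g := fun (k : ℕ) (d : ℝ) => d ^ k / (2 * k + 1).factorial)
    (g' := fun (k : ℕ) (d : ℝ) => k * d ^ (k - 1) / (2 * k + 1).factorial) (t := Metric.ball 0 1)
    (y₀ := d) (y := d) ((summable_nat_add_iff 1).2 summable_half_pow) Metric.isOpen_ball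
    (convex_ball 0 1).isPreconnected (fun k y _ => (hasDerivAt_pow k y).div_const _)
    (fun k y hy => norm_sinhcSqrt'_term_le (by simpa using (mem_ball_zero_iff.1 hy).le) k)
    (by simpa using hd) (summable_sinhcSqrt hd.le) (by simpa using hd)

/-- Coefficientwise this is `2k/(2k+1)! = 1/(2k)! - 1/(2k+1)!`. -/
theorem two_mul_sinhcSqrt' {d : ℝ} (hd : |d| ≤ 1) :
    2 * d * sinhcSqrt' d = coshSqrt d - sinhcSqrt d := by
  rw [sinhcSqrt', coshSqrt, sinhcSqrt, ← (summable_coshSqrt hd).tsum_sub (summable_sinhcSqrt hd),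
    ← tsum_mul_left]
  congr 1
  funext k
  rw [Nat.factorial_succ (2 * k)]
  have : ((2 * k).factorial : ℝ) ≠ 0 := by positivity
  push_cast
  rcases k with _ | k
  · simp
  · simp only [Nat.add_sub_cancel]
    field_simp
    push_cast
    ring

theorem abs_sinhcSqrt_le {d : ℝ} (hd : |d| ≤ 1) : |sinhcSqrt d| ≤ 2 := by
  have := tsum_of_norm_bounded hasSum_geometric_two (norm_sinhcSqrt_term_le hd)
  exact this

theorem abs_sinhcSqrt'_le {d : ℝ} (hd : |d| ≤ 1) : |sinhcSqrt' d| ≤ 1 := by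
  have h : HasSum (fun k : ℕ => (1 / 2 : ℝ) ^ (k + 1)) 1 := by
    have := hasSum_geometric_two.mul_left (1 / 2 : ℝ)
    norm_num at this ⊢
    simpa [pow_succ, mul_comm] using this
  exact tsum_of_norm_bounded h (norm_sinhcSqrt'_term_le hd)

theorem coshSqrt_zero : coshSqrt 0 = 1 := by
  rw [coshSqrt, tsum_eq_single 0 (fun k hk => by simp [hk])]
  simp

theorem sinhcSqrt_zero : sinhcSqrt 0 = 1 := by
  rw [sinhcSqrt, tsum_eq_single 0 (fun k hk => by simp [hk])]
  simp

theorem abs_coshSqrt_sub_one_le {d : ℝ} (hd : |d| < 1) : |coshSqrt d - 1| ≤ |d| := by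
  have := (convex_ball (0 : ℝ) 1).norm_image_sub_le_of_norm_hasDerivWithin_le (f := coshSqrt)
    (f' := fun d => sinhcSqrt d / 2) (C := 1) (x := 0) (y := d)
    (fun x hx => (hasDerivAt_coshSqrt (by simpa using hx)).hasDerivWithinAt)
    (fun x hx => by
      have := abs_sinhcSqrt_le (d := x) (by simpa using (mem_ball_zero_iff.1 hx).le)
      rw [Real.norm_eq_abs, abs_div, abs_two]
      linarith) (by simp) (by simpa using hd)
  simpa [coshSqrt_zero] using this

theorem abs_sinhcSqrt_sub_one_le {d : ℝ} (hd : |d| < 1) : |sinhcSqrt d - 1| ≤ |d| := by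
  have := (convex_ball (0 : ℝ) 1).norm_image_sub_le_of_norm_hasDerivWithin_le (f := sinhcSqrt)
    (f' := sinhcSqrt') (C := 1) (x := 0) (y := d)
    (fun x hx => (hasDerivAt_sinhcSqrt (by simpa using hx)).hasDerivWithinAt)
    (fun x hx => abs_sinhcSqrt'_le (d := x) (by simpa using (mem_ball_zero_iff.1 hx).le))
    (by simp) (by simpa using hd)
  simpa [sinhcSqrt_zero] using this

/-- This is `cosh² - sinh² = 1` without square roots, valid for both signs of `d`. With `C, S` the
two functions, the derivative is `S(C - S - 2dS')`, which vanishes by `two_mul_sinhcSqrt'`. -/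
theorem coshSqrt_sq_sub {d : ℝ} (hd : |d| < 1) : coshSqrt d ^ 2 - d * sinhcSqrt d ^ 2 = 1 := by
  have hderiv : ∀ x ∈ Metric.ball (0 : ℝ) 1,
      HasDerivAt (fun d => coshSqrt d ^ 2 - d * sinhcSqrt d ^ 2) 0 x := by
    intro x hx
    have hx' : |x| < 1 := by simpa using hx
    convert! ((hasDerivAt_coshSqrt hx').pow 2).sub
      ((hasDerivAt_id x).mul ((hasDerivAt_sinhcSqrt hx').pow 2)) using 1
    simp only [Pi.pow_apply, id]
    norm_num
    linear_combination (sinhcSqrt x) * two_mul_sinhcSqrt' hx'.le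
  have := (convex_ball (0 : ℝ) 1).norm_image_sub_le_of_norm_hasDerivWithin_le
    (f := fun d => coshSqrt d ^ 2 - d * sinhcSqrt d ^ 2) (f' := fun _ => 0) (C := 0) (x := 0)
    (y := d) (fun x hx => (hderiv x hx).hasDerivWithinAt) (by simp) (by simp) (by simpa using hd)
  simp only [zero_mul] at this
  replace this := norm_le_zero_iff.1 this
  simpa [coshSqrt_zero, sub_eq_zero] using this

/-- Minus the determinant of the matrix `{t, ν}`. -/
def discr (u : SU11Coord) : ℝ := ‖u.2‖ ^ 2 - u.1 ^ 2

/-- Cayley–Hamilton for a traceless matrix. It makes even powers scalar, so the exponential series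
splits into its even and odd parts. -/
theorem toMatrix_mul_self (u : SU11Coord) :
    toMatrix u * toMatrix u = ((discr u : ℝ) : ℂ) • (1 : Matrix (Fin 2) (Fin 2) ℂ) := by
  have h : u.2 * conj u.2 = (‖u.2‖ : ℂ) ^ 2 := by
    rw [Complex.mul_conj, Complex.normSq_eq_norm_sq]; push_cast; rfl
  ext i j
  fin_cases i <;> fin_cases j <;> simp [toMatrix, discr] <;>
    ring_nf <;> rw [Complex.I_sq] <;>
    linear_combination h

section
attribute [local instance] Matrix.linftyOpNormedRing Matrix.linftyOpNormedAlgebra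

theorem exp_toMatrix {u : SU11Coord} (hd : |discr u| ≤ 1) :
    NormedSpace.exp (toMatrix u) =
      ((coshSqrt (discr u) : ℝ) : ℂ) • (1 : Matrix (Fin 2) (Fin 2) ℂ) +
        ((sinhcSqrt (discr u) : ℝ) : ℂ) • toMatrix u := by
  have hev : ∀ k : ℕ, toMatrix u ^ (2 * k) = ((discr u ^ k : ℝ) : ℂ) • 1 := by
    intro k
    rw [pow_mul, sq, toMatrix_mul_self, smul_pow, one_pow, Complex.ofReal_pow]
  have h1 := (Complex.hasSum_ofReal.2 (summable_coshSqrt hd).hasSum).smul_const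
    (1 : Matrix (Fin 2) (Fin 2) ℂ)
  have h2 := (Complex.hasSum_ofReal.2 (summable_sinhcSqrt hd).hasSum).smul_const (toMatrix u)
  refine (NormedSpace.exp_series_hasSum_exp' (𝕂 := ℂ) (toMatrix u)).unique
    (HasSum.even_add_odd ?_ ?_)
  · convert! h1 using 2 with k
    rw [hev, smul_smul]
    push_cast
    rw [mul_comm, div_eq_mul_inv]
  · convert! h2 using 2 with k
    rw [pow_succ, hev, smul_mul_assoc, one_mul, smul_smul]
    push_cast
    rw [mul_comm, div_eq_mul_inv]

end

/-- The diagonal entry of `e^{t, ν}`. -/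
def expDiag (u : SU11Coord) : ℂ :=
  coshSqrt (discr u) + (sinhcSqrt (discr u) * u.1 : ℝ) * Complex.I

/-- The off-diagonal entry of `e^{t, ν}`. -/
def expOff (u : SU11Coord) : ℂ := (sinhcSqrt (discr u) : ℂ) * u.2

theorem exp_toMatrix_eq_su11 {u : SU11Coord} (hd : |discr u| ≤ 1) :
    NormedSpace.exp (toMatrix u) = su11 (expDiag u) (expOff u) := by
  rw [exp_toMatrix hd]
  ext i j
  fin_cases i <;> fin_cases j <;> simp [toMatrix, su11, expDiag, expOff] <;> ring

theorem expDiag_mul_conj_sub {u : SU11Coord} (hd : |discr u| < 1) :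
    expDiag u * conj (expDiag u) - expOff u * conj (expOff u) = 1 := by
  have h := coshSqrt_sq_sub hd
  have h' : ((coshSqrt (discr u) ^ 2 - (‖u.2‖ ^ 2 - u.1 ^ 2) * sinhcSqrt (discr u) ^ 2 : ℝ) : ℂ)
      = 1 := by
    rw [← Complex.ofReal_one, ← h]; rfl
  have hn : u.2 * conj u.2 = (‖u.2‖ : ℂ) ^ 2 := by
    rw [Complex.mul_conj, Complex.normSq_eq_norm_sq]; push_cast; rfl
  simp only [expDiag, expOff, map_add, map_mul, Complex.conj_ofReal, Complex.conj_I]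
  push_cast at h' ⊢
  linear_combination h' - (sinhcSqrt (discr u) : ℂ) ^ 2 * hn
    - (sinhcSqrt (discr u) * u.1 : ℂ) ^ 2 * Complex.I_sq

end QPCocycle
end

/-! ### Second-order estimates for `e^{t,ν}` and its logarithmic derivative. -/

open scoped ContDiff
noncomputable section
namespace QPCocycle

open ComplexConjugate

/-- The derivative of `discr` at `u` in the direction `u'`. -/
def discr' (u u' : SU11Coord) : ℝ := 2 * (conj u.2 * u'.2).re - 2 * u.1 * u'.1

/-- The derivative of `expDiag` at `u` in the direction `u'`. -/
def expDiag' (u u' : SU11Coord) : ℂ :=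
  (sinhcSqrt (discr u) / 2 * discr' u u' : ℝ) +
    (sinhcSqrt' (discr u) * discr' u u' * u.1 + sinhcSqrt (discr u) * u'.1 : ℝ) * Complex.I

/-- The derivative of `expOff` at `u` in the direction `u'`. -/
def expOff' (u u' : SU11Coord) : ℂ :=
  (sinhcSqrt' (discr u) * discr' u u' : ℝ) * u.2 + (sinhcSqrt (discr u) : ℂ) * u'.2

theorem hasDerivAt_discr {f : ℝ → SU11Coord} {f' : SU11Coord} {x : ℝ} (hf : HasDerivAt f f' x) :
    HasDerivAt (fun y => discr (f y)) (discr' (f x) f') x := by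
  have h1 : HasDerivAt (fun y => (f y).1) f'.1 x := hf.fst
  have h2 : HasDerivAt (fun y => (f y).2) f'.2 x := hf.snd
  have h3 := h2.norm_sq
  have h4 := h3.sub (h1.pow 2)
  refine (h4.congr_deriv ?_).congr_of_eventuallyEq (Filter.Eventually.of_forall fun y => rfl)
  simp [discr', Complex.inner]
  ring

theorem hasDerivAt_expDiag {f : ℝ → SU11Coord} {f' : SU11Coord} {x : ℝ} (hf : HasDerivAt f f' x)
    (hd : |discr (f x)| < 1) :
    HasDerivAt (fun y => expDiag (f y)) (expDiag' (f x) f') x := by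
  have h1 : HasDerivAt (fun y => (f y).1) f'.1 x := hf.fst
  have hc := (hasDerivAt_coshSqrt hd).comp x (hasDerivAt_discr hf)
  have hs := (hasDerivAt_sinhcSqrt hd).comp x (hasDerivAt_discr hf)
  exact hc.ofReal_comp.add ((hs.mul h1).ofReal_comp.mul_const Complex.I)

theorem hasDerivAt_expOff {f : ℝ → SU11Coord} {f' : SU11Coord} {x : ℝ} (hf : HasDerivAt f f' x)
    (hd : |discr (f x)| < 1) :
    HasDerivAt (fun y => expOff (f y)) (expOff' (f x) f') x := by
  have h2 : HasDerivAt (fun y => (f y).2) f'.2 x := hf.snd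
  have hs := (hasDerivAt_sinhcSqrt hd).comp x (hasDerivAt_discr hf)
  exact hs.ofReal_comp.mul h2

section Estimates

variable {u u' : SU11Coord} {ε : ℝ}

theorem abs_fst_le (hu : ‖u‖ ≤ ε) : |u.1| ≤ ε := (norm_fst_le u).trans hu

theorem norm_snd_le' (hu : ‖u‖ ≤ ε) : ‖u.2‖ ≤ ε := (norm_snd_le u).trans hu

theorem abs_discr_le (hu : ‖u‖ ≤ ε) : |discr u| ≤ ε ^ 2 := by
  have h1 := abs_fst_le hu
  have h2 := norm_snd_le' hu
  have h3 : u.1 ^ 2 ≤ ε ^ 2 := sq_le_sq' (by linarith [neg_abs_le u.1]) ((le_abs_self _).trans h1)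
  have h4 : ‖u.2‖ ^ 2 ≤ ε ^ 2 := by gcongr
  rw [discr, abs_le]
  constructor <;> nlinarith [sq_nonneg u.1, sq_nonneg ‖u.2‖]

theorem abs_discr'_le (hu : ‖u‖ ≤ ε) (hu' : ‖u'‖ ≤ ε) : |discr' u u'| ≤ 4 * ε ^ 2 := by
  have h0 : 0 ≤ ε := (norm_nonneg _).trans hu
  have h1 : |(conj u.2 * u'.2).re| ≤ ε * ε := by
    refine (Complex.abs_re_le_norm _).trans ?_
    rw [norm_mul, RCLike.norm_conj]
    exact mul_le_mul (norm_snd_le' hu) (norm_snd_le' hu') (norm_nonneg _) h0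
  have h2 : |u.1 * u'.1| ≤ ε * ε := by
    rw [abs_mul]
    exact mul_le_mul (abs_fst_le hu) (abs_fst_le hu') (abs_nonneg _) h0
  rw [abs_le] at h1 h2
  rw [discr', abs_le]
  constructor <;> nlinarith

theorem sinhcSqrt_bounds (hε : ε ≤ 1 / 100) (hu : ‖u‖ ≤ ε) :
    |sinhcSqrt (discr u) - 1| ≤ ε / 100 ∧ |coshSqrt (discr u) - 1| ≤ ε / 100 ∧
      |sinhcSqrt' (discr u)| ≤ 1 := by
  have h0 : 0 ≤ ε := (norm_nonneg _).trans hu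
  have h1 := abs_discr_le hu
  have h2 : ε ^ 2 ≤ ε / 100 := by nlinarith
  have h3 : |discr u| < 1 := by linarith
  exact ⟨(abs_sinhcSqrt_sub_one_le h3).trans (by linarith),
    (abs_coshSqrt_sub_one_le h3).trans (by linarith), abs_sinhcSqrt'_le h3.le⟩

theorem norm_expDiag_sub_one_le (hε : ε ≤ 1 / 100) (hu : ‖u‖ ≤ ε) : ‖expDiag u - 1‖ ≤ 2 * ε := by
  obtain ⟨hs, hc, -⟩ := sinhcSqrt_bounds hε hu
  have h0 : 0 ≤ ε := (norm_nonneg _).trans hu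
  have e : expDiag u - 1 = ((coshSqrt (discr u) - 1 : ℝ) : ℂ) +
      ((sinhcSqrt (discr u) * u.1 : ℝ) : ℂ) * Complex.I := by
    rw [expDiag]; push_cast; ring
  rw [e]
  refine (norm_add_le _ _).trans ?_
  rw [norm_mul, Complex.norm_I, mul_one, Complex.norm_real, Complex.norm_real, Real.norm_eq_abs,
    Real.norm_eq_abs, abs_mul]
  have hs' : |sinhcSqrt (discr u)| ≤ 3 / 2 := by
    rw [abs_le] at hs ⊢; constructor <;> linarith
  have := mul_le_mul hs' (abs_fst_le hu) (abs_nonneg _) (by norm_num)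
  linarith

theorem norm_expOff_sub_le (hε : ε ≤ 1 / 100) (hu : ‖u‖ ≤ ε) :
    ‖expOff u - u.2‖ ≤ ε * ‖u.2‖ := by
  obtain ⟨hs, -, -⟩ := sinhcSqrt_bounds hε hu
  have h0 : 0 ≤ ε := (norm_nonneg _).trans hu
  have e : expOff u - u.2 = ((sinhcSqrt (discr u) - 1 : ℝ) : ℂ) * u.2 := by
    rw [expOff]; push_cast; ring
  rw [e, norm_mul, Complex.norm_real, Real.norm_eq_abs]
  gcongr
  linarith

theorem norm_expDiag'_le (hε : ε ≤ 1 / 100) (hu : ‖u‖ ≤ ε) (hu' : ‖u'‖ ≤ ε) :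
    ‖expDiag' u u'‖ ≤ 2 * ε := by
  obtain ⟨hs, -, hs'⟩ := sinhcSqrt_bounds hε hu
  have h0 : 0 ≤ ε := (norm_nonneg _).trans hu
  have hd := abs_discr'_le hu hu'
  have hs1 : |sinhcSqrt (discr u)| ≤ 3 / 2 := by
    rw [abs_le] at hs ⊢; constructor <;> linarith
  have hε2 : 4 * ε ^ 2 ≤ ε / 25 := by nlinarith
  have hd' : |discr' u u'| ≤ ε / 25 := hd.trans hε2
  rw [expDiag']
  refine (norm_add_le _ _).trans ?_
  rw [norm_mul, Complex.norm_I, mul_one, Complex.norm_real, Complex.norm_real, Real.norm_eq_abs,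
    Real.norm_eq_abs, abs_mul, abs_div, abs_two]
  have h1 : |sinhcSqrt (discr u)| / 2 * |discr' u u'| ≤ 1 * (ε / 25) := by gcongr; linarith
  have h2 : |sinhcSqrt' (discr u) * discr' u u' * u.1| ≤ 1 * (ε / 25) * 1 := by
    rw [abs_mul, abs_mul]
    gcongr
    exact (abs_fst_le hu).trans (by linarith)
  have h3 : |sinhcSqrt (discr u) * u'.1| ≤ 3 / 2 * ε := by
    rw [abs_mul]
    gcongr
    exact abs_fst_le hu'
  have h4 := abs_add_le (sinhcSqrt' (discr u) * discr' u u' * u.1) (sinhcSqrt (discr u) * u'.1)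
  linarith

theorem norm_expOff'_sub_le (hε : ε ≤ 1 / 100) (hu : ‖u‖ ≤ ε) (hu' : ‖u'‖ ≤ ε) :
    ‖expOff' u u' - u'.2‖ ≤ ε * (‖u.2‖ + ‖u'.2‖) := by
  obtain ⟨hs, -, hs'⟩ := sinhcSqrt_bounds hε hu
  have h0 : 0 ≤ ε := (norm_nonneg _).trans hu
  have hd := abs_discr'_le hu hu'
  have hd' : |discr' u u'| ≤ ε := by nlinarith
  have e : expOff' u u' - u'.2 = ((sinhcSqrt' (discr u) * discr' u u' : ℝ) : ℂ) * u.2 +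
      ((sinhcSqrt (discr u) - 1 : ℝ) : ℂ) * u'.2 := by
    rw [expOff']; push_cast; ring
  rw [e]
  refine (norm_add_le _ _).trans ?_
  rw [norm_mul, norm_mul, Complex.norm_real, Complex.norm_real, Real.norm_eq_abs, Real.norm_eq_abs,
    abs_mul, mul_add]
  have h1 : |sinhcSqrt' (discr u)| * |discr' u u'| ≤ 1 * ε := by gcongr
  have h2 : |sinhcSqrt (discr u) - 1| ≤ ε := by linarith
  gcongr
  linarith

/-- The coefficient `a ā' - b̄ b'` of the logarithmic derivative of a curve in `SU(1,1)`. -/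
def logDerivDiag (a b a' b' : ℂ) : ℂ := a * conj a' - conj b * b'

/-- The coefficient `a b̄' - b̄ a'` of the logarithmic derivative of a curve in `SU(1,1)`. -/
def logDerivOff (a b a' b' : ℂ) : ℂ := a * conj b' - conj b * a'

/-- For `ν = ν' = 0` the matrix is diagonal and the quantity is exactly `-t'`, so no error involves
`t` alone. This matters because the error must be quadratic in `ν, ν'`. -/
theorem abs_logDerivDiag_im_le (hε : ε ≤ 1 / 100) (hu : ‖u‖ ≤ ε) (hu' : ‖u'‖ ≤ ε) :
    |(logDerivDiag (expDiag u) (expOff u) (expDiag' u u') (expOff' u u')).im + u'.1 +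
      (conj u.2 * u'.2).im| ≤ 7 * ε * (‖u.2‖ ^ 2 + ‖u'.2‖ ^ 2) := by
  obtain ⟨hs, hc, hs'⟩ := sinhcSqrt_bounds hε hu
  have h0 : 0 ≤ ε := (norm_nonneg _).trans hu
  have hd := abs_discr_le hu
  have hd1 : |discr u| < 1 := by nlinarith
  have hrel := two_mul_sinhcSqrt' hd1.le
  have hdet := coshSqrt_sq_sub hd1
  set S := sinhcSqrt (discr u)
  set S1 := sinhcSqrt' (discr u)
  set C := coshSqrt (discr u)
  have hn : ‖u.2‖ ^ 2 = u.2.re ^ 2 + u.2.im ^ 2 := by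
    rw [← Complex.normSq_eq_norm_sq, Complex.normSq_apply]; ring
  have hdis : discr u = u.2.re ^ 2 + u.2.im ^ 2 - u.1 ^ 2 := by rw [discr, hn]
  set σ := S1 * C - S ^ 2 / 2 with hσ
  -- An exact formula: the relations `2dS' = C - S` and `C² - dS² = 1` remove every term not of
  -- second order in `ν, ν'`.
  have key : (logDerivDiag (expDiag u) (expOff u) (expDiag' u u') (expOff' u u')).im + u'.1 +
      (conj u.2 * u'.2).im = 2 * σ * ‖u.2‖ ^ 2 * u'.1 - 2 * u.1 * σ * (conj u.2 * u'.2).re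
        + (1 - S ^ 2) * (conj u.2 * u'.2).im := by
    rw [hn]
    have r1 : (expDiag u).re = C := by simp [expDiag, C]
    have r2 : (expDiag u).im = S * u.1 := by simp [expDiag, S]
    have r3 : (expOff u).re = S * u.2.re := by simp [expOff, S]
    have r4 : (expOff u).im = S * u.2.im := by simp [expOff, S]
    have r5 : (expDiag' u u').re = S / 2 * discr' u u' := by
      rw [expDiag', Complex.add_re, Complex.re_ofReal_mul, Complex.I_re, Complex.ofReal_re,
        mul_zero, add_zero]
    have r6 : (expDiag' u u').im = S1 * discr' u u' * u.1 + S * u'.1 := by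
      rw [expDiag', Complex.add_im, Complex.im_ofReal_mul, Complex.I_im, Complex.ofReal_im,
        mul_one, zero_add]
    have r7 : (expOff' u u').re = S1 * discr' u u' * u.2.re + S * u'.2.re := by
      rw [expOff', Complex.add_re, Complex.re_ofReal_mul, Complex.re_ofReal_mul]
    have r8 : (expOff' u u').im = S1 * discr' u u' * u.2.im + S * u'.2.im := by
      rw [expOff', Complex.add_im, Complex.im_ofReal_mul, Complex.im_ofReal_mul]
    have r9 : discr' u u' = 2 * (u.2.re * u'.2.re + u.2.im * u'.2.im) - 2 * u.1 * u'.1 := by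
      simp [discr']
    simp only [logDerivDiag, Complex.sub_im, Complex.mul_im, Complex.mul_re, Complex.conj_re,
      Complex.conj_im, r1, r2, r3, r4, r5, r6, r7, r8, r9, hσ]
    have e1 : 2 * (u.2.re ^ 2 + u.2.im ^ 2 - u.1 ^ 2) * S1 = C - S := by rw [← hdis]; exact hrel
    have e2 : C ^ 2 - (u.2.re ^ 2 + u.2.im ^ 2 - u.1 ^ 2) * S ^ 2 = 1 := by rw [← hdis]; exact hdet
    linear_combination (-u'.1 * C) * e1 - u'.1 * e2
  clear_value S S1 C
  have ht := abs_fst_le hu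
  have ht' := abs_fst_le hu'
  clear hdet hrel hdis hd hd1 hn
  have hS2 : |1 - S ^ 2| ≤ ε := by
    rw [abs_le] at hs ⊢
    constructor <;> nlinarith
  have hσ2 : |σ| ≤ 2 := by
    have h1 : |S1 * C| ≤ 1 * (11 / 10) := by
      rw [abs_mul]
      gcongr
      rw [abs_le] at hc ⊢
      constructor <;> linarith
    rw [abs_le] at hs hS2 h1 ⊢
    constructor <;> linarith
  have hre : |(conj u.2 * u'.2).re| ≤ ‖u.2‖ * ‖u'.2‖ := by
    refine (Complex.abs_re_le_norm _).trans ?_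
    rw [norm_mul, RCLike.norm_conj]
  have him : |(conj u.2 * u'.2).im| ≤ ‖u.2‖ * ‖u'.2‖ := by
    refine (Complex.abs_im_le_norm _).trans ?_
    rw [norm_mul, RCLike.norm_conj]
  rw [key]
  have h1 : |2 * σ * ‖u.2‖ ^ 2 * u'.1| ≤ 2 * 2 * ‖u.2‖ ^ 2 * ε := by
    rw [abs_mul, abs_mul, abs_mul, abs_two, abs_of_nonneg (sq_nonneg ‖u.2‖)]
    gcongr
  have h2 : |2 * u.1 * σ * (conj u.2 * u'.2).re| ≤ 2 * ε * 2 * (‖u.2‖ * ‖u'.2‖) := by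
    rw [abs_mul, abs_mul, abs_mul, abs_two]
    gcongr
  have h3 : |(1 - S ^ 2) * (conj u.2 * u'.2).im| ≤ ε * (‖u.2‖ * ‖u'.2‖) := by
    rw [abs_mul]
    gcongr
  have h4 := abs_add_le (2 * σ * ‖u.2‖ ^ 2 * u'.1 - 2 * u.1 * σ * (conj u.2 * u'.2).re)
    ((1 - S ^ 2) * (conj u.2 * u'.2).im)
  have h5 := abs_sub (2 * σ * ‖u.2‖ ^ 2 * u'.1) (2 * u.1 * σ * (conj u.2 * u'.2).re)
  have h6 : ε * (‖u.2‖ * ‖u'.2‖) ≤ ε * ((‖u.2‖ ^ 2 + ‖u'.2‖ ^ 2) / 2) := by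
    gcongr
    nlinarith [sq_nonneg (‖u.2‖ - ‖u'.2‖)]
  nlinarith [mul_nonneg h0 (sq_nonneg ‖u'.2‖), mul_nonneg h0 (sq_nonneg ‖u.2‖)]

theorem norm_logDerivOff_sub_le (hε : ε ≤ 1 / 100) (hu : ‖u‖ ≤ ε) (hu' : ‖u'‖ ≤ ε) :
    ‖logDerivOff (expDiag u) (expOff u) (expDiag' u u') (expOff' u u') - conj u'.2‖ ≤
      9 * ε * (‖u.2‖ + ‖u'.2‖) := by
  have h0 : 0 ≤ ε := (norm_nonneg _).trans hu
  have ha := norm_expDiag_sub_one_le hε hu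
  have hb := norm_expOff_sub_le hε hu
  have ha' := norm_expDiag'_le hε hu hu'
  have hb' := norm_expOff'_sub_le hε hu hu'
  have hb1 : ‖expOff u‖ ≤ 2 * ‖u.2‖ := by
    have := norm_add_le (expOff u - u.2) u.2
    rw [sub_add_cancel] at this
    nlinarith [norm_nonneg u.2]
  have hb2 : ‖expOff' u u'‖ ≤ 2 * (‖u.2‖ + ‖u'.2‖) := by
    have := norm_add_le (expOff' u u' - u'.2) u'.2
    rw [sub_add_cancel] at this
    nlinarith [norm_nonneg u.2, norm_nonneg u'.2]
  have e : logDerivOff (expDiag u) (expOff u) (expDiag' u u') (expOff' u u') - conj u'.2 =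
      (expDiag u - 1) * conj (expOff' u u') + conj (expOff' u u' - u'.2)
        - conj (expOff u) * expDiag' u u' := by
    rw [logDerivOff, map_sub]; ring
  rw [e]
  refine (norm_sub_le _ _).trans ((add_le_add_left (norm_add_le _ _) _).trans ?_)
  rw [norm_mul, norm_mul, RCLike.norm_conj, RCLike.norm_conj, RCLike.norm_conj]
  have h1 : ‖expDiag u - 1‖ * ‖expOff' u u'‖ ≤ 2 * ε * (2 * (‖u.2‖ + ‖u'.2‖)) := by gcongr
  have h2 : ‖expOff u‖ * ‖expDiag' u u'‖ ≤ 2 * ‖u.2‖ * (2 * ε) := by gcongr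
  nlinarith [mul_nonneg h0 (norm_nonneg u.2), mul_nonneg h0 (norm_nonneg u'.2)]

/-- Only an upper bound is needed: this quantity enters through `-π log`, and `log x ≤ x - 1`. -/
theorem normSq_denom_sub_one_le (hε : ε ≤ 1 / 100) (hu : ‖u‖ ≤ ε) (z : ℂ) :
    ‖conj (expOff u) * z + conj (expDiag u)‖ ^ 2 - 1 ≤
      ‖u.2‖ ^ 2 + 2 * (conj u.2 * z).re + 5 * ε * (‖z‖ ^ 2 + ‖u.2‖ ^ 2) := by
  obtain ⟨hs, hc, -⟩ := sinhcSqrt_bounds hε hu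
  have h0 : 0 ≤ ε := (norm_nonneg _).trans hu
  have hd1 : |discr u| < 1 := by nlinarith [abs_discr_le hu]
  have hdet := coshSqrt_sq_sub hd1
  set S := sinhcSqrt (discr u)
  set C := coshSqrt (discr u)
  have hn : ∀ w : ℂ, ‖w‖ ^ 2 = w.re ^ 2 + w.im ^ 2 := fun w => by
    rw [← Complex.normSq_eq_norm_sq, Complex.normSq_apply]; ring
  have hdis : discr u = u.2.re ^ 2 + u.2.im ^ 2 - u.1 ^ 2 := by rw [discr, hn]
  have key : ‖conj (expOff u) * z + conj (expDiag u)‖ ^ 2 - 1 = S ^ 2 * ‖u.2‖ ^ 2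
      + 2 * (C * S) * (conj u.2 * z).re - 2 * S ^ 2 * u.1 * (conj u.2 * z).im
      + S ^ 2 * ‖u.2‖ ^ 2 * ‖z‖ ^ 2 := by
    simp only [hn]
    simp only [expDiag, expOff]
    simp
    simp only [show sinhcSqrt (discr u) = S from rfl, show coshSqrt (discr u) = C from rfl]
    have e2 : C ^ 2 - (u.2.re ^ 2 + u.2.im ^ 2 - u.1 ^ 2) * S ^ 2 = 1 := by rw [← hdis]; exact hdet
    linear_combination e2
  have hS2 : |S ^ 2 - 1| ≤ ε := by
    rw [abs_le] at hs ⊢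
    constructor <;> nlinarith
  have hCS : |C * S - 1| ≤ ε := by
    rw [abs_le] at hs hc ⊢
    constructor <;> nlinarith
  have hre : |(conj u.2 * z).re| ≤ ‖u.2‖ * ‖z‖ := by
    refine (Complex.abs_re_le_norm _).trans ?_
    rw [norm_mul, RCLike.norm_conj]
  have him : |(conj u.2 * z).im| ≤ ‖u.2‖ * ‖z‖ := by
    refine (Complex.abs_im_le_norm _).trans ?_
    rw [norm_mul, RCLike.norm_conj]
  have hS3 : S ^ 2 ≤ 3 / 2 := by rw [abs_le] at hS2; linarith
  have h1 : (S ^ 2 - 1) * ‖u.2‖ ^ 2 ≤ ε * ‖u.2‖ ^ 2 := by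
    gcongr
    exact (le_abs_self _).trans hS2
  have h2 : (C * S - 1) * (conj u.2 * z).re ≤ ε * (‖u.2‖ * ‖z‖) := by
    refine (le_abs_self _).trans ?_
    rw [abs_mul]
    gcongr
  have h3 : -(S ^ 2 * u.1 * (conj u.2 * z).im) ≤ 3 / 2 * ε * (‖u.2‖ * ‖z‖) := by
    refine (neg_le_abs _).trans ?_
    rw [abs_mul, abs_mul, abs_of_nonneg (sq_nonneg S)]
    gcongr
    exact abs_fst_le hu
  have h4 : S ^ 2 * ‖u.2‖ ^ 2 * ‖z‖ ^ 2 ≤ 3 / 2 * ε * ‖z‖ ^ 2 := by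
    have : ‖u.2‖ ^ 2 ≤ ε := by nlinarith [norm_snd_le' hu, norm_nonneg u.2]
    gcongr
  have h6 : ε * (‖u.2‖ * ‖z‖) ≤ ε * ((‖u.2‖ ^ 2 + ‖z‖ ^ 2) / 2) := by
    gcongr
    nlinarith [sq_nonneg (‖u.2‖ - ‖z‖)]
  rw [key]
  nlinarith [mul_nonneg h0 (sq_nonneg ‖z‖), mul_nonneg h0 (sq_nonneg ‖u.2‖)]

/-- Only a lower bound is needed: the numerator enters the combined identity with the positive
weight `m`. -/
theorem normSq_num_ge (hε : ε ≤ 1 / 100) (hu : ‖u‖ ≤ ε) (z : ℂ) :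
    ‖z + u.2‖ ^ 2 - 8 * ε * (‖z‖ ^ 2 + ‖u.2‖ ^ 2) ≤ ‖expDiag u * z + expOff u‖ ^ 2 := by
  have h0 : 0 ≤ ε := (norm_nonneg _).trans hu
  have ha := norm_expDiag_sub_one_le hε hu
  have hb := norm_expOff_sub_le hε hu
  have he : ‖(z + u.2) - (expDiag u * z + expOff u)‖ ≤ 2 * ε * (‖z‖ + ‖u.2‖) := by
    have e : (z + u.2) - (expDiag u * z + expOff u) =
        -((expDiag u - 1) * z + (expOff u - u.2)) := by ring
    rw [e, norm_neg]
    refine (norm_add_le _ _).trans ?_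
    rw [norm_mul]
    nlinarith [mul_le_mul_of_nonneg_right ha (norm_nonneg z), mul_nonneg h0 (norm_nonneg u.2)]
  have h1 := norm_sub_norm_le (z + u.2) (expDiag u * z + expOff u)
  have h2 := norm_add_le z u.2
  set N := ‖expDiag u * z + expOff u‖
  set P := ‖z + u.2‖
  have hN : 0 ≤ N := norm_nonneg _
  have hP : 0 ≤ P := norm_nonneg _
  have h3 : P - 2 * ε * (‖z‖ + ‖u.2‖) ≤ N := by linarith
  have h4 : P * (2 * ε * (‖z‖ + ‖u.2‖)) ≤ (‖z‖ + ‖u.2‖) * (2 * ε * (‖z‖ + ‖u.2‖)) := by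
    gcongr
  have h5 : 2 * ((‖z‖ + ‖u.2‖) * (2 * ε * (‖z‖ + ‖u.2‖))) ≤ 8 * ε * (‖z‖ ^ 2 + ‖u.2‖ ^ 2) := by
    nlinarith [mul_nonneg h0 (sq_nonneg (‖z‖ - ‖u.2‖))]
  have h6 : P ^ 2 - 2 * (P * (2 * ε * (‖z‖ + ‖u.2‖))) ≤ N ^ 2 := by
    rcases le_total 0 (P - 2 * ε * (‖z‖ + ‖u.2‖)) with h | h
    · nlinarith [sq_nonneg (2 * ε * (‖z‖ + ‖u.2‖))]
    · nlinarith [sq_nonneg N]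
  linarith

end Estimates

end QPCocycle
end

/-! ### Pointwise bounds for the quadratic form. -/

open scoped ContDiff
noncomputable section
namespace QPCocycle

open ComplexConjugate

/-- The quadratic form governing the second order expansion of the energy and exponent identities
of a section `z` of the cocycle `E_r e^{t, ν}`, with `m = 4πr` and `ν'` the derivative of `ν`. -/
def quadForm (m : ℝ) (z ν ν' : ℂ) : ℝ :=
  m * ‖z + ν‖ ^ 2 + (conj ν * ν').im - 2 * (conj ν' * z).im -
    Real.pi * (‖ν‖ ^ 2 + 2 * (conj ν * z).re)

/-- The right side is the density of the energy identity minus `π` times that of the exponent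
identity, so along an invariant section it integrates to zero. The error must not depend on how
close `|z|` is to `1`. -/
theorem quadForm_le {m ε : ℝ} (hm : 4 * Real.pi ≤ m) {u u' : SU11Coord} (hε : ε ≤ 1 / 100)
    (hu : ‖u‖ ≤ ε) (hu' : ‖u'‖ ≤ ε) {z : ℂ} (hz : ‖z‖ < 1) :
    u'.1 + quadForm m z u.2 u'.2 - 13 * m * ε * (‖z‖ ^ 2 + ‖u.2‖ ^ 2 + ‖u'.2‖ ^ 2) ≤
      m * (‖expDiag u * z + expOff u‖ ^ 2 / (1 - ‖z‖ ^ 2)) -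
        ((logDerivDiag (expDiag u) (expOff u) (expDiag' u u') (expOff' u u')).im * (1 + ‖z‖ ^ 2) +
          2 * (logDerivOff (expDiag u) (expOff u) (expDiag' u u') (expOff' u u') * z).im)
          / (1 - ‖z‖ ^ 2) -
        Real.pi * Real.log (‖conj (expOff u) * z + conj (expDiag u)‖ ^ 2) := by
  have h0 : 0 ≤ ε := (norm_nonneg _).trans hu
  have hpi := Real.pi_gt_three
  have hpi' := Real.pi_lt_d2
  have hν := norm_snd_le' hu
  have hν' := norm_snd_le' hu'
  have hν0 := norm_nonneg u.2
  have hν0' := norm_nonneg u'.2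
  have hz0 := norm_nonneg z
  have hnum := normSq_num_ge hε hu z
  have hp := abs_logDerivDiag_im_le hε hu hu'
  have hq := norm_logDerivOff_sub_le hε hu hu'
  have hden := normSq_denom_sub_one_le hε hu z
  have hd1 : |discr u| < 1 := by nlinarith [abs_discr_le hu]
  have hne := mobius_denom_ne_zero (expDiag_mul_conj_sub hd1) hz
  have hlog := Real.log_le_sub_one_of_pos (pow_pos (norm_pos_iff.2 hne) 2)
  set N := ‖expDiag u * z + expOff u‖
  set P := (logDerivDiag (expDiag u) (expOff u) (expDiag' u u') (expOff' u u')).im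
  set Q := logDerivOff (expDiag u) (expOff u) (expDiag' u u') (expOff' u u')
  set Lg := Real.log (‖conj (expOff u) * z + conj (expDiag u)‖ ^ 2)
  set D := ‖conj (expOff u) * z + conj (expDiag u)‖ ^ 2
  have hn1 : 0 < 1 - ‖z‖ ^ 2 := by nlinarith
  -- The weight `1/(1-|z|²)` is `1 + X` with `X` not uniformly bounded. The relation `X = |z|² +
  -- |z|²X` splits an error `εX` into a quadratic part and a multiple of `|z|²X`.
  set X := ‖z‖ ^ 2 / (1 - ‖z‖ ^ 2) with hX
  have hX0 : 0 ≤ X := by positivity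
  have hw : (1 - ‖z‖ ^ 2)⁻¹ = 1 + X := by rw [hX]; field_simp; ring
  have hXX : X = ‖z‖ ^ 2 + ‖z‖ ^ 2 * X := by rw [hX]; field_simp; ring
  have hνε : ‖u.2‖ ^ 2 ≤ ε / 100 := by nlinarith only [hν, hν0, hε]
  have hνε' : ‖u'.2‖ ^ 2 ≤ ε / 100 := by nlinarith only [hν', hν0', hε]
  have hqz : |(Q * z).im - (conj u'.2 * z).im| ≤ 9 * ε * (‖u.2‖ + ‖u'.2‖) * ‖z‖ := by
    rw [← Complex.sub_im, ← sub_mul]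
    refine (Complex.abs_im_le_norm _).trans ?_
    rw [norm_mul]
    gcongr
  have hQn : ‖Q‖ ≤ 2 * ε := by
    have := norm_add_le (Q - conj u'.2) (conj u'.2)
    rw [sub_add_cancel, RCLike.norm_conj] at this
    have h1 : 9 * ε * (‖u.2‖ + ‖u'.2‖) ≤ 9 * ε * (1 / 100 + 1 / 100) := by
      gcongr <;> linarith
    linarith only [this, hq, h1, hν', h0]
  have hQz : |(Q * z).im| ≤ 2 * ε := by
    refine (Complex.abs_im_le_norm _).trans ?_
    rw [norm_mul]
    nlinarith only [norm_nonneg Q, hz0, hz, hQn]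
  have hPn : |P| ≤ 2 * ε := by
    have h1 : |(conj u.2 * u'.2).im| ≤ ε / 100 := by
      refine (Complex.abs_im_le_norm _).trans ?_
      rw [norm_mul, RCLike.norm_conj]
      nlinarith only [sq_nonneg (‖u.2‖ - ‖u'.2‖), hνε, hνε']
    have h2 : 7 * ε * (‖u.2‖ ^ 2 + ‖u'.2‖ ^ 2) ≤ 7 * (1 / 100) * (ε / 100 + ε / 100) := by
      gcongr
    have h3 := abs_fst_le hu'
    have h4 := hp.trans h2
    rw [abs_le] at h1 h3 h4 ⊢
    constructor <;> linarith only [h1.1, h1.2, h3.1, h3.2, h4.1, h4.2, h0]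
  have hzν : ‖z‖ ^ 2 ≤ 2 * ‖z + u.2‖ ^ 2 + 2 * ‖u.2‖ ^ 2 := by
    have h1 := norm_sub_le (z + u.2) u.2
    rw [add_sub_cancel_right] at h1
    have h2 : ‖z‖ ^ 2 ≤ (‖z + u.2‖ + ‖u.2‖) ^ 2 := by gcongr
    nlinarith only [h2, sq_nonneg (‖z + u.2‖ - ‖u.2‖)]
  have hm0 : 12 ≤ m := by linarith
  have hc : u'.1 + quadForm m z u.2 u'.2 - 13 * m * ε * (‖z‖ ^ 2 + ‖u.2‖ ^ 2 + ‖u'.2‖ ^ 2) ≤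
      m * (N ^ 2 * (1 + X)) - (P * (1 + 2 * X) + 2 * (Q * z).im * (1 + X)) - Real.pi * Lg := by
    -- The part `|z+ν|²X` of the main term yields a positive `|z|²X/2`, kept as a reserve against
    -- the unbounded errors.
    have t1 : ‖z + u.2‖ ^ 2 + ‖z‖ ^ 2 * X / 2 - 9 * ε * X - 8 * ε * ‖u.2‖ ^ 2 ≤ N ^ 2 * (1 + X) := by
      have h1 := mul_le_mul_of_nonneg_right hnum (by linarith : 0 ≤ 1 + X)
      have h2 := mul_le_mul_of_nonneg_right hzν hX0
      have h3 := mul_le_mul_of_nonneg_right hνε hX0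
      have h4 : ε * (‖u.2‖ ^ 2 * X) ≤ 1 / 100 * (ε * X) := by
        have h5 : ‖u.2‖ ^ 2 ≤ 1 / 100 := by linarith
        have := mul_le_mul_of_nonneg_right h5 (mul_nonneg h0 hX0)
        linarith
      have h6 : ε * X = ε * ‖z‖ ^ 2 + ε * (‖z‖ ^ 2 * X) := by rw [← mul_add, ← hXX]
      have h7 := mul_nonneg h0 hX0
      have h8 : ‖z‖ ^ 2 * (1 + X) = X := by rw [mul_add, mul_one, ← hXX]
      have h9 : ε * (‖z‖ ^ 2 * (1 + X)) = ε * X := by rw [h8]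
      have h10 : 0 ≤ ‖z‖ ^ 2 * X := by positivity
      have h11 : ‖u.2‖ ^ 2 * X ≤ 1 / 100 * (ε * X) := by linarith only [h3]
      linarith only [h1, h2, h11, h4, h9, h7]
    have t2 : u'.1 + (conj u.2 * u'.2).im - 7 * ε * (‖u.2‖ ^ 2 + ‖u'.2‖ ^ 2) - 4 * ε * X ≤
        -(P * (1 + 2 * X)) := by
      have h1 := (abs_le.1 hp).2
      have h2 := mul_le_mul_of_nonneg_right (abs_le.1 hPn).2 hX0
      linarith only [h1, h2]
    have t3 : -(2 * (conj u'.2 * z).im) - 18 * ε * (‖z‖ ^ 2 + ‖u.2‖ ^ 2 / 2 + ‖u'.2‖ ^ 2 / 2)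
        - 4 * ε * X ≤ -(2 * (Q * z).im * (1 + X)) := by
      have h1 := (abs_le.1 hqz).2
      have h2 := mul_le_mul_of_nonneg_right (abs_le.1 hQz).2 hX0
      have h3 : (‖u.2‖ + ‖u'.2‖) * ‖z‖ ≤ ‖z‖ ^ 2 + ‖u.2‖ ^ 2 / 2 + ‖u'.2‖ ^ 2 / 2 := by
        nlinarith only [sq_nonneg (‖u.2‖ - ‖z‖), sq_nonneg (‖u'.2‖ - ‖z‖)]
      have h4 := mul_le_mul_of_nonneg_left h3 h0
      linarith only [h1, h2, h4]
    have t4 : -(Real.pi * (‖u.2‖ ^ 2 + 2 * (conj u.2 * z).re)) - 16 * ε * (‖z‖ ^ 2 + ‖u.2‖ ^ 2) ≤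
        -(Real.pi * Lg) := by
      have h1 := mul_le_mul_of_nonneg_left (hlog.trans hden) Real.pi_pos.le
      have h2 : Real.pi * (5 * ε * (‖z‖ ^ 2 + ‖u.2‖ ^ 2)) ≤ 3.15 * (5 * ε * (‖z‖ ^ 2 + ‖u.2‖ ^ 2)) := by
        gcongr
      have h3 : 0 ≤ ε * (‖z‖ ^ 2 + ‖u.2‖ ^ 2) := by positivity
      linarith only [h1, h2, h3]
    have t5 := mul_le_mul_of_nonneg_left t1 (by linarith : 0 ≤ m)
    have hY0 : 0 ≤ ‖z‖ ^ 2 * X := by positivity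
    have t6 : (9 * m + 8) * (ε * X) = (9 * m + 8) * (ε * ‖z‖ ^ 2) + (9 * m + 8) * ε * (‖z‖ ^ 2 * X) := by
      rw [mul_assoc (9 * m + 8), ← mul_add, ← mul_add, ← hXX]
    -- The reserve, times `m`, absorbs all errors in `|z|²X`, because `(9m+8)/100 ≤ m/2`.
    have t7 : (9 * m + 8) * ε * (‖z‖ ^ 2 * X) ≤ m / 2 * (‖z‖ ^ 2 * X) := by
      gcongr
      have : (9 * m + 8) * ε ≤ (9 * m + 8) * (1 / 100) := by gcongr
      linarith only [this, hm0]
    have t8 : 42 * (ε * (‖z‖ ^ 2 + ‖u.2‖ ^ 2 + ‖u'.2‖ ^ 2)) ≤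
        4 * m * (ε * (‖z‖ ^ 2 + ‖u.2‖ ^ 2 + ‖u'.2‖ ^ 2)) := by
      gcongr
      linarith
    have t9 : 0 ≤ m * (ε * ‖u.2‖ ^ 2) := by positivity
    have t10 : 0 ≤ m * (ε * ‖u'.2‖ ^ 2) := by positivity
    have t11 : 0 ≤ ε * ‖u.2‖ ^ 2 := by positivity
    have t12 : 0 ≤ ε * ‖u'.2‖ ^ 2 := by positivity
    rw [quadForm]
    linarith only [t2, t3, t4, t5, t6, t7, t8, t9, t10, t11, t12]
  refine hc.trans (le_of_eq ?_)
  have e1 : (1 + ‖z‖ ^ 2) / (1 - ‖z‖ ^ 2) = 1 + 2 * X := by rw [hX]; field_simp; ring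
  rw [div_eq_mul_inv (N ^ 2), hw, add_div, mul_div_assoc P, e1, div_eq_mul_inv (2 * (Q * z).im), hw]

/-- Polarise and apply Young's inequality to the cross terms, leaving `δ` free so that the loss can
be made small against coercivity. The constant rounds up `13.5 + 1`, from the cross terms and the
pure `w, w'` terms. -/
theorem quadForm_add_ge {m δ : ℝ} (hm : 4 * Real.pi ≤ m) (hδ : 0 < δ) (hδ' : δ ≤ 1)
    (z l l' w w' : ℂ) :
    quadForm m z l l' - δ * (‖z‖ ^ 2 + ‖l‖ ^ 2 + ‖l'‖ ^ 2) -
      15 * m ^ 2 / δ * (‖w‖ ^ 2 + ‖w'‖ ^ 2) ≤ quadForm m z (l + w) (l' + w') := by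
  have hpi := Real.pi_gt_three
  have hm0 : 12 ≤ m := by linarith
  have hn : ∀ w : ℂ, ‖w‖ ^ 2 = w.re ^ 2 + w.im ^ 2 := fun w => by
    rw [← Complex.normSq_eq_norm_sq, Complex.normSq_apply]; ring
  have key : quadForm m z (l + w) (l' + w') = quadForm m z l l' + m * (2 * (conj z * w).re +
      2 * (conj l * w).re + ‖w‖ ^ 2) + (conj l * w').im + (conj w * l').im + (conj w * w').im
      - 2 * (conj w' * z).im - Real.pi * (2 * (conj l * w).re + ‖w‖ ^ 2 + 2 * (conj w * z).re) := by
    simp only [quadForm, hn]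
    simp
    ring
  have hre : ∀ x y : ℂ, |(conj x * y).re| ≤ ‖x‖ * ‖y‖ := fun x y => by
    refine (Complex.abs_re_le_norm _).trans ?_
    rw [norm_mul, RCLike.norm_conj]
  have him : ∀ x y : ℂ, |(conj x * y).im| ≤ ‖x‖ * ‖y‖ := fun x y => by
    refine (Complex.abs_im_le_norm _).trans ?_
    rw [norm_mul, RCLike.norm_conj]
  have b1 := (abs_le.1 (hre z w)).1
  have b2 := (abs_le.1 (hre l w)).1
  have b2' := (abs_le.1 (hre l w)).2
  have b3 := (abs_le.1 (him l w')).1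
  have b4 := (abs_le.1 (him w l')).1
  have b5 := (abs_le.1 (him w w')).1
  have b6 := (abs_le.1 (him w' z)).2
  have b7 := (abs_le.1 (hre w z)).2
  set a := ‖z‖ + ‖l‖ + ‖l'‖ with ha
  set b := ‖w‖ + ‖w'‖ with hb
  have hz := norm_nonneg z
  have hl := norm_nonneg l
  have hl' := norm_nonneg l'
  have hw := norm_nonneg w
  have hw' := norm_nonneg w'
  have ha2 : a ^ 2 ≤ 3 * (‖z‖ ^ 2 + ‖l‖ ^ 2 + ‖l'‖ ^ 2) := by
    nlinarith only [ha, sq_nonneg (‖z‖ - ‖l‖), sq_nonneg (‖z‖ - ‖l'‖), sq_nonneg (‖l‖ - ‖l'‖)]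
  have hb2 : b ^ 2 ≤ 2 * (‖w‖ ^ 2 + ‖w'‖ ^ 2) := by
    nlinarith only [hb, sq_nonneg (‖w‖ - ‖w'‖)]
  have hcross : quadForm m z l l' - 3 * m * (a * b) - m * (‖w‖ ^ 2 + ‖w'‖ ^ 2) ≤
      quadForm m z (l + w) (l' + w') := by
    have c1 := mul_le_mul_of_nonneg_left b1 (by linarith : 0 ≤ m)
    have c2 := mul_le_mul_of_nonneg_left b2 (by linarith : 0 ≤ m)
    have c3 := mul_le_mul_of_nonneg_left b2' Real.pi_pos.le
    have c4 := mul_le_mul_of_nonneg_left b7 Real.pi_pos.le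
    have hpm : Real.pi ≤ m / 4 := by linarith
    have c5 : Real.pi * (‖l‖ * ‖w‖) ≤ m / 4 * (‖l‖ * ‖w‖) := by gcongr
    have c6 : Real.pi * (‖w‖ * ‖z‖) ≤ m / 4 * (‖w‖ * ‖z‖) := by gcongr
    have c7 : Real.pi * ‖w‖ ^ 2 ≤ m / 4 * ‖w‖ ^ 2 := by gcongr
    have d1 : ‖l‖ * ‖w'‖ ≤ m / 12 * (‖l‖ * ‖w'‖) := le_mul_of_one_le_left (by positivity) (by linarith)
    have d2 : ‖w‖ * ‖l'‖ ≤ m / 12 * (‖w‖ * ‖l'‖) := le_mul_of_one_le_left (by positivity) (by linarith)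
    have d3 : ‖w'‖ * ‖z‖ ≤ m / 12 * (‖w'‖ * ‖z‖) := le_mul_of_one_le_left (by positivity) (by linarith)
    have d4 : ‖w‖ * ‖w'‖ ≤ m / 12 * (‖w‖ ^ 2 + ‖w'‖ ^ 2) := by
      have : ‖w‖ * ‖w'‖ ≤ 1 * (‖w‖ ^ 2 + ‖w'‖ ^ 2) := by
        nlinarith only [sq_nonneg (‖w‖ - ‖w'‖), sq_nonneg ‖w‖, sq_nonneg ‖w'‖]
      refine this.trans ?_
      gcongr
      linarith
    have p1 : 0 ≤ m * (‖z‖ * ‖w‖) := by positivity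
    have p2 : 0 ≤ m * (‖l‖ * ‖w‖) := by positivity
    have p3 : 0 ≤ m * (‖l'‖ * ‖w‖) := by positivity
    have p4 : 0 ≤ m * (‖z‖ * ‖w'‖) := by positivity
    have p5 : 0 ≤ m * (‖l‖ * ‖w'‖) := by positivity
    have p6 : 0 ≤ m * (‖l'‖ * ‖w'‖) := by positivity
    have p7 : 0 ≤ m * ‖w‖ ^ 2 := by positivity
    have p8 : 0 ≤ m * ‖w'‖ ^ 2 := by positivity
    have e : m * (a * b) = m * (‖z‖ * ‖w‖) + m * (‖l‖ * ‖w‖) + m * (‖l'‖ * ‖w‖) + m * (‖z‖ * ‖w'‖)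
        + m * (‖l‖ * ‖w'‖) + m * (‖l'‖ * ‖w'‖) := by rw [ha, hb]; ring
    rw [key, mul_assoc 3 m, e]
    clear_value a b
    have s1 : -(m * (‖z‖ * ‖w‖) + m * (‖l‖ * ‖w‖)) * 2 + m * ‖w‖ ^ 2 ≤
        m * (2 * (conj z * w).re + 2 * (conj l * w).re + ‖w‖ ^ 2) := by
      linarith only [c1, c2]
    have s2 : Real.pi * (2 * (conj l * w).re + ‖w‖ ^ 2 + 2 * (conj w * z).re) ≤
        m / 2 * (‖l‖ * ‖w‖) + m / 4 * ‖w‖ ^ 2 + m / 2 * (‖w‖ * ‖z‖) := by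
      linarith only [c3, c4, c5, c6, c7]
    linarith only [s1, s2, d1, d2, d3, d4, b3, b4, b5, b6, p1, p2, p3, p4, p5, p6, p7, p8]
  have hyoung : 3 * m * (a * b) ≤ δ / 3 * a ^ 2 + 27 * m ^ 2 / (4 * δ) * b ^ 2 := by
    have : δ / 3 * a ^ 2 + 27 * m ^ 2 / (4 * δ) * b ^ 2 - 3 * m * (a * b) =
        (2 * δ * a - 9 * m * b) ^ 2 / (12 * δ) := by field_simp; ring
    have h2 : 0 ≤ (2 * δ * a - 9 * m * b) ^ 2 / (12 * δ) := by positivity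
    linarith
  have h1 : δ / 3 * a ^ 2 ≤ δ / 3 * (3 * (‖z‖ ^ 2 + ‖l‖ ^ 2 + ‖l'‖ ^ 2)) := by gcongr
  have h2 : 27 * m ^ 2 / (4 * δ) * b ^ 2 ≤ 27 * m ^ 2 / (4 * δ) * (2 * (‖w‖ ^ 2 + ‖w'‖ ^ 2)) := by
    gcongr
  have h3 : m * (‖w‖ ^ 2 + ‖w'‖ ^ 2) ≤ m ^ 2 / δ * (‖w‖ ^ 2 + ‖w'‖ ^ 2) := by
    gcongr
    rw [le_div_iff₀ hδ]
    nlinarith only [hm0, hδ, hδ']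
  have h4 : 27 * m ^ 2 / (4 * δ) * (2 * (‖w‖ ^ 2 + ‖w'‖ ^ 2)) =
      13.5 * (m ^ 2 / δ * (‖w‖ ^ 2 + ‖w'‖ ^ 2)) := by field_simp; norm_num; ring
  have h5 : 15 * m ^ 2 / δ * (‖w‖ ^ 2 + ‖w'‖ ^ 2) = 15 * (m ^ 2 / δ * (‖w‖ ^ 2 + ‖w'‖ ^ 2)) := by
    ring
  have h6 : 0 ≤ m ^ 2 / δ * (‖w‖ ^ 2 + ‖w'‖ ^ 2) := by positivity
  linarith

end QPCocycle
end

/-! ### Difference quotients for a merely measurable section. -/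

open scoped ContDiff
noncomputable section
namespace QPCocycle

open MeasureTheory ComplexConjugate Filter Topology AddCircle Asymptotics

/-- Translations of a bounded measurable function on the circle converge almost everywhere along a
suitable sequence of increments. -/
theorem exists_seq_tendsto_translate {z : UnitAddCircle → ℂ} (hz : Measurable z) {C : ℝ}
    (hC : ∀ θ, ‖z θ‖ ≤ C) :
    ∃ h : ℕ → ℝ, (∀ n, 0 < h n) ∧ Tendsto h atTop (𝓝 0) ∧
      ∀ᵐ θ ∂(haarAddCircle : Measure UnitAddCircle),
        Tendsto (fun n => z (θ + (h n : UnitAddCircle))) atTop (𝓝 (z θ)) := by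
  have hmem : MemLp z 2 (haarAddCircle : Measure UnitAddCircle) :=
    MemLp.of_bound hz.aestronglyMeasurable C (Eventually.of_forall hC)
  have hmp : ∀ c : UnitAddCircle, MeasurePreserving (fun θ => θ + c)
      (haarAddCircle : Measure UnitAddCircle) haarAddCircle :=
    fun c => measurePreserving_add_right _ c
  have hlim : Tendsto (fun n : ℕ => 1 / ((n : ℝ) + 1)) atTop (𝓝 0) :=
    tendsto_one_div_add_atTop_nhds_zero_nat
  let g : ℕ → C(UnitAddCircle, UnitAddCircle) := fun n =>
    ⟨fun θ => θ + ((1 / ((n : ℝ) + 1) : ℝ) : UnitAddCircle), by fun_prop⟩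
  let F : C(UnitAddCircle × UnitAddCircle, UnitAddCircle) := ⟨fun p => p.2 + p.1, by fun_prop⟩
  have hg : Tendsto g atTop (𝓝 (ContinuousMap.id _)) := by
    have h1 := F.curry.continuous.tendsto 0
    have h2 : Tendsto (fun n : ℕ => ((1 / ((n : ℝ) + 1) : ℝ) : UnitAddCircle)) atTop (𝓝 0) :=
      ((AddCircle.continuous_mk' 1).tendsto 0).comp hlim
    have h3 := h1.comp h2
    have h4 : F.curry 0 = ContinuousMap.id _ := by
      ext θ
      simp [F]
    rw [h4] at h3
    exact h3
  -- Translations are strongly continuous on `L²`; convergence in measure then gives almost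
  -- everywhere convergence along a subsequence.
  have hL := Filter.Tendsto.compMeasurePreservingLp (p := 2)
    (tendsto_const_nhds (x := hmem.toLp z)) hg (fun n => hmp _) (MeasurePreserving.id _)
    (by simp)
  obtain ⟨ns, hns, hae⟩ := (tendstoInMeasure_of_tendsto_Lp hL).exists_seq_tendsto_ae
  refine ⟨fun n => 1 / ((ns n : ℝ) + 1), fun n => by positivity, hlim.comp hns.tendsto_atTop, ?_⟩
  have e1 : ∀ n, ∀ᵐ θ ∂(haarAddCircle : Measure UnitAddCircle),
      Lp.compMeasurePreserving (g n) (hmp _) (hmem.toLp z) θ = z (g n θ) := fun n =>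
    (Lp.coeFn_compMeasurePreserving _ (hmp _)).trans
      ((hmp _).quasiMeasurePreserving.ae_eq_comp hmem.coeFn_toLp)
  have e2 : ∀ᵐ θ ∂(haarAddCircle : Measure UnitAddCircle),
      Lp.compMeasurePreserving (ContinuousMap.id UnitAddCircle) (MeasurePreserving.id _)
        (hmem.toLp z) θ = z θ :=
    (Lp.coeFn_compMeasurePreserving _ (MeasurePreserving.id _)).trans hmem.coeFn_toLp
  filter_upwards [hae, ae_all_iff.2 e1, e2] with θ h1 h2 h3
  rw [h3] at h1
  exact h1.congr fun n => h2 (ns n)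

/-- The argument of the product formula used in the energy identity. -/
theorem arg_eq_of_mul_eq {Φ D D' k k' Ψ : ℂ} (hΦ : 0 < Φ.re) (hΨ : 0 < Ψ.re)
    (hD : |D.arg| < Real.pi / 4) (hD' : |D'.arg| < Real.pi / 4) (hD0 : D ≠ 0) (hD0' : D' ≠ 0)
    (hk : |k.arg| < Real.pi / 4) (hk' : |k'.arg| < Real.pi / 4) (hk0 : k ≠ 0) (hk0' : k' ≠ 0)
    (h : Φ * D * D' = conj k * k' * Ψ) :
    Φ.arg + D.arg + D'.arg = -k.arg + k'.arg + Ψ.arg := by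
  have hΦ0 : Φ ≠ 0 := by rintro rfl; simp at hΦ
  have hΨ0 : Ψ ≠ 0 := by rintro rfl; simp at hΨ
  have hΦ1 := Complex.abs_arg_lt_pi_div_two_iff.2 (Or.inl hΦ)
  have hΨ1 := Complex.abs_arg_lt_pi_div_two_iff.2 (Or.inl hΨ)
  have hkc : (conj k).arg = -k.arg := by
    rw [Complex.arg_conj, if_neg]
    intro h0
    rw [h0, abs_of_pos Real.pi_pos] at hk
    linarith [Real.pi_pos]
  -- On each side the arguments total less than `π/2 + π/4 + π/4 = π` in absolute value, so `arg` is
  -- additive without a branch jump.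
  rw [abs_lt] at *
  have e1 : (Φ * D).arg = Φ.arg + D.arg :=
    Complex.arg_mul hΦ0 hD0 ⟨by linarith, by linarith⟩
  have e2 : (Φ * D * D').arg = Φ.arg + D.arg + D'.arg := by
    rw [← e1]
    exact Complex.arg_mul (mul_ne_zero hΦ0 hD0) hD0' ⟨by linarith, by linarith⟩
  have e3 : (conj k * k').arg = -k.arg + k'.arg := by
    rw [← hkc]
    exact Complex.arg_mul ((map_ne_zero _).2 hk0) hk0' ⟨by linarith, by linarith⟩
  have e4 : (conj k * k' * Ψ).arg = -k.arg + k'.arg + Ψ.arg := by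
    rw [← e3]
    exact Complex.arg_mul (mul_ne_zero ((map_ne_zero _).2 hk0) hk0') hΨ0
      ⟨by linarith, by linarith⟩
  rw [← e2, h, e4]

theorem abs_arg_one_add_le {w : ℂ} (hw : ‖w‖ ≤ 1 / 2) : |(1 + w).arg| ≤ 3 / 2 * ‖w‖ := by
  rw [← Complex.log_im]
  exact (Complex.abs_im_le_norm _).trans (Complex.norm_log_one_add_half_le_self hw)

theorem abs_arg_one_add_lt {w : ℂ} (hw : ‖w‖ ≤ 1 / 2) : |(1 + w).arg| < Real.pi / 4 := by
  have := abs_arg_one_add_le hw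
  linarith [Real.pi_gt_d2]

theorem one_add_ne_zero_of_norm_le {w : ℂ} (hw : ‖w‖ ≤ 1 / 2) : 1 + w ≠ 0 := by
  intro h
  rw [← neg_eq_iff_add_eq_zero.2 h, norm_neg, norm_one] at hw
  norm_num at hw

/-- `arg` is the imaginary part of `log`, whose derivative at `1` is `1`. Convergence of `X n`
suffices, so no derivative of the section is needed. -/
theorem tendsto_arg_one_add_mul_div {h : ℕ → ℝ} (hpos : ∀ n, 0 < h n)
    (hlim : Tendsto h atTop (𝓝 0)) {X : ℕ → ℂ} {x : ℂ} (hX : Tendsto X atTop (𝓝 x)) :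
    Tendsto (fun n => (1 + h n * X n).arg / h n) atTop (𝓝 x.im) := by
  have hc : Tendsto (fun n => (h n : ℂ)) atTop (𝓝 0) := by
    exact_mod_cast (Complex.continuous_ofReal.tendsto 0).comp hlim
  have h0 : Tendsto (fun n => (h n : ℂ) * X n) atTop (𝓝 0) := by simpa using hc.mul hX
  have hlog : HasDerivAt (fun w : ℂ => Complex.log (1 + w)) 1 0 := by
    have h1 : HasDerivAt (fun w : ℂ => 1 + w) 1 0 := (hasDerivAt_id _).const_add 1
    simpa using h1.clog (by simp)
  have h2 : (fun w : ℂ => Complex.log (1 + w) - w) =o[𝓝 0] (fun w : ℂ => w) := by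
    simpa using hlog.isLittleO
  have h3 : Tendsto (fun n => (Complex.log (1 + h n * X n) - h n * X n) / h n) atTop (𝓝 0) := by
    have h4 := h2.comp_tendsto h0
    have h5 : (fun n => (h n : ℂ) * X n) =O[atTop] (fun n => (h n : ℂ)) := by
      simpa using (Asymptotics.isBigO_refl (fun n => (h n : ℂ)) atTop).mul (hX.isBigO_one ℂ)
    exact (h4.trans_isBigO h5).tendsto_div_nhds_zero
  have h6 : Tendsto (fun n => Complex.log (1 + h n * X n) / h n) atTop (𝓝 x) := by
    have := h3.add hX
    rw [zero_add] at this
    refine this.congr fun n => ?_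
    have : (h n : ℂ) ≠ 0 := by exact_mod_cast (hpos n).ne'
    field_simp
    ring
  have h7 := (Complex.continuous_im.tendsto x).comp h6
  refine h7.congr fun n => ?_
  simp [Complex.div_ofReal_im, Complex.log_im]

end QPCocycle
end

/-! ### The energy identity. -/

open scoped ContDiff
noncomputable section
namespace QPCocycle

open MeasureTheory ComplexConjugate Filter Topology AddCircle

theorem integrable_of_measurable_of_bound {f : UnitAddCircle → ℝ} (hf : Measurable f) {C : ℝ}
    (hC : ∀ θ, |f θ| ≤ C) : Integrable f (haarAddCircle : Measure UnitAddCircle) :=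
  Integrable.of_bound hf.aestronglyMeasurable C (Eventually.of_forall hC)

theorem integrable_arg {f : UnitAddCircle → ℂ} (hf : Measurable f) :
    Integrable (fun θ => (f θ).arg) (haarAddCircle : Measure UnitAddCircle) :=
  integrable_of_measurable_of_bound (Complex.measurable_arg.comp hf) fun _ => Complex.abs_arg_le_pi _

theorem le_one_sub_conj_mul_re {x y : ℂ} {ρ : ℝ} (hx : ‖x‖ ≤ ρ) (hy : ‖y‖ ≤ ρ) :
    1 - ρ ^ 2 ≤ (1 - conj x * y).re := by
  have h1 : (conj x * y).re ≤ ρ ^ 2 := by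
    refine (Complex.re_le_norm _).trans ?_
    rw [norm_mul, RCLike.norm_conj, sq]
    exact mul_le_mul hx hy (norm_nonneg _) ((norm_nonneg _).trans hx)
  rw [Complex.sub_re, Complex.one_re]
  linarith

theorem fourier_apply_add (n : ℤ) (θ η : UnitAddCircle) :
    (fourier n (θ + η) : ℂ) = fourier n θ * fourier n η := by
  simp [fourier_apply, smul_add, toCircle_add]

theorem norm_mul_sub_mul_le {p q u v : ℂ} {L c : ℝ} (hpq : ‖p‖ + ‖q‖ ≤ c) (hu : ‖u‖ ≤ L)
    (hv : ‖v‖ ≤ L) : ‖p * u - q * v‖ ≤ c * L := by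
  refine (norm_sub_le _ _).trans ?_
  rw [norm_mul, norm_mul]
  have hL : 0 ≤ L := (norm_nonneg _).trans hu
  calc ‖p‖ * ‖u‖ + ‖q‖ * ‖v‖ ≤ ‖p‖ * L + ‖q‖ * L := by gcongr
    _ = (‖p‖ + ‖q‖) * L := by ring
    _ ≤ c * L := by gcongr

/-- The polarised form `1 - z̄ w` transforms under two elements of `SU(1,1)` up to a first order
error. -/
theorem mobius_form_expand {a b a₁ b₁ z w h da db : ℂ} (hdet : a * conj a - b * conj b = 1)
    (ha : a₁ = a + h * da) (hb : b₁ = b + h * db) (hh : conj h = h) :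
    conj (conj b * z + conj a) * (conj b₁ * w + conj a₁) - conj (a * z + b) * (a₁ * w + b₁) =
      (1 - conj z * w) + h * ((a * conj da - conj b * db) + (a * conj db - conj b * da) * w +
        (b * conj da - conj a * db) * conj z + (b * conj db - conj a * da) * (conj z * w)) := by
  subst ha hb
  simp only [map_add, map_mul, Complex.conj_conj, hh]
  linear_combination (1 - conj z * w) * hdet

/-- The energy identity for an invariant section of `E_r g` with `g` close to the identity:
the derivative of the monodromy in the `SU(1,1)` form integrates to the degree contribution. -/
theorem energy_identity {α : UnitAddCircle} {r : ℕ} {a b a' b' z : UnitAddCircle → ℂ} {L ρ : ℝ}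
    (ha : Continuous a) (hb : Continuous b)
    (hda : ∀ (θ : UnitAddCircle) (x : ℝ), HasDerivAt (fun y : ℝ => a (θ + y)) (a' (θ + x)) x)
    (hdb : ∀ (θ : UnitAddCircle) (x : ℝ), HasDerivAt (fun y : ℝ => b (θ + y)) (b' (θ + x)) x)
    (ha' : ∀ θ, ‖a' θ‖ ≤ L) (hb' : ∀ θ, ‖b' θ‖ ≤ L)
    (hdet : ∀ θ, a θ * conj (a θ) - b θ * conj (b θ) = 1)
    (ha1 : ∀ θ, ‖a θ - 1‖ ≤ 1 / 4) (hb1 : ∀ θ, ‖b θ‖ ≤ 1 / 4)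
    (hz : Measurable z) (hρ : ρ < 1) (hzρ : ∀ θ, ‖z θ‖ ≤ ρ)
    (hinv : ∀ θ, z (θ + α) * (conj (b θ) * z θ + conj (a θ)) =
      fourier (2 * r : ℤ) θ * (a θ * z θ + b θ)) :
    ∫ θ, ((logDerivDiag (a θ) (b θ) (a' θ) (b' θ)).im * (1 + ‖z θ‖ ^ 2) +
          2 * (logDerivOff (a θ) (b θ) (a' θ) (b' θ) * z θ).im) / (1 - ‖z θ‖ ^ 2) ∂haarAddCircle =
      4 * Real.pi * r * ∫ θ, ‖a θ * z θ + b θ‖ ^ 2 / (1 - ‖z θ‖ ^ 2) ∂haarAddCircle := by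
  have hρ0 : 0 ≤ ρ := (norm_nonneg _).trans (hzρ 0)
  have hL0 : 0 ≤ L := (norm_nonneg _).trans (ha' 0)
  have hρ2 : 0 < 1 - ρ ^ 2 := by nlinarith
  set m : ℝ := 4 * Real.pi * r with hm
  have hm0 : 0 ≤ m := by positivity
  obtain ⟨h, hpos, hlim, hae⟩ := exists_seq_tendsto_translate hz hzρ
  -- the denominators of the Moebius action and the image section
  set κ : UnitAddCircle → ℂ := fun θ => conj (b θ) * z θ + conj (a θ) with hκ
  set y : UnitAddCircle → ℂ := fun θ => (a θ * z θ + b θ) / κ θ with hy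
  have hz1 : ∀ θ, ‖z θ‖ < 1 := fun θ => (hzρ θ).trans_lt hρ
  have hκ0 : ∀ θ, κ θ ≠ 0 := fun θ => mobius_denom_ne_zero (hdet θ) (hz1 θ)
  have hκ1 : ∀ θ, ‖κ θ - 1‖ ≤ 1 / 2 := by
    intro θ
    have e : κ θ - 1 = conj (b θ) * z θ + conj (a θ - 1) := by simp [κ]; ring
    rw [e]
    refine (norm_add_le _ _).trans ?_
    rw [norm_mul, RCLike.norm_conj, RCLike.norm_conj]
    have := mul_le_mul (hb1 θ) (hz1 θ).le (norm_nonneg _) (by norm_num)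
    linarith [ha1 θ]
  have hyκ : ∀ θ, y θ * κ θ = a θ * z θ + b θ := fun θ => div_mul_cancel₀ _ (hκ0 θ)
  have hzy : ∀ θ, z (θ + α) = fourier (2 * r : ℤ) θ * y θ := fun θ => by
    refine mul_right_cancel₀ (hκ0 θ) ?_
    rw [mul_assoc, hyκ, hinv θ]
  have hfn : ∀ θ : UnitAddCircle, ‖(fourier (2 * r : ℤ) θ : ℂ)‖ = 1 := fun θ => by
    rw [fourier_apply, Circle.norm_coe]
  have hyρ : ∀ θ, ‖y θ‖ ≤ ρ := fun θ => by
    have := hzρ (θ + α)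
    rwa [hzy, norm_mul, hfn, one_mul] at this
  have hκm : Measurable κ := by
    have := (Complex.continuous_conj.comp hb).measurable
    have := (Complex.continuous_conj.comp ha).measurable
    exact (Measurable.mul ‹_› hz).add ‹_›
  have hym : Measurable y := ((ha.measurable.mul hz).add hb.measurable).div hκm
  have htr : ∀ c : UnitAddCircle, Measurable fun θ : UnitAddCircle => θ + c :=
    fun c => measurable_add_const c
  have hcm : Measurable fun w : ℂ => conj w := Complex.continuous_conj.measurable
  -- difference quotients
  set da : ℕ → UnitAddCircle → ℂ := fun n θ => (a (θ + h n) - a θ) / h n with hda_def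
  set db : ℕ → UnitAddCircle → ℂ := fun n θ => (b (θ + h n) - b θ) / h n with hdb_def
  have hh0 : ∀ n, (h n : ℂ) ≠ 0 := fun n => by exact_mod_cast (hpos n).ne'
  have hquot : ∀ (f f' : UnitAddCircle → ℂ), (∀ (θ : UnitAddCircle) (x : ℝ),
      HasDerivAt (fun y : ℝ => f (θ + y)) (f' (θ + x)) x) → (∀ θ, ‖f' θ‖ ≤ L) → ∀ θ,
      (∀ n, ‖(f (θ + h n) - f θ) / h n‖ ≤ L) ∧
      Tendsto (fun n => (f (θ + h n) - f θ) / (h n : ℂ)) atTop (𝓝 (f' θ)) := by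
    intro f f' hf hf' θ
    refine ⟨fun n => ?_, ?_⟩
    · have h1 := convex_univ.norm_image_sub_le_of_norm_hasDerivWithin_le
        (f := fun y : ℝ => f (θ + y)) (f' := fun x : ℝ => f' (θ + x)) (C := L) (x := 0) (y := h n)
        (fun x _ => (hf θ x).hasDerivWithinAt) (fun x _ => hf' _) trivial trivial
      simp only [AddCircle.coe_zero, add_zero, sub_zero] at h1
      rw [norm_div, Complex.norm_real, div_le_iff₀ (norm_pos_iff.2 (hpos n).ne')]
      exact h1
    · have h1 := (hf θ 0).tendsto_slope_zero_right
      have h2 : Tendsto h atTop (𝓝[>] 0) :=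
        tendsto_nhdsWithin_iff.2 ⟨hlim, Eventually.of_forall hpos⟩
      have h3 := h1.comp h2
      simp only [AddCircle.coe_zero, add_zero, zero_add] at h3
      refine h3.congr fun n => ?_
      simp [Function.comp, div_eq_inv_mul]
  have hdaL := hquot a a' hda ha'
  have hdbL := hquot b b' hdb hb'
  set R : ℕ → UnitAddCircle → ℂ := fun n θ =>
    (a θ * conj (da n θ) - conj (b θ) * db n θ) +
      (a θ * conj (db n θ) - conj (b θ) * da n θ) * z (θ + h n) +
      (b θ * conj (da n θ) - conj (a θ) * db n θ) * conj (z θ) +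
      (b θ * conj (db n θ) - conj (a θ) * da n θ) * (conj (z θ) * z (θ + h n)) with hR
  set Φ : ℕ → UnitAddCircle → ℂ := fun n θ => 1 - conj (z θ) * z (θ + h n) with hΦ
  set g : ℕ → UnitAddCircle → ℂ := fun n θ => conj (y θ) * y (θ + h n) with hg
  set e : ℕ → ℂ := fun n => fourier (2 * r : ℤ) (h n : UnitAddCircle) with he
  set X : ℕ → UnitAddCircle → ℂ := fun n θ => R n θ / Φ n θ with hX
  set Y : ℕ → UnitAddCircle → ℂ := fun n θ => (1 - e n) / h n * g n θ / (1 - g n θ) with hY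
  have hΦre : ∀ n θ, 1 - ρ ^ 2 ≤ (Φ n θ).re := fun n θ =>
    le_one_sub_conj_mul_re (hzρ _) (hzρ _)
  have hgre : ∀ n θ, 1 - ρ ^ 2 ≤ (1 - g n θ).re := fun n θ =>
    le_one_sub_conj_mul_re (hyρ _) (hyρ _)
  have hΦ0 : ∀ n θ, Φ n θ ≠ 0 := fun n θ h0 => by
    have := hΦre n θ
    rw [h0, Complex.zero_re] at this
    linarith
  have hg0 : ∀ n θ, 1 - g n θ ≠ 0 := fun n θ h0 => by
    have := hgre n θ
    rw [h0, Complex.zero_re] at this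
    linarith
  -- Invariance rewrites `Φ` at `θ + α` through `y`: the common rotation cancels, and only its
  -- increment `e n` over the step `h n` survives.
  have hexp : ∀ n, Φ n ∘ (· + α) = fun θ => 1 - e n * g n θ := by
    intro n
    funext θ
    have h1 : z (θ + α + h n) = fourier (2 * r : ℤ) θ * e n * y (θ + h n) := by
      rw [add_right_comm, hzy, fourier_apply_add]
    have h2 : conj (fourier (2 * r : ℤ) θ : ℂ) * fourier (2 * r : ℤ) θ = 1 := by
      rw [mul_comm, Complex.mul_conj, Complex.normSq_eq_norm_sq, hfn]
      norm_num
    simp only [hΦ, hg, Function.comp, h1, hzy, map_mul]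
    linear_combination (-conj (y θ) * e n * y (θ + h n)) * h2
  -- The polarised form `1 - z̄w` is SU(1,1)-covariant up to the factors `κ`. The matrix at the
  -- second point differs by a first-order amount, which is recorded in `X`.
  have hN : ∀ n θ, Φ n θ * (1 + h n * X n θ) = conj (κ θ) * κ (θ + h n) * (1 - g n θ) := by
    intro n θ
    have h1 := mobius_form_expand (z := z θ) (w := z (θ + h n)) (h := (h n : ℂ))
      (a₁ := a (θ + h n)) (b₁ := b (θ + h n)) (da := da n θ) (db := db n θ) (hdet θ)
      (by simp only [hda_def]; field_simp [hh0 n]; ring)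
      (by simp only [hdb_def]; field_simp [hh0 n]; ring) (Complex.conj_ofReal _)
    have h2 : Φ n θ * (1 + h n * X n θ) = Φ n θ + h n * R n θ := by
      simp only [hX]
      field_simp [hΦ0 n θ]
    rw [h2]
    have h3 := hyκ θ
    have h4 := hyκ (θ + h n)
    simp only [hΦ, hR, hg]
    rw [← h1, ← h3, ← h4, map_mul]
    ring
  have hD' : ∀ n θ, (1 - g n θ) * (1 + h n * Y n θ) = 1 - e n * g n θ := by
    intro n θ
    have := hg0 n θ
    have := hh0 n
    simp only [hY]
    field_simp
    ring
  -- uniform bounds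
  have hzle : ∀ θ, ‖z θ‖ ≤ 1 := fun θ => (hz1 θ).le
  have hab : ∀ θ, ‖a θ‖ + ‖b θ‖ ≤ 3 / 2 := fun θ => by
    have := norm_add_le (a θ - 1) 1
    rw [sub_add_cancel, norm_one] at this
    linarith [ha1 θ, hb1 θ]
  have hXb : ∀ n θ, ‖X n θ‖ ≤ 6 * L / (1 - ρ ^ 2) := by
    intro n θ
    have hda' : ‖conj (da n θ)‖ ≤ L := by rw [RCLike.norm_conj]; exact (hdaL θ).1 n
    have hdb' : ‖conj (db n θ)‖ ≤ L := by rw [RCLike.norm_conj]; exact (hdbL θ).1 n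
    have hab1 : ‖a θ‖ + ‖conj (b θ)‖ ≤ 3 / 2 := by rw [RCLike.norm_conj]; exact hab θ
    have hab2 : ‖b θ‖ + ‖conj (a θ)‖ ≤ 3 / 2 := by
      rw [RCLike.norm_conj, add_comm]; exact hab θ
    have h1 := norm_mul_sub_mul_le hab1 hda' ((hdbL θ).1 n)
    have h2 := norm_mul_sub_mul_le hab1 hdb' ((hdaL θ).1 n)
    have h3 := norm_mul_sub_mul_le hab2 hda' ((hdbL θ).1 n)
    have h4 := norm_mul_sub_mul_le hab2 hdb' ((hdaL θ).1 n)
    have hc : ∀ {x w : ℂ}, ‖x‖ ≤ 3 / 2 * L → ‖w‖ ≤ 1 → ‖x * w‖ ≤ 3 / 2 * L := fun hx hw => by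
      rw [norm_mul]
      exact (mul_le_of_le_one_right (norm_nonneg _) hw).trans hx
    have hzc : ‖conj (z θ)‖ ≤ 1 := by rw [RCLike.norm_conj]; exact hzle θ
    have hR6 : ‖R n θ‖ ≤ 6 * L := by
      refine (norm_add₃_le.trans (add_le_add (add_le_add (norm_add_le _ _) le_rfl) le_rfl)).trans ?_
      have e2 := hc h2 (hzle (θ + h n))
      have e3 := hc h3 hzc
      have e4 := hc h4 (w := conj (z θ) * z (θ + h n))
        (by rw [norm_mul]; exact mul_le_one₀ hzc (norm_nonneg _) (hzle _))
      linarith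
    rw [norm_div]
    exact div_le_div₀ (by positivity) hR6 hρ2 ((hΦre n θ).trans (Complex.re_le_norm _))
  have hen : ∀ n, e n = Complex.exp (Complex.I * ((m * h n : ℝ) : ℂ)) := by
    intro n
    simp only [he, fourier_coe_apply, hm]
    congr 1
    push_cast
    ring
  have hYb : ∀ n θ, ‖Y n θ‖ ≤ m / (1 - ρ ^ 2) := by
    intro n θ
    have h1 : ‖(1 - e n) / h n‖ ≤ m := by
      rw [norm_div, Complex.norm_real, div_le_iff₀ (norm_pos_iff.2 (hpos n).ne'), norm_sub_rev, hen]
      refine Real.norm_exp_I_mul_ofReal_sub_one_le.trans ?_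
      rw [norm_mul, Real.norm_of_nonneg hm0]
    have h2 : ‖g n θ‖ ≤ 1 := by
      simp only [hg]
      rw [norm_mul, RCLike.norm_conj]
      exact mul_le_one₀ ((hyρ _).trans hρ.le) (norm_nonneg _) ((hyρ _).trans hρ.le)
    rw [norm_div, norm_mul]
    exact div_le_div₀ hm0 ((mul_le_of_le_one_right (norm_nonneg _) h2).trans h1) hρ2
      ((hgre n θ).trans (Complex.re_le_norm _))
  have hsmall : ∀ᶠ n in atTop, ∀ θ, ‖h n * X n θ‖ ≤ 1 / 2 ∧ ‖h n * Y n θ‖ ≤ 1 / 2 := by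
    have h1 : Tendsto (fun n => h n * (6 * L / (1 - ρ ^ 2) + m / (1 - ρ ^ 2))) atTop (𝓝 0) := by
      simpa using hlim.mul_const (6 * L / (1 - ρ ^ 2) + m / (1 - ρ ^ 2))
    filter_upwards [h1.eventually (ge_mem_nhds (by norm_num : (0 : ℝ) < 1 / 2))] with n hn θ
    have hL1 : 0 ≤ 6 * L / (1 - ρ ^ 2) := by positivity
    have hm1 : 0 ≤ m / (1 - ρ ^ 2) := by positivity
    have hp := hpos n
    rw [norm_mul, norm_mul, Complex.norm_real, Real.norm_of_nonneg hp.le]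
    constructor
    · refine le_trans ?_ hn
      gcongr
      linarith [hXb n θ]
    · refine le_trans ?_ hn
      gcongr
      linarith [hYb n θ]
  have hzs : ∀ n, Measurable fun θ => z (θ + h n) := fun n => hz.comp (htr _)
  have hΦm : ∀ n, Measurable (Φ n) := fun n => ((hcm.comp hz).mul (hzs n)).const_sub 1
  have hdam : ∀ n, Measurable (da n) := fun n =>
    ((ha.measurable.comp (htr _)).sub ha.measurable).div_const _
  have hdbm : ∀ n, Measurable (db n) := fun n =>
    ((hb.measurable.comp (htr _)).sub hb.measurable).div_const _
  have hXm : ∀ n, Measurable (X n) := by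
    intro n
    have c1 := hcm.comp (hdam n)
    have c2 := hcm.comp (hdbm n)
    have c3 := hcm.comp ha.measurable
    have c4 := hcm.comp hb.measurable
    have c5 := hcm.comp hz
    exact (((((ha.measurable.mul c1).sub (c4.mul (hdbm n))).add
      (((ha.measurable.mul c2).sub (c4.mul (hdam n))).mul (hzs n))).add
      (((hb.measurable.mul c1).sub (c3.mul (hdbm n))).mul c5)).add
      (((hb.measurable.mul c2).sub (c3.mul (hdam n))).mul (c5.mul (hzs n)))).div (hΦm n)
  have hYm : ∀ n, Measurable (Y n) := by
    intro n
    have c1 : Measurable (g n) := (hcm.comp hym).mul (hym.comp (htr _))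
    exact (c1.const_mul _).div (c1.const_sub 1)
  have hargX : ∀ n, Measurable fun θ => (1 + h n * X n θ).arg := fun n =>
    Complex.measurable_arg.comp (((hXm n).const_mul _).const_add 1)
  have hargY : ∀ n, Measurable fun θ => (1 + h n * Y n θ).arg := fun n =>
    Complex.measurable_arg.comp (((hYm n).const_mul _).const_add 1)
  -- the exact identity at step `h n`
  have hsum : ∀ᶠ n in atTop, (∫ θ, (1 + h n * X n θ).arg / h n ∂haarAddCircle) +
      ∫ θ, (1 + h n * Y n θ).arg / h n ∂haarAddCircle = 0 := by
    filter_upwards [hsmall] with n hn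
    have hκarg : ∀ θ, |(κ θ).arg| < Real.pi / 4 := fun θ => by
      have := abs_arg_one_add_lt (hκ1 θ)
      rwa [add_sub_cancel] at this
    -- Taking arguments turns the product formula into a sum. The right side consists of two
    -- differences under translation, by `h n` and by `α`, so it integrates to zero.
    have hpt : ∀ θ, (1 + h n * X n θ).arg + (1 + h n * Y n θ).arg =
        ((κ (θ + h n)).arg - (κ θ).arg) + ((Φ n (θ + α)).arg - (Φ n θ).arg) := by
      intro θ
      have h1 := arg_eq_of_mul_eq (Φ := Φ n θ) (Ψ := Φ n (θ + α)) (k := κ θ) (k' := κ (θ + h n))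
        (hρ2.trans_le (hΦre n θ)) (hρ2.trans_le (hΦre n _)) (abs_arg_one_add_lt (hn θ).1)
        (abs_arg_one_add_lt (hn θ).2) (one_add_ne_zero_of_norm_le (hn θ).1)
        (one_add_ne_zero_of_norm_le (hn θ).2) (hκarg _) (hκarg _) (hκ0 _) (hκ0 _)
        (by rw [hN, mul_assoc, hD']; exact congrArg _ (congrFun (hexp n) θ).symm)
      linarith
    have i1 := integrable_arg (((hXm n).const_mul (h n : ℂ)).const_add 1)
    have i2 := integrable_arg (((hYm n).const_mul (h n : ℂ)).const_add 1)
    have i3 := integrable_arg hκm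
    have i4 : Integrable (fun θ => (κ (θ + h n)).arg) haarAddCircle :=
      integrable_arg (hκm.comp (htr (h n)))
    have i5 := integrable_arg (hΦm n)
    have i6 : Integrable (fun θ => (Φ n (θ + α)).arg) haarAddCircle :=
      integrable_arg ((hΦm n).comp (htr α))
    have i7 : Integrable (fun θ => (κ (θ + h n)).arg - (κ θ).arg) haarAddCircle := i4.sub i3
    have i8 : Integrable (fun θ => (Φ n (θ + α)).arg - (Φ n θ).arg) haarAddCircle := i6.sub i5
    rw [integral_div, integral_div, ← add_div, ← integral_add i1 i2]
    simp_rw [hpt]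
    rw [integral_add i7 i8, integral_sub i4 i3, integral_sub i6 i5]
    have t1 := integral_add_right_eq_self (μ := (haarAddCircle : Measure UnitAddCircle))
      (fun θ => (κ θ).arg) (h n : UnitAddCircle)
    have t2 := integral_add_right_eq_self (μ := (haarAddCircle : Measure UnitAddCircle))
      (fun θ => (Φ n θ).arg) α
    rw [t1, t2]
    simp
  have hargb : ∀ n {w : ℂ} {C : ℝ}, ‖h n * w‖ ≤ 1 / 2 → ‖w‖ ≤ C →
      ‖(1 + h n * w).arg / h n‖ ≤ 3 / 2 * C := by
    intro n w C hw hC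
    rw [norm_div, Real.norm_of_nonneg (hpos n).le, div_le_iff₀ (hpos n)]
    refine (abs_arg_one_add_le hw).trans ?_
    rw [norm_mul, Complex.norm_real, Real.norm_of_nonneg (hpos n).le]
    have := mul_le_mul_of_nonneg_left hC (hpos n).le
    linarith
  have hnsq : ∀ w : ℂ, conj w * w = ((‖w‖ ^ 2 : ℝ) : ℂ) := fun w => by
    rw [mul_comm, Complex.mul_conj, Complex.normSq_eq_norm_sq]
  have hlimX : Tendsto (fun n => ∫ θ, (1 + h n * X n θ).arg / h n ∂haarAddCircle) atTop
      (𝓝 (∫ θ, ((logDerivDiag (a θ) (b θ) (a' θ) (b' θ)).im * (1 + ‖z θ‖ ^ 2) +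
          2 * (logDerivOff (a θ) (b θ) (a' θ) (b' θ) * z θ).im) / (1 - ‖z θ‖ ^ 2)
            ∂haarAddCircle)) := by
    refine tendsto_integral_filter_of_dominated_convergence
      (fun _ => 3 / 2 * (6 * L / (1 - ρ ^ 2)))
      (Eventually.of_forall fun n => ((hargX n).div_const _).aestronglyMeasurable)
      (hsmall.mono fun n hn => Eventually.of_forall fun θ => hargb n (hn θ).1 (hXb n θ))
      (integrable_const _) ?_
    filter_upwards [hae] with θ hθ
    have hA := (hdaL θ).2
    have hB := (hdbL θ).2
    have hAc := (Complex.continuous_conj.tendsto _).comp hA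
    have hBc := (Complex.continuous_conj.tendsto _).comp hB
    have hΦl : Tendsto (fun n => Φ n θ) atTop (𝓝 (1 - conj (z θ) * z θ)) :=
      (hθ.const_mul _).const_sub 1
    have hRl : Tendsto (fun n => R n θ) atTop (𝓝 ((a θ * conj (a' θ) - conj (b θ) * b' θ) +
      (a θ * conj (b' θ) - conj (b θ) * a' θ) * z θ +
      (b θ * conj (a' θ) - conj (a θ) * b' θ) * conj (z θ) +
      (b θ * conj (b' θ) - conj (a θ) * a' θ) * (conj (z θ) * z θ))) :=
      ((((hAc.const_mul _).sub (hB.const_mul _)).add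
        (((hBc.const_mul _).sub (hA.const_mul _)).mul hθ)).add
        (((hAc.const_mul _).sub (hB.const_mul _)).mul_const _)).add
        (((hBc.const_mul _).sub (hA.const_mul _)).mul (hθ.const_mul _))
    have hne : 1 - ‖z θ‖ ^ 2 ≠ 0 := by nlinarith [hz1 θ, norm_nonneg (z θ)]
    have hne' : 1 - conj (z θ) * z θ ≠ 0 := by
      rw [hnsq]
      exact_mod_cast hne
    have := tendsto_arg_one_add_mul_div hpos hlim (hRl.div hΦl hne')
    convert! this using 2
    rw [hnsq, show (1 : ℂ) - ((‖z θ‖ ^ 2 : ℝ) : ℂ) = ((1 - ‖z θ‖ ^ 2 : ℝ) : ℂ) by push_cast; rfl,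
      Complex.div_ofReal_im]
    congr 1
    -- With `p, q` these two coefficients, the last two terms of `R` tend to `-conj(qz)` and
    -- `-p̄|z|²`. This doubles `Im(qz)` and produces the factor `1 + |z|²`.
    simp only [logDerivDiag, logDerivOff, Complex.add_im, Complex.sub_im, Complex.mul_im,
      Complex.sub_re, Complex.mul_re, Complex.conj_re, Complex.conj_im, Complex.ofReal_re,
      Complex.ofReal_im]
    ring
  have hlimY : Tendsto (fun n => ∫ θ, (1 + h n * Y n θ).arg / h n ∂haarAddCircle) atTop
      (𝓝 (∫ θ, -(m * (‖a θ * z θ + b θ‖ ^ 2 / (1 - ‖z θ‖ ^ 2))) ∂haarAddCircle)) := by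
    refine tendsto_integral_filter_of_dominated_convergence
      (fun _ => 3 / 2 * (m / (1 - ρ ^ 2)))
      (Eventually.of_forall fun n => ((hargY n).div_const _).aestronglyMeasurable)
      (hsmall.mono fun n hn => Eventually.of_forall fun θ => hargb n (hn θ).2 (hYb n θ))
      (integrable_const _) ?_
    filter_upwards [hae] with θ hθ
    have hsh : Tendsto (fun n => θ + (h n : UnitAddCircle)) atTop (𝓝 θ) := by
      have := ((AddCircle.continuous_mk' (1 : ℝ)).tendsto 0).comp hlim
      simpa using this.const_add θ
    have hal := (ha.tendsto θ).comp hsh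
    have hbl := (hb.tendsto θ).comp hsh
    have hyl : Tendsto (fun n => y (θ + h n)) atTop (𝓝 (y θ)) :=
      ((hal.mul hθ).add hbl).div ((((Complex.continuous_conj.tendsto _).comp hbl).mul hθ).add
        ((Complex.continuous_conj.tendsto _).comp hal)) (hκ0 θ)
    have hgl : Tendsto (fun n => g n θ) atTop (𝓝 (conj (y θ) * y θ)) := hyl.const_mul _
    -- The rotation increment has derivative `im` at zero; this is the source of the degree factor
    -- `4πr`.
    have hel : Tendsto (fun n => (1 - e n) / (h n : ℂ)) atTop (𝓝 (-(Complex.I * m))) := by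
      have h1 : HasDerivAt (fun x : ℝ => Complex.exp (Complex.I * ((m * x : ℝ) : ℂ)))
          (Complex.I * m) 0 := by
        have h2 : HasDerivAt (fun x : ℝ => Complex.I * ((m * x : ℝ) : ℂ)) (Complex.I * m) 0 := by
          have := (((hasDerivAt_id (0 : ℝ)).const_mul m).ofReal_comp).const_mul Complex.I
          simpa using this
        simpa using h2.cexp
      have h2 := h1.tendsto_slope_zero_right.comp
        (tendsto_nhdsWithin_iff.2 ⟨hlim, Eventually.of_forall hpos⟩ : Tendsto h atTop (𝓝[>] 0))
      refine h2.neg.congr fun n => ?_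
      simp only [Function.comp, hen, zero_add, mul_zero, Complex.ofReal_zero, Complex.exp_zero]
      rw [Complex.real_smul, Complex.ofReal_inv, div_eq_inv_mul]
      ring
    have hy1 : ‖y θ‖ < 1 := (hyρ θ).trans_lt hρ
    have hne : 1 - ‖y θ‖ ^ 2 ≠ 0 := by nlinarith [norm_nonneg (y θ)]
    have hne' : 1 - conj (y θ) * y θ ≠ 0 := by
      rw [hnsq]
      exact_mod_cast hne
    have := tendsto_arg_one_add_mul_div hpos hlim ((hel.mul hgl).div (hgl.const_sub 1) hne')
    convert! this using 2
    rw [hnsq, show (1 : ℂ) - ((‖y θ‖ ^ 2 : ℝ) : ℂ) = ((1 - ‖y θ‖ ^ 2 : ℝ) : ℂ) by push_cast; rfl,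
      Complex.div_ofReal_im]
    have h1 := normSq_mobius (z := z θ) (hdet θ)
    have h2 : ‖y θ‖ * ‖κ θ‖ = ‖a θ * z θ + b θ‖ := by rw [← norm_mul, hyκ]
    have h3 : ‖κ θ‖ ≠ 0 := norm_ne_zero_iff.2 (hκ0 θ)
    -- Conservation of the form turns `|y|²/(1-|y|²)` into `|az+b|²/(1-|z|²)`.
    have h4 : 1 - ‖z θ‖ ^ 2 = (1 - ‖y θ‖ ^ 2) * ‖κ θ‖ ^ 2 := by
      rw [← h1, ← h2]
      ring
    rw [h4, ← h2]
    simp only [neg_mul, Complex.neg_im, mul_assoc, ← Complex.ofReal_mul, Complex.mul_im,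
      Complex.I_re, Complex.I_im, Complex.ofReal_re, Complex.ofReal_im]
    field_simp
    ring
  have hfin := tendsto_nhds_unique (hlimX.add hlimY)
    (tendsto_const_nhds.congr' (hsum.mono fun n hn => hn.symm))
  rw [integral_neg, integral_const_mul] at hfin
  linarith

end QPCocycle
end

/-! ### The exponent identity and coercivity on the resonant band. -/

open scoped ContDiff
noncomputable section
namespace QPCocycle

open MeasureTheory ComplexConjugate Filter Topology AddCircle

/-- The exponent identity: the multiplier of an invariant section has vanishing mean logarithm. -/
theorem integrable_and_integral_log_denom_eq_zero {α : UnitAddCircle} {n : ℤ}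
    {a b z : UnitAddCircle → ℂ} {ρ : ℝ}
    (hdet : ∀ θ, a θ * conj (a θ) - b θ * conj (b θ) = 1)
    (hz : Measurable z) (hρ : ρ < 1) (hzρ : ∀ θ, ‖z θ‖ ≤ ρ)
    (hinv : ∀ θ, z (θ + α) * (conj (b θ) * z θ + conj (a θ)) =
      fourier n θ * (a θ * z θ + b θ)) :
    Integrable (fun θ => Real.log (‖conj (b θ) * z θ + conj (a θ)‖ ^ 2)) haarAddCircle ∧
    ∫ θ, Real.log (‖conj (b θ) * z θ + conj (a θ)‖ ^ 2) ∂haarAddCircle = 0 := by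
  have hρ0 : 0 ≤ ρ := (norm_nonneg _).trans (hzρ 0)
  have hz1 : ∀ θ, ‖z θ‖ < 1 := fun θ => (hzρ θ).trans_lt hρ
  have hpos : ∀ θ, 1 - ρ ^ 2 ≤ 1 - ‖z θ‖ ^ 2 := fun θ => by
    have := pow_le_pow_left₀ (norm_nonneg _) (hzρ θ) 2
    linarith
  have hρ2 : 0 < 1 - ρ ^ 2 := by nlinarith
  set f : UnitAddCircle → ℝ := fun θ => Real.log (1 - ‖z θ‖ ^ 2) with hf
  have hfm : Measurable f := Real.measurable_log.comp ((hz.norm.pow_const 2).const_sub 1)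
  have hfb : ∀ θ, |f θ| ≤ -Real.log (1 - ρ ^ 2) := fun θ => by
    rw [abs_of_nonpos (Real.log_nonpos (hρ2.le.trans (hpos θ)) (by nlinarith [sq_nonneg ‖z θ‖]))]
    exact neg_le_neg (Real.log_le_log hρ2 (hpos θ))
  have hfi := integrable_of_measurable_of_bound hfm hfb
  have hfi' : Integrable (fun θ => f (θ + α)) haarAddCircle :=
    integrable_of_measurable_of_bound (hfm.comp (measurable_add_const α))
    (fun θ => hfb (θ + α))
  -- The squared multiplier is the ratio of `1 - |z|²` at `θ` and at `θ + α`, so its logarithm is a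
  -- coboundary with bounded transfer function.
  have key : ∀ θ, Real.log (‖conj (b θ) * z θ + conj (a θ)‖ ^ 2) = f θ - f (θ + α) := by
    intro θ
    have h1 := normSq_mobius (z := z θ) (hdet θ)
    have h2 := congrArg norm (hinv θ)
    rw [norm_mul, norm_mul, fourier_apply, Circle.norm_coe, one_mul] at h2
    have h3 := norm_pos_iff.2 (mobius_denom_ne_zero (hdet θ) (hz1 θ))
    have h4 : 1 - ‖z θ‖ ^ 2 = ‖conj (b θ) * z θ + conj (a θ)‖ ^ 2 * (1 - ‖z (θ + α)‖ ^ 2) := by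
      rw [← h1, ← h2]
      ring
    simp only [hf]
    rw [h4, Real.log_mul (pow_pos h3 2).ne' (hρ2.trans_le (hpos _)).ne']
    ring
  simp_rw [key]
  refine ⟨hfi.sub hfi', ?_⟩
  rw [integral_sub hfi hfi', sub_eq_zero]
  exact (integral_add_right_eq_self f α).symm

/-- The trigonometric polynomial with coefficients `c k`, `k ∈ S`. -/
def trigPoly (S : Finset ℤ) (c : ℤ → ℂ) (θ : UnitAddCircle) : ℂ := ∑ k ∈ S, c k * fourier k θ

theorem continuous_trigPoly (S : Finset ℤ) (c : ℤ → ℂ) : Continuous (trigPoly S c) := by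
  unfold trigPoly
  fun_prop

theorem norm_trigPoly_le (S : Finset ℤ) (c : ℤ → ℂ) (θ : UnitAddCircle) :
    ‖trigPoly S c θ‖ ≤ ∑ k ∈ S, ‖c k‖ := by
  refine (norm_sum_le _ _).trans (Finset.sum_le_sum fun k _ => ?_)
  rw [norm_mul, fourier_apply, Circle.norm_coe, mul_one]

theorem integrable_conj_trigPoly_mul (S : Finset ℤ) (c : ℤ → ℂ) {f : UnitAddCircle → ℂ}
    (hf : Integrable f haarAddCircle) :
    Integrable (fun θ => conj (trigPoly S c θ) * f θ) haarAddCircle := by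
  refine hf.bdd_mul (c := ∑ k ∈ S, ‖c k‖)
    (Complex.continuous_conj.comp (continuous_trigPoly S c)).aestronglyMeasurable
    (Eventually.of_forall fun θ => ?_)
  rw [RCLike.norm_conj]
  exact norm_trigPoly_le S c θ

theorem integral_conj_trigPoly_mul (S : Finset ℤ) (c : ℤ → ℂ) {f : UnitAddCircle → ℂ}
    (hf : Integrable f haarAddCircle) :
    ∫ θ, conj (trigPoly S c θ) * f θ ∂haarAddCircle = ∑ k ∈ S, conj (c k) * fourierCoeff f k := by
  have h1 : ∀ θ, conj (trigPoly S c θ) * f θ = ∑ k ∈ S, conj (c k) * (fourier (-k) θ • f θ) := by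
    intro θ
    rw [trigPoly, map_sum, Finset.sum_mul]
    refine Finset.sum_congr rfl fun k _ => ?_
    rw [map_mul, fourier_neg, smul_eq_mul, mul_assoc]
  simp_rw [h1]
  rw [integral_finsetSum]
  · refine Finset.sum_congr rfl fun k _ => ?_
    rw [integral_const_mul, fourierCoeff]
  · intro k _
    exact (hf.fourier_smul (-k)).const_mul _

theorem fourierCoeff_trigPoly (S : Finset ℤ) (c : ℤ → ℂ) {k : ℤ} (hk : k ∈ S) :
    fourierCoeff (trigPoly S c) k = c k := by
  have h : trigPoly S c = ∑ j ∈ S, fun θ => c j * fourier j θ := by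
    funext θ
    simp [trigPoly]
  rw [h, fourierCoeff.sum]
  · rw [Finset.sum_apply, Finset.sum_eq_single k]
    · rw [fourierCoeff.const_mul, fourierCoeff_fourier, Pi.single_eq_same, mul_one]
    · intro j _ hj
      rw [fourierCoeff.const_mul, fourierCoeff_fourier, Pi.single_eq_of_ne hj.symm, mul_zero]
    · exact fun h => absurd hk h
  · intro j _
    exact ((continuous_const.mul (fourier j).continuous).integrable_of_hasCompactSupport
      (HasCompactSupport.of_compactSpace _))

theorem integral_conj_trigPoly_mul_trigPoly (S : Finset ℤ) (c d : ℤ → ℂ) :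
    ∫ θ, conj (trigPoly S c θ) * trigPoly S d θ ∂haarAddCircle = ∑ k ∈ S, conj (c k) * d k := by
  rw [integral_conj_trigPoly_mul]
  · exact Finset.sum_congr rfl fun k hk => by rw [fourierCoeff_trigPoly S d hk]
  · exact (continuous_trigPoly S d).integrable_of_hasCompactSupport
      (HasCompactSupport.of_compactSpace _)

theorem integral_normSq_trigPoly (S : Finset ℤ) (c : ℤ → ℂ) :
    ∫ θ, ‖trigPoly S c θ‖ ^ 2 ∂haarAddCircle = ∑ k ∈ S, ‖c k‖ ^ 2 := by
  have h := integral_conj_trigPoly_mul_trigPoly S c c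
  have h1 : ∀ w : ℂ, conj w * w = ((‖w‖ ^ 2 : ℝ) : ℂ) := fun w => by
    rw [mul_comm, Complex.mul_conj, Complex.normSq_eq_norm_sq]
  simp_rw [h1] at h
  rw [integral_complex_ofReal] at h
  exact_mod_cast h

theorem integrable_normSq {z : UnitAddCircle → ℂ} (hz : Measurable z) (hz1 : ∀ θ, ‖z θ‖ ≤ 1) :
    Integrable (fun θ => ‖z θ‖ ^ 2) (haarAddCircle : Measure UnitAddCircle) :=
  integrable_of_measurable_of_bound (hz.norm.pow_const 2) (C := 1) fun θ => by
    rw [abs_of_nonneg (sq_nonneg _)]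
    exact pow_le_one₀ (norm_nonneg _) (hz1 θ)

theorem integrable_of_measurable_of_norm_le {z : UnitAddCircle → ℂ} (hz : Measurable z) {C : ℝ}
    (hC : ∀ θ, ‖z θ‖ ≤ C) : Integrable z (haarAddCircle : Measure UnitAddCircle) :=
  Integrable.of_bound hz.aestronglyMeasurable C (Eventually.of_forall hC)

/-- Bessel's inequality for finitely many Fourier coefficients. -/
theorem sum_normSq_fourierCoeff_le (S : Finset ℤ) {z : UnitAddCircle → ℂ} (hz : Measurable z)
    (hz1 : ∀ θ, ‖z θ‖ ≤ 1) :
    ∑ k ∈ S, ‖fourierCoeff z k‖ ^ 2 ≤ ∫ θ, ‖z θ‖ ^ 2 ∂haarAddCircle := by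
  set p := trigPoly S (fourierCoeff z) with hp
  have hzi := integrable_of_measurable_of_norm_le hz hz1
  have hi := integrable_conj_trigPoly_mul S (fourierCoeff z) hzi
  have hip : Integrable (fun θ => ‖p θ‖ ^ 2) (haarAddCircle : Measure UnitAddCircle) :=
    ((continuous_trigPoly S _).norm.pow 2).integrable_of_hasCompactSupport
      (HasCompactSupport.of_compactSpace _)
  have h0 : 0 ≤ ∫ θ, (‖z θ‖ ^ 2 - 2 * (conj (p θ) * z θ).re + ‖p θ‖ ^ 2) ∂haarAddCircle := by
    refine integral_nonneg fun θ => ?_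
    have h1 := (Complex.re_le_norm (conj (p θ) * z θ))
    rw [norm_mul, RCLike.norm_conj] at h1
    change 0 ≤ ‖z θ‖ ^ 2 - 2 * (conj (p θ) * z θ).re + ‖p θ‖ ^ 2
    nlinarith [sq_nonneg (‖z θ‖ - ‖p θ‖)]
  have hire : Integrable (fun θ => 2 * (conj (p θ) * z θ).re) haarAddCircle :=
    (hi.re).const_mul 2
  have h2 : ∫ θ, (conj (p θ) * z θ).re ∂haarAddCircle = ∑ k ∈ S, ‖fourierCoeff z k‖ ^ 2 := by
    have h3 := Complex.reCLM.integral_comp_comm hi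
    simp only [Complex.reCLM_apply] at h3
    rw [h3, integral_conj_trigPoly_mul S _ hzi, Complex.re_sum]
    refine Finset.sum_congr rfl fun k _ => ?_
    rw [mul_comm, Complex.mul_conj, Complex.normSq_eq_norm_sq, Complex.ofReal_re]
  have hzp : Integrable (fun θ => ‖z θ‖ ^ 2 - 2 * (conj (p θ) * z θ).re) haarAddCircle :=
    (integrable_normSq hz hz1).sub hire
  rw [integral_add hzp hip, integral_sub (integrable_normSq hz hz1) hire, integral_const_mul, h2,
    integral_normSq_trigPoly] at h0
  linarith

theorem quadForm_eq (m : ℝ) (z l l' : ℂ) :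
    quadForm m z l l' = m * ‖z‖ ^ 2 + (m - Real.pi) * (2 * (conj l * z).re + (conj l * l).re) +
      (conj l * l').im - 2 * (conj l' * z).im := by
  have hn : ∀ w : ℂ, ‖w‖ ^ 2 = w.re ^ 2 + w.im ^ 2 := fun w => by
    rw [← Complex.normSq_eq_norm_sq, Complex.normSq_apply]; ring
  simp only [quadForm, hn]
  simp
  ring

/-- The quadratic form is coercive on trigonometric polynomials with frequencies in the resonant
band. -/
theorem integrable_quadForm_trigPoly {r : ℕ} (hr : 1 ≤ r) {z : UnitAddCircle → ℂ}
    (hz : Measurable z) (hz1 : ∀ θ, ‖z θ‖ ≤ 1) (c : ℤ → ℂ) :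
    let S := Finset.Icc (-(2 * (r : ℤ) - 1)) 0
    let q := fun θ => quadForm (4 * Real.pi * r) (z θ) (trigPoly S c θ)
      (trigPoly S (fun k => c k * (2 * Real.pi * k * Complex.I)) θ)
    Integrable q haarAddCircle ∧
      ∫ θ, ‖z θ‖ ^ 2 ∂haarAddCircle + ∑ k ∈ S, ‖c k‖ ^ 2 ≤ ∫ θ, q θ ∂haarAddCircle := by
  intro S q
  set m : ℝ := 4 * Real.pi * r with hm
  have hpi := Real.pi_gt_three
  have hr1 : (1 : ℝ) ≤ r := by exact_mod_cast hr
  have hm0 : 1 ≤ m := by rw [hm]; nlinarith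
  set l := trigPoly S c with hl
  set c' : ℤ → ℂ := fun k => c k * (2 * Real.pi * k * Complex.I) with hc'
  set l' := trigPoly S c' with hl'
  have hzi := integrable_of_measurable_of_norm_le hz hz1
  have i0 := integrable_normSq hz hz1
  have hcont : ∀ d, Integrable (trigPoly S d) haarAddCircle := fun d =>
    (continuous_trigPoly S d).integrable_of_hasCompactSupport (HasCompactSupport.of_compactSpace _)
  have i1 := integrable_conj_trigPoly_mul S c hzi
  have i2 := integrable_conj_trigPoly_mul S c (hcont c)
  have i3 := integrable_conj_trigPoly_mul S c (hcont c')
  have i4 := integrable_conj_trigPoly_mul S c' hzi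
  have hre : ∀ {f : UnitAddCircle → ℂ}, Integrable f haarAddCircle →
      ∫ θ, (f θ).re ∂haarAddCircle = (∫ θ, f θ ∂haarAddCircle).re := fun hf =>
    Complex.reCLM.integral_comp_comm hf
  have him : ∀ {f : UnitAddCircle → ℂ}, Integrable f haarAddCircle →
      ∫ θ, (f θ).im ∂haarAddCircle = (∫ θ, f θ ∂haarAddCircle).im := fun hf =>
    Complex.imCLM.integral_comp_comm hf
  have j0 : Integrable (fun θ => m * ‖z θ‖ ^ 2) haarAddCircle := i0.const_mul m
  have j1 : Integrable (fun θ => 2 * (conj (l θ) * z θ).re) haarAddCircle := i1.re.const_mul 2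
  have j2 : Integrable (fun θ => (conj (l θ) * l θ).re) haarAddCircle := i2.re
  have j3 : Integrable (fun θ => (m - Real.pi) * (2 * (conj (l θ) * z θ).re +
      (conj (l θ) * l θ).re)) haarAddCircle := (j1.add j2).const_mul _
  have j4 : Integrable (fun θ => (conj (l θ) * l' θ).im) haarAddCircle := i3.im
  have j5 : Integrable (fun θ => 2 * (conj (l' θ) * z θ).im) haarAddCircle := i4.im.const_mul 2
  have j6 : Integrable (fun θ => m * ‖z θ‖ ^ 2 + (m - Real.pi) * (2 * (conj (l θ) * z θ).re +
      (conj (l θ) * l θ).re)) haarAddCircle := j0.add j3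
  have j7 : Integrable (fun θ => m * ‖z θ‖ ^ 2 + (m - Real.pi) * (2 * (conj (l θ) * z θ).re +
      (conj (l θ) * l θ).re) + (conj (l θ) * l' θ).im) haarAddCircle := j6.add j4
  have hq : q = fun θ => m * ‖z θ‖ ^ 2 + (m - Real.pi) * (2 * (conj (l θ) * z θ).re +
      (conj (l θ) * l θ).re) + (conj (l θ) * l' θ).im - 2 * (conj (l' θ) * z θ).im :=
    funext fun θ => quadForm_eq _ _ _ _
  refine ⟨hq ▸ j7.sub j5, ?_⟩
  rw [hq, integral_sub j7 j5, integral_add j6 j4, integral_add j0 j3, integral_const_mul,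
    integral_const_mul, integral_const_mul, integral_add j1 j2, integral_const_mul, hre i1, hre i2,
    him i3, him i4, integral_conj_trigPoly_mul S c hzi, integral_conj_trigPoly_mul S c' hzi,
    integral_conj_trigPoly_mul_trigPoly, integral_conj_trigPoly_mul_trigPoly]
  -- Since `m ≥ 1`, Bessel's inequality lets `(m-1)∫|z|²` dominate its part in the band, so the
  -- comparison reduces to single modes.
  have hB := sum_normSq_fourierCoeff_le S hz hz1
  set Z := ∫ θ, ‖z θ‖ ^ 2 ∂haarAddCircle
  have hterm : ∀ k ∈ S, ‖fourierCoeff z k‖ ^ 2 + ‖c k‖ ^ 2 ≤ m * ‖fourierCoeff z k‖ ^ 2 +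
      ((m - Real.pi) * (2 * (conj (c k) * fourierCoeff z k).re + (conj (c k) * c k).re) +
      (conj (c k) * c' k).im - 2 * (conj (c' k) * fourierCoeff z k).im) := by
    intro k hk
    obtain ⟨hk1, hk2⟩ := Finset.mem_Icc.1 hk
    have hk1' : -(2 * (r : ℝ) - 1) ≤ k := by exact_mod_cast hk1
    have hk2' : (k : ℝ) ≤ 0 := by exact_mod_cast hk2
    set w := fourierCoeff z k
    set v := c k with hv
    have hn : ∀ w : ℂ, ‖w‖ ^ 2 = w.re ^ 2 + w.im ^ 2 := fun w => by
      rw [← Complex.normSq_eq_norm_sq, Complex.normSq_apply]; ring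
    -- Completing the square. Both coefficients are at least `π` on the band: `k ≥ -(2r-1)` is used
    -- for the first, `k ≤ 0` for the second.
    have e : m * ‖w‖ ^ 2 + ((m - Real.pi) * (2 * (conj v * w).re + (conj v * v).re) +
        (conj v * c' k).im - 2 * (conj (c' k) * w).im) =
        (m - Real.pi + 2 * Real.pi * k) * ‖w + v‖ ^ 2 + (Real.pi - 2 * Real.pi * k) * ‖w‖ ^ 2 := by
      simp only [hn, hc', ← hv]
      simp
      ring
    rw [e]
    have h1 : 3 ≤ m - Real.pi + 2 * Real.pi * k := by rw [hm]; nlinarith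
    have h2 : 3 ≤ Real.pi - 2 * Real.pi * k := by nlinarith
    have h3 := mul_le_mul_of_nonneg_right h1 (sq_nonneg ‖w + v‖)
    have h4 := mul_le_mul_of_nonneg_right h2 (sq_nonneg ‖w‖)
    have h5 := norm_sub_le (w + v) w
    rw [add_sub_cancel_left] at h5
    have h6 : ‖v‖ ^ 2 ≤ (‖w + v‖ + ‖w‖) ^ 2 := by gcongr
    nlinarith [sq_nonneg (‖w + v‖ - ‖w‖), sq_nonneg ‖w + v‖]
  have hsum := Finset.sum_le_sum hterm
  simp only [Finset.sum_add_distrib, Finset.sum_sub_distrib, ← Finset.mul_sum] at hsum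
  simp only [Complex.re_sum, Complex.im_sum]
  nlinarith

end QPCocycle
end

/-! ### The integrated inequality along the invariant section. -/

open scoped ContDiff
noncomputable section
namespace QPCocycle

open MeasureTheory ComplexConjugate Filter Topology AddCircle

/-- A continuous function of a bounded measurable map is integrable. -/
theorem integrable_comp_of_bounded {E : Type*} [NormedAddCommGroup E] [ProperSpace E]
    [MeasurableSpace E] [BorelSpace E] {f : E → ℝ} (hf : Continuous f) {g : UnitAddCircle → E}
    (hg : Measurable g) {C : ℝ} (hC : ∀ θ, ‖g θ‖ ≤ C) :
    Integrable (fun θ => f (g θ)) (haarAddCircle : Measure UnitAddCircle) := by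
  obtain ⟨B, hB⟩ := (isCompact_closedBall (0 : E) C).exists_bound_of_continuousOn hf.continuousOn
  exact integrable_of_measurable_of_bound (hf.measurable.comp hg) fun θ =>
    hB _ (mem_closedBall_zero_iff.2 (hC θ))

section Derivative

variable {E : Type*} [NormedAddCommGroup E] [NormedSpace ℝ E] {f f' : UnitAddCircle → E}

theorem continuous_of_hasDerivAt_circle
    (h : ∀ (θ : UnitAddCircle) (x : ℝ), HasDerivAt (fun y : ℝ => f (θ + y)) (f' (θ + x)) x) :
    Continuous f := by
  have h1 : Continuous fun y : ℝ => f y :=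
    continuous_iff_continuousAt.2 fun x => by simpa using (h 0 x).continuousAt
  exact continuous_coinduced_dom.2 h1

theorem measurable_of_hasDerivAt_circle [MeasurableSpace E] [BorelSpace E]
    (h : ∀ (θ : UnitAddCircle) (x : ℝ), HasDerivAt (fun y : ℝ => f (θ + y)) (f' (θ + x)) x) :
    Measurable f' := by
  have hf := continuous_of_hasDerivAt_circle h
  have hu : Tendsto (fun n : ℕ => 1 / ((n : ℝ) + 1)) atTop (𝓝[≠] 0) :=
    tendsto_nhdsWithin_iff.2 ⟨tendsto_one_div_add_atTop_nhds_zero_nat,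
      Eventually.of_forall fun n => by
        have : (0 : ℝ) < 1 / ((n : ℝ) + 1) := by positivity
        exact this.ne'⟩
  refine measurable_of_tendsto_metrizable
    (f := fun (n : ℕ) θ => (1 / ((n : ℝ) + 1))⁻¹ • (f (θ + (1 / ((n : ℝ) + 1) : ℝ)) - f θ))
    (fun n => ?_) (tendsto_pi_nhds.2 fun θ => ?_)
  · exact Continuous.measurable (by fun_prop)
  · have := (hasDerivAt_iff_tendsto_slope_zero.1 (h θ 0)).comp hu
    simpa [Function.comp_def] using this

/-- The fundamental theorem of calculus over one period; the derivative is only known to be bounded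
and measurable. -/
theorem integral_eq_zero_of_hasDerivAt_circle {f f' : UnitAddCircle → ℝ} {C : ℝ}
    (h : ∀ (θ : UnitAddCircle) (x : ℝ), HasDerivAt (fun y : ℝ => f (θ + y)) (f' (θ + x)) x)
    (hC : ∀ θ, |f' θ| ≤ C) :
    ∫ θ, f' θ ∂haarAddCircle = 0 := by
  have hm := measurable_of_hasDerivAt_circle h
  have h1 : ∫ θ, f' θ ∂haarAddCircle = ∫ x in (0 : ℝ)..0 + 1, f' (x : UnitAddCircle) := by
    rw [AddCircle.intervalIntegral_preimage]
    simp [AddCircle.volume_eq_smul_haarAddCircle]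
  rw [h1, intervalIntegral.integral_eq_sub_of_hasDerivAt (f := fun y : ℝ => f y)
    (fun x _ => by simpa using h 0 x)]
  · have := AddCircle.coe_period (1 : ℝ)
    simp [this]
  · have : Measurable fun x : ℝ => f' (x : UnitAddCircle) :=
      hm.comp (AddCircle.measurable_mk' (a := 1))
    refine IntervalIntegrable.mono_fun' (g := fun _ => C) intervalIntegrable_const
      this.aestronglyMeasurable (Eventually.of_forall fun x => hC _)

end Derivative

theorem continuous_quadForm (m : ℝ) : Continuous fun p : ℂ × ℂ × ℂ => quadForm m p.1 p.2.1 p.2.2 := by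
  unfold quadForm
  fun_prop

theorem integrable_energy_densities {a b a' b' z : UnitAddCircle → ℂ} {ρ : ℝ}
    (hma : Measurable a) (hmb : Measurable b) (hma' : Measurable a') (hmb' : Measurable b')
    (hz : Measurable z) (ha : ∀ θ, ‖a θ‖ ≤ 2) (hb : ∀ θ, ‖b θ‖ ≤ 2) (ha' : ∀ θ, ‖a' θ‖ ≤ 2)
    (hb' : ∀ θ, ‖b' θ‖ ≤ 2) (hρ : ρ < 1) (hzρ : ∀ θ, ‖z θ‖ ≤ ρ) :
    Integrable (fun θ => ‖a θ * z θ + b θ‖ ^ 2 / (1 - ‖z θ‖ ^ 2)) haarAddCircle ∧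
    Integrable (fun θ => ((logDerivDiag (a θ) (b θ) (a' θ) (b' θ)).im * (1 + ‖z θ‖ ^ 2) +
      2 * (logDerivOff (a θ) (b θ) (a' θ) (b' θ) * z θ).im) / (1 - ‖z θ‖ ^ 2)) haarAddCircle := by
  have hρ0 : 0 ≤ ρ := (norm_nonneg _).trans (hzρ 0)
  have hz1 : ∀ θ, ‖z θ‖ ≤ 1 := fun θ => (hzρ θ).trans hρ.le
  have hwm : Measurable fun θ => (1 - ‖z θ‖ ^ 2)⁻¹ := by fun_prop
  have hwb : ∀ θ, ‖(1 - ‖z θ‖ ^ 2)⁻¹‖ ≤ (1 - ρ ^ 2)⁻¹ := fun θ => by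
    have h1 : ‖z θ‖ ^ 2 ≤ ρ ^ 2 := pow_le_pow_left₀ (norm_nonneg _) (hzρ θ) 2
    have h2 : 0 < 1 - ρ ^ 2 := by nlinarith
    rw [Real.norm_of_nonneg (inv_nonneg.2 (by linarith))]
    exact inv_anti₀ h2 (by linarith)
  have hw0 : 0 ≤ (1 - ρ ^ 2)⁻¹ := (norm_nonneg _).trans (hwb 0)
  simp only [div_eq_mul_inv]
  constructor
  · refine integrable_comp_of_bounded (E := ℂ × ℂ × ℂ × ℝ)
      (f := fun p => ‖p.1 * p.2.2.1 + p.2.1‖ ^ 2 * p.2.2.2) (by fun_prop)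
      (g := fun θ => (a θ, b θ, z θ, (1 - ‖z θ‖ ^ 2)⁻¹))
      (hma.prodMk (hmb.prodMk (hz.prodMk hwm))) (C := 2 + (1 - ρ ^ 2)⁻¹) fun θ => ?_
    simp only [Prod.norm_def, sup_le_iff]
    exact ⟨(ha θ).trans (by linarith), (hb θ).trans (by linarith), (hz1 θ).trans (by linarith),
      (hwb θ).trans (by linarith)⟩
  · refine integrable_comp_of_bounded (E := ℂ × ℂ × ℂ × ℂ × ℂ × ℝ)
      (f := fun p => ((logDerivDiag p.1 p.2.1 p.2.2.1 p.2.2.2.1).im * (1 + ‖p.2.2.2.2.1‖ ^ 2) +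
        2 * (logDerivOff p.1 p.2.1 p.2.2.1 p.2.2.2.1 * p.2.2.2.2.1).im) * p.2.2.2.2.2)
      (by unfold logDerivDiag logDerivOff; fun_prop)
      (g := fun θ => (a θ, b θ, a' θ, b' θ, z θ, (1 - ‖z θ‖ ^ 2)⁻¹))
      (hma.prodMk (hmb.prodMk (hma'.prodMk (hmb'.prodMk (hz.prodMk hwm)))))
      (C := 2 + (1 - ρ ^ 2)⁻¹) fun θ => ?_
    simp only [Prod.norm_def, sup_le_iff]
    exact ⟨(ha θ).trans (by linarith), (hb θ).trans (by linarith), (ha' θ).trans (by linarith),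
      (hb' θ).trans (by linarith), (hz1 θ).trans (by linarith), (hwb θ).trans (by linarith)⟩

/-- The invariant section of a perturbation of `E_r` with bounded products nearly annihilates the
quadratic form. -/
theorem BoundedFiberedProducts.exists_integral_quadForm_le {r : ℕ} (hr : 1 ≤ r) {α : UnitAddCircle}
    {U U' : UnitAddCircle → SU11Coord} {ε : ℝ} (hε : ε ≤ 1 / 100)
    (hd : ∀ (θ : UnitAddCircle) (x : ℝ), HasDerivAt (fun y : ℝ => U (θ + y)) (U' (θ + x)) x)
    (hU : ∀ θ, ‖U θ‖ ≤ ε) (hU' : ∀ θ, ‖U' θ‖ ≤ ε)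
    (hbdd : BoundedFiberedProducts α (perturbedE r U)) :
    ∃ z : UnitAddCircle → ℂ, Measurable z ∧ (∀ θ, ‖z θ‖ ≤ 1) ∧
      Integrable (fun θ => quadForm (4 * Real.pi * r) (z θ) (U θ).2 (U' θ).2 -
        13 * (4 * Real.pi * r) * ε * (‖z θ‖ ^ 2 + ‖(U θ).2‖ ^ 2 + ‖(U' θ).2‖ ^ 2))
          haarAddCircle ∧
      ∫ θ, (quadForm (4 * Real.pi * r) (z θ) (U θ).2 (U' θ).2 -
        13 * (4 * Real.pi * r) * ε * (‖z θ‖ ^ 2 + ‖(U θ).2‖ ^ 2 + ‖(U' θ).2‖ ^ 2))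
          ∂haarAddCircle ≤ 0 := by
  set m : ℝ := 4 * Real.pi * r with hm
  have hpi := Real.pi_gt_three
  have hm4 : 4 * Real.pi ≤ m := by
    have : (1 : ℝ) ≤ r := by exact_mod_cast hr
    nlinarith
  have h0 : 0 ≤ ε := (norm_nonneg _).trans (hU 0)
  have hdisc : ∀ θ, |discr (U θ)| < 1 := fun θ => by
    have := abs_discr_le (hU θ)
    nlinarith
  set a := fun θ => expDiag (U θ)
  set b := fun θ => expOff (U θ)
  set a' := fun θ => expDiag' (U θ) (U' θ)
  set b' := fun θ => expOff' (U θ) (U' θ)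
  have hda : ∀ (θ : UnitAddCircle) (x : ℝ),
      HasDerivAt (fun y : ℝ => a (θ + y)) (a' (θ + x)) x := fun θ x =>
    hasDerivAt_expDiag (hd θ x) (hdisc _)
  have hdb : ∀ (θ : UnitAddCircle) (x : ℝ),
      HasDerivAt (fun y : ℝ => b (θ + y)) (b' (θ + x)) x := fun θ x =>
    hasDerivAt_expOff (hd θ x) (hdisc _)
  have hca := continuous_of_hasDerivAt_circle hda
  have hcb := continuous_of_hasDerivAt_circle hdb
  have hma' := measurable_of_hasDerivAt_circle hda
  have hmb' := measurable_of_hasDerivAt_circle hdb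
  have hcU := continuous_of_hasDerivAt_circle hd
  have hmU' := measurable_of_hasDerivAt_circle hd
  have ha1 : ∀ θ, ‖a θ - 1‖ ≤ 1 / 4 := fun θ =>
    (norm_expDiag_sub_one_le hε (hU θ)).trans (by linarith)
  have hb1 : ∀ θ, ‖b θ‖ ≤ 1 / 4 := fun θ => by
    have h1 := norm_expOff_sub_le hε (hU θ)
    have h2 := norm_snd_le' (hU θ)
    have h3 := norm_le_norm_add_norm_sub' (b θ) (U θ).2
    nlinarith [norm_nonneg (U θ).2]
  have ha2 : ∀ θ, ‖a θ‖ ≤ 2 := fun θ => by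
    have h3 := norm_le_norm_add_norm_sub' (a θ) 1
    rw [norm_one] at h3
    linarith [ha1 θ]
  have hla : ∀ θ, ‖a' θ‖ ≤ 1 := fun θ =>
    (norm_expDiag'_le hε (hU θ) (hU' θ)).trans (by linarith)
  have hlb : ∀ θ, ‖b' θ‖ ≤ 1 := fun θ => by
    have h1 := norm_expOff'_sub_le hε (hU θ) (hU' θ)
    have h2 := norm_snd_le' (hU θ)
    have h4 := norm_snd_le' (hU' θ)
    have h3 := norm_le_norm_add_norm_sub' (b' θ) (U' θ).2
    nlinarith [norm_nonneg (U θ).2, norm_nonneg (U' θ).2]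
  have hdet : ∀ θ, a θ * conj (a θ) - b θ * conj (b θ) = 1 := fun θ =>
    expDiag_mul_conj_sub (hdisc θ)
  have hee : ∀ θ : UnitAddCircle, (fourier (r : ℤ) θ : ℂ) * conj (fourier (r : ℤ) θ : ℂ) = 1 :=
    fun θ => by rw [Complex.mul_conj, Complex.normSq_eq_norm_sq, fourier_apply, Circle.norm_coe]; simp
  have hE : perturbedE r U = fun θ => su11 (fourier (r : ℤ) θ * a θ) (fourier (r : ℤ) θ * b θ) := by
    funext θ
    rw [perturbedE, exp_toMatrix_eq_su11 (hdisc θ).le, E, fourier_neg]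
    ext i j
    fin_cases i <;> fin_cases j <;> simp [su11, Matrix.mul_apply, Fin.sum_univ_two, a, b]
  rw [hE] at hbdd
  obtain ⟨z, hz, ⟨ρ, hρ, hzρ⟩, hinv⟩ := hbdd.exists_invariant_section (by fun_prop) (by fun_prop)
    (fun θ => by
      rw [map_mul, map_mul]
      linear_combination (a θ * conj (a θ) - b θ * conj (b θ)) * hee θ + hdet θ)
  -- `E_r` acts on the disc as rotation by `e^{4πirθ}`, hence the frequency `2r`.
  have hinv' : ∀ θ, z (θ + α) * (conj (b θ) * z θ + conj (a θ)) =
      fourier (2 * r : ℤ) θ * (a θ * z θ + b θ) := fun θ => by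
    have h1 := hinv θ
    rw [map_mul, map_mul] at h1
    rw [two_mul, fourier_add]
    linear_combination (fourier (r : ℤ) θ : ℂ) * h1 -
      z (θ + α) * (conj (b θ) * z θ + conj (a θ)) * hee θ
  have hρ0 : 0 ≤ ρ := (norm_nonneg _).trans (hzρ 0)
  have hz1 : ∀ θ, ‖z θ‖ ≤ 1 := fun θ => (hzρ θ).trans hρ.le
  have hzlt : ∀ θ, ‖z θ‖ < 1 := fun θ => (hzρ θ).trans_lt hρ
  have hen := energy_identity hca hcb hda hdb hla hlb hdet ha1 hb1 hz hρ hzρ hinv'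
  obtain ⟨hlogi, hlog⟩ := integrable_and_integral_log_denom_eq_zero hdet hz hρ hzρ hinv'
  obtain ⟨hi2, hi3⟩ := integrable_energy_densities hca.measurable hcb.measurable hma' hmb' hz ha2
    (fun θ => (hb1 θ).trans (by norm_num)) (fun θ => (hla θ).trans (by norm_num))
    (fun θ => (hlb θ).trans (by norm_num)) hρ hzρ
  have hC : ∀ θ, ‖(z θ, (U θ).2, (U' θ).2)‖ ≤ 1 := fun θ => by
    have h2 := norm_snd_le' (hU θ)
    have h4 := norm_snd_le' (hU' θ)
    simp only [Prod.norm_def, sup_le_iff]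
    refine ⟨hz1 θ, ?_, ?_⟩ <;> linarith
  have hq : Integrable (fun θ => quadForm m (z θ) (U θ).2 (U' θ).2 -
      13 * m * ε * (‖z θ‖ ^ 2 + ‖(U θ).2‖ ^ 2 + ‖(U' θ).2‖ ^ 2)) haarAddCircle :=
    integrable_comp_of_bounded (E := ℂ × ℂ × ℂ)
      (f := fun p => quadForm m p.1 p.2.1 p.2.2 -
        13 * m * ε * (‖p.1‖ ^ 2 + ‖p.2.1‖ ^ 2 + ‖p.2.2‖ ^ 2))
      ((continuous_quadForm m).sub (by fun_prop)) (g := fun θ => (z θ, (U θ).2, (U' θ).2))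
      (by fun_prop) hC
  have ht : Integrable (fun θ => (U' θ).1) haarAddCircle :=
    integrable_of_measurable_of_bound (by fun_prop) fun θ => abs_fst_le (hU' θ)
  have ht0 : ∫ θ, (U' θ).1 ∂haarAddCircle = 0 :=
    integral_eq_zero_of_hasDerivAt_circle (f := fun θ => (U θ).1) (fun θ x => (hd θ x).fst)
      fun θ => abs_fst_le (hU' θ)
  refine ⟨z, hz, hz1, hq, ?_⟩
  -- The majorant integrates to zero by the energy and exponent identities, and `t'` has mean zero.
  have hmono := integral_mono (ht.add hq)
    (((hi2.const_mul m).sub hi3).sub (hlogi.const_mul Real.pi)) fun θ => by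
      have := quadForm_le hm4 hε (hU θ) (hU' θ) (hzlt θ)
      simp only [Pi.add_apply, Pi.sub_apply]
      linarith
  rw [integral_add' ht hq, integral_sub' ((hi2.const_mul m).sub hi3) (hlogi.const_mul Real.pi),
    integral_sub' (hi2.const_mul m) hi3, integral_const_mul, integral_const_mul, hlog, hen, ht0,
    ← hm] at hmono
  linarith

end QPCocycle
end

/-! ### `C^s` norms and the conclusion. -/

open scoped ContDiff
noncomputable section
namespace QPCocycle

open MeasureTheory ComplexConjugate Filter Topology AddCircle

theorem hasDerivAt_circle_of_real {E : Type*} [NormedAddCommGroup E] [NormedSpace ℝ E]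
    {f f' : UnitAddCircle → E}
    (h : ∀ x : ℝ, HasDerivAt (fun y : ℝ => f y) (f' x) x) (θ : UnitAddCircle) (x : ℝ) :
    HasDerivAt (fun y : ℝ => f (θ + y)) (f' (θ + x)) x := by
  obtain ⟨t, rfl⟩ := QuotientAddGroup.mk_surjective θ
  exact (h (t + x)).comp_const_add t x

section Norms

variable {U U' : UnitAddCircle → SU11Coord} {s : ℕ}

theorem Smooth.exists_hasDerivAt (hU : Smooth U) : ∃ U' : UnitAddCircle → SU11Coord,
    ∀ (θ : UnitAddCircle) (x : ℝ), HasDerivAt (fun y : ℝ => U (θ + y)) (U' (θ + x)) x := by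
  refine ⟨fun θ => deriv (fun h : ℝ => U (θ + h)) 0, ?_⟩
  refine hasDerivAt_circle_of_real (f := U)
    (f' := fun θ => deriv (fun h : ℝ => U (θ + h)) 0) fun x => ?_
  have h1 : DifferentiableAt ℝ (fun y : ℝ => U y) x := hU.differentiable (by simp) x
  have h2 := deriv_comp_const_add (fun y : ℝ => U y) x 0
  rw [add_zero] at h2
  convert h1.hasDerivAt using 1
  rw [← h2]
  simp

/-- Periodicity and continuity make the range compact. Boundedness is essential, as a real `⨆` over
an unbounded family takes the default value `0`. -/
theorem Smooth.bddAbove_norm_iteratedDeriv (hU : Smooth U) (j : ℕ) :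
    BddAbove (Set.range fun x : ℝ => ‖iteratedDeriv j (fun y : ℝ => U y) x‖) := by
  have hp : Function.Periodic (fun x : ℝ => ‖iteratedDeriv j (fun y : ℝ => U y) x‖) 1 := fun x => by
    have h1 := congrFun (iteratedDeriv_comp_add_const j (fun y : ℝ => U y) 1) x
    have h2 : (fun z : ℝ => U ((z + 1 : ℝ) : UnitAddCircle)) = fun z : ℝ => U z := by
      funext z
      rw [AddCircle.coe_add, AddCircle.coe_period, add_zero]
    dsimp only at h1 ⊢
    rw [h2] at h1
    rw [← h1]
  refine (hp.compact_of_continuous one_ne_zero ?_).bddAbove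
  exact (ContDiff.continuous_iteratedDeriv (n := ∞) j hU (by exact_mod_cast le_top)).norm

theorem Smooth.norm_iteratedDeriv_le_cNorm (hU : Smooth U) {j : ℕ} (hj : j ≤ s) (x : ℝ) :
    ‖iteratedDeriv j (fun y : ℝ => U y) x‖ ≤ cNorm s U :=
  (le_ciSup (hU.bddAbove_norm_iteratedDeriv j) x).trans
    (le_ciSup (f := fun j : Fin (s + 1) => ⨆ x : ℝ, ‖iteratedDeriv (j : ℕ) (fun y : ℝ => U y) x‖)
      (Set.finite_range _).bddAbove ⟨j, Nat.lt_succ_of_le hj⟩)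

theorem cNorm_le {C : ℝ} (h : ∀ j ≤ s, ∀ x : ℝ, ‖iteratedDeriv j (fun y : ℝ => U y) x‖ ≤ C) :
    cNorm s U ≤ C :=
  ciSup_le fun j => ciSup_le fun x => h j (Nat.le_of_lt_succ j.2) x

theorem Smooth.norm_le_cNorm (hU : Smooth U) (s : ℕ) (θ : UnitAddCircle) : ‖U θ‖ ≤ cNorm s U := by
  obtain ⟨t, rfl⟩ := QuotientAddGroup.mk_surjective θ
  simpa using hU.norm_iteratedDeriv_le_cNorm (Nat.zero_le s) t

theorem Smooth.norm_deriv_le_cNorm (hU : Smooth U) (hs : 1 ≤ s)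
    (hd : ∀ (θ : UnitAddCircle) (x : ℝ), HasDerivAt (fun y : ℝ => U (θ + y)) (U' (θ + x)) x)
    (θ : UnitAddCircle) : ‖U' θ‖ ≤ cNorm s U := by
  obtain ⟨t, rfl⟩ := QuotientAddGroup.mk_surjective θ
  have h1 := hU.norm_iteratedDeriv_le_cNorm hs t
  have h2 := (hd 0 t).deriv
  simp only [zero_add] at h2
  rw [iteratedDeriv_one, h2] at h1
  exact h1

end Norms

section TrigPoly

variable (S : Finset ℤ) (c : ℤ → ℂ)

theorem hasDerivAt_trigPoly (x : ℝ) :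
    HasDerivAt (fun y : ℝ => trigPoly S c y)
      (trigPoly S (fun k => c k * (2 * Real.pi * k * Complex.I)) x) x := by
  have h := HasDerivAt.fun_sum (u := S) fun k _ => (hasDerivAt_fourier 1 k x).const_mul (c k)
  refine h.congr_deriv (Finset.sum_congr rfl fun k _ => ?_)
  push_cast
  ring

theorem iteratedDeriv_trigPoly (j : ℕ) :
    iteratedDeriv j (fun y : ℝ => ((0, trigPoly S c y) : SU11Coord)) =
      fun y : ℝ => (0, trigPoly S (fun k => c k * (2 * Real.pi * k * Complex.I) ^ j) y) := by
  induction j with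
  | zero => simp
  | succ j ih =>
    rw [iteratedDeriv_succ, ih]
    funext x
    refine ((hasDerivAt_const x (0 : ℝ)).prodMk (hasDerivAt_trigPoly S _ x)).deriv.trans ?_
    simp only [pow_succ, mul_assoc]

theorem smooth_trigPoly : Smooth fun θ => (0, trigPoly S c θ) := by
  refine contDiff_const.prodMk ?_
  simp only [trigPoly, fourier_coe_apply]
  refine ContDiff.sum fun k _ => contDiff_const.mul ?_
  refine ContDiff.cexp ?_
  have : ContDiff ℝ ∞ fun x : ℝ => (x : ℂ) := Complex.ofRealCLM.contDiff
  fun_prop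

variable {S} {m : ℝ}

theorem norm_mul_pow_le (hS : ∀ k ∈ S, |2 * Real.pi * (k : ℝ)| ≤ m) {k : ℤ} (hk : k ∈ S) (j : ℕ) :
    ‖c k * (2 * Real.pi * k * Complex.I) ^ j‖ ≤ m ^ j * ‖c k‖ := by
  have h : ‖(2 * Real.pi * k * Complex.I : ℂ)‖ ≤ m := by
    have := hS k hk
    rw [← Real.norm_eq_abs, ← Complex.norm_real] at this
    rw [norm_mul, Complex.norm_I, mul_one]
    exact_mod_cast this
  rw [norm_mul, norm_pow, mul_comm]
  gcongr

/-- Each derivative multiplies the mode `k` by a factor of modulus `|2πk| ≤ m`, and `m ≥ 1` makes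
order `s` the worst. -/
theorem cNorm_trigPoly_le (hS : ∀ k ∈ S, |2 * Real.pi * (k : ℝ)| ≤ m) (hm : 1 ≤ m) (s : ℕ) :
    cNorm s (fun θ => (0, trigPoly S c θ)) ≤ m ^ s * ∑ k ∈ S, ‖c k‖ := by
  refine cNorm_le fun j hj x => ?_
  rw [iteratedDeriv_trigPoly, Prod.norm_mk, norm_zero, max_eq_right (norm_nonneg _)]
  refine (norm_trigPoly_le _ _ _).trans ?_
  rw [Finset.mul_sum]
  refine Finset.sum_le_sum fun k hk => (norm_mul_pow_le c hS hk j).trans ?_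
  gcongr

theorem integral_normSq_deriv_trigPoly_le (hS : ∀ k ∈ S, |2 * Real.pi * (k : ℝ)| ≤ m) :
    ∫ θ, ‖trigPoly S (fun k => c k * (2 * Real.pi * k * Complex.I)) θ‖ ^ 2 ∂haarAddCircle ≤
      m ^ 2 * ∑ k ∈ S, ‖c k‖ ^ 2 := by
  rw [integral_normSq_trigPoly, Finset.mul_sum]
  refine Finset.sum_le_sum fun k hk => ?_
  have h := norm_mul_pow_le c hS hk 1
  rw [pow_one, pow_one] at h
  rw [← mul_pow]
  exact pow_le_pow_left₀ (norm_nonneg _) h 2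

end TrigPoly

/-- The resonant Fourier coefficients of a perturbation with bounded products are controlled by
its nonresonant part. -/
theorem sum_normSq_le_of_boundedFiberedProducts {r : ℕ} (hr : 1 ≤ r) {α : UnitAddCircle}
    {U U' : UnitAddCircle → SU11Coord} {m ε τ : ℝ} (hm : m = 4 * Real.pi * r)
    (hε : ε = 1 / (104 * m * (1 + m ^ 2)))
    (hd : ∀ (θ : UnitAddCircle) (x : ℝ), HasDerivAt (fun y : ℝ => U (θ + y)) (U' (θ + x)) x)
    (hU : ∀ θ, ‖U θ‖ ≤ ε) (hU' : ∀ θ, ‖U' θ‖ ≤ ε)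
    (hbdd : BoundedFiberedProducts α (perturbedE r U)) (c : ℤ → ℂ)
    (hτ : ∀ θ, ‖(U θ).2 - trigPoly (Finset.Icc (-(2 * (r : ℤ) - 1)) 0) c θ‖ ≤ τ)
    (hτ' : ∀ θ, ‖(U' θ).2 - trigPoly (Finset.Icc (-(2 * (r : ℤ) - 1)) 0)
      (fun k => c k * (2 * Real.pi * k * Complex.I)) θ‖ ≤ τ)
    (hS : ∀ k ∈ Finset.Icc (-(2 * (r : ℤ) - 1)) 0, |2 * Real.pi * (k : ℝ)| ≤ m) :
    ∑ k ∈ Finset.Icc (-(2 * (r : ℤ) - 1)) 0, ‖c k‖ ^ 2 ≤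
      4 * (60 * m ^ 2 * (1 + m ^ 2) + 1) * τ ^ 2 := by
  have hpi := Real.pi_gt_three
  have hm4 : 4 * Real.pi ≤ m := by
    have : (1 : ℝ) ≤ r := by exact_mod_cast hr
    rw [hm]; nlinarith
  have hm12 : 12 ≤ m := by linarith
  -- The constant `104 = 8·13` in `ε` is chosen for this.
  have hKε : 13 * m * ε = 1 / (8 * (1 + m ^ 2)) := by
    rw [hε]; field_simp; norm_num
  have hε1 : ε ≤ 1 / 100 := by
    rw [hε]
    refine one_div_le_one_div_of_le (by norm_num) ?_
    nlinarith [sq_nonneg m]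
  obtain ⟨z, hz, hz1, hqi, hq⟩ := hbdd.exists_integral_quadForm_le hr hε1 hd hU hU'
  rw [← hm] at hqi hq
  rw [hKε] at hqi hq
  obtain ⟨hti, ht⟩ := integrable_quadForm_trigPoly hr hz hz1 c
  rw [← hm] at hti ht
  have hL' := integral_normSq_deriv_trigPoly_le c hS
  have hL := integral_normSq_trigPoly (Finset.Icc (-(2 * (r : ℤ) - 1)) 0) c
  set S := Finset.Icc (-(2 * (r : ℤ) - 1)) 0
  set l := trigPoly S c with hl
  set l' := trigPoly S (fun k => c k * (2 * Real.pi * k * Complex.I)) with hl'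
  set D : ℝ := 1 + m ^ 2 with hD
  have hD0 : 0 < D := by positivity
  have hint : ∀ c : ℤ → ℂ, Integrable (fun θ => ‖trigPoly S c θ‖ ^ 2)
      (haarAddCircle : Measure UnitAddCircle) := fun c =>
    ((continuous_trigPoly S c).norm.pow 2).integrable_of_hasCompactSupport
      (HasCompactSupport.of_compactSpace _)
  have hzi := integrable_normSq hz hz1
  have hsum : Integrable (fun θ => ‖z θ‖ ^ 2 + ‖l θ‖ ^ 2 + ‖l' θ‖ ^ 2) haarAddCircle :=
    (hzi.add (hint c)).add (hint _)
  -- The loss `1/(2D)` is `δ = 1/(4D)` from Young's inequality plus twice `1/(8D)`, the latter from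
  -- replacing `ν, ν'` by `l, l'` in the `O(ε)` error.
  have hmono : ∫ θ, (quadForm m (z θ) (l θ) (l' θ) -
      1 / (2 * D) * (‖z θ‖ ^ 2 + ‖l θ‖ ^ 2 + ‖l' θ‖ ^ 2) -
      (60 * m ^ 2 * D + 1) * (2 * τ ^ 2)) ∂haarAddCircle ≤ 0 := by
    refine (integral_mono ((hti.sub (hsum.const_mul _)).sub (integrable_const _)) hqi
      fun θ => ?_).trans hq
    have h1 := quadForm_add_ge hm4 (δ := 1 / (4 * D)) (by positivity)
      (by rw [div_le_one (by positivity)]; nlinarith) (z θ) (l θ) (l' θ)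
      ((U θ).2 - l θ) ((U' θ).2 - l' θ)
    rw [add_sub_cancel, add_sub_cancel] at h1
    have hw : ‖(U θ).2 - l θ‖ ^ 2 ≤ τ ^ 2 := pow_le_pow_left₀ (norm_nonneg _) (hτ θ) 2
    have hw' : ‖(U' θ).2 - l' θ‖ ^ 2 ≤ τ ^ 2 := pow_le_pow_left₀ (norm_nonneg _) (hτ' θ) 2
    have hsq : ∀ x y : ℂ, ‖x‖ ^ 2 ≤ 2 * ‖y‖ ^ 2 + 2 * ‖x - y‖ ^ 2 := fun x y => by
      have := norm_le_norm_add_norm_sub' x y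
      nlinarith [norm_nonneg x, norm_nonneg y, norm_nonneg (x - y), sq_nonneg (‖y‖ - ‖x - y‖)]
    have h2 := hsq (U θ).2 (l θ)
    have h3 := hsq (U' θ).2 (l' θ)
    have e1 : 15 * m ^ 2 / (1 / (4 * D)) = 60 * m ^ 2 * D := by field_simp; norm_num
    have e2 : 1 / (4 * D) = 2 * (1 / (8 * D)) := by field_simp; norm_num
    have e3 : 1 / (2 * D) = 4 * (1 / (8 * D)) := by field_simp; norm_num
    rw [e1, e2] at h1
    have hx : 0 ≤ 1 / (8 * D) := by positivity
    have hx1 : 1 / (8 * D) ≤ 1 / 8 := one_div_le_one_div_of_le (by norm_num) (by nlinarith)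
    simp only [Pi.sub_apply]
    rw [e3]
    set x := 1 / (8 * D)
    have hm2 : 0 ≤ 60 * m ^ 2 * D := by positivity
    have h4 : x * (‖z θ‖ ^ 2 + ‖(U θ).2‖ ^ 2 + ‖(U' θ).2‖ ^ 2) ≤
        x * (2 * (‖z θ‖ ^ 2 + ‖l θ‖ ^ 2 + ‖l' θ‖ ^ 2) + 4 * τ ^ 2) :=
      mul_le_mul_of_nonneg_left (by linarith [sq_nonneg ‖z θ‖]) hx
    have h5 := mul_le_mul_of_nonneg_left (add_le_add hw hw') hm2
    have h6 := mul_le_mul_of_nonneg_right hx1 (sq_nonneg τ)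
    linarith [sq_nonneg τ]
  have hti' : Integrable (fun θ => quadForm m (z θ) (l θ) (l' θ) -
      1 / (2 * D) * (‖z θ‖ ^ 2 + ‖l θ‖ ^ 2 + ‖l' θ‖ ^ 2)) haarAddCircle :=
    hti.sub (hsum.const_mul _)
  have hzl : Integrable (fun θ => ‖z θ‖ ^ 2 + ‖l θ‖ ^ 2) haarAddCircle := hzi.add (hint c)
  rw [integral_sub hti' (integrable_const _), integral_sub hti (hsum.const_mul _), integral_const_mul, integral_const,
    integral_add hzl (hint _), integral_add hzi (hint c), hL] at hmono
  simp only [probReal_univ, one_smul] at hmono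
  set Z := ∫ θ, ‖z θ‖ ^ 2 ∂haarAddCircle
  set M := ∑ k ∈ S, ‖c k‖ ^ 2
  have hZ : 0 ≤ Z := integral_nonneg fun θ => sq_nonneg _
  -- As `∫|l'|² ≤ m² M` and `D = 1 + m²`, the loss uses at most half of the coercive term `Z + M`.
  have h1 : 1 / (2 * D) * (Z + M + ∫ θ, ‖l' θ‖ ^ 2 ∂haarAddCircle) ≤ (Z + M) / 2 := by
    rw [div_mul_eq_mul_div, one_mul, div_le_div_iff₀ (by positivity) (by norm_num)]
    nlinarith [mul_nonneg (sq_nonneg m) hZ]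
  linarith

/-- The resonant part is controlled by the nonresonant one. -/
theorem cNorm_resonantPart_le {r : ℕ} (hr : 1 ≤ r) {α : UnitAddCircle}
    {U : UnitAddCircle → SU11Coord} {m : ℝ} (hm : m = 4 * Real.pi * r) (hU : Smooth U)
    (hU0 : meanT U = 0) (hUε : cNorm 2 U ≤ 1 / (104 * m * (1 + m ^ 2)))
    (hbdd : BoundedFiberedProducts α (perturbedE r U)) {s : ℕ} (hs : 1 ≤ s) :
    cNorm s (resonantPart r U) ≤
      m ^ s * √(2 * r * (4 * (60 * m ^ 2 * (1 + m ^ 2) + 1))) * cNorm s (U - resonantPart r U) := by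
  have hpi := Real.pi_gt_three
  have hr1 : (1 : ℝ) ≤ r := by exact_mod_cast hr
  have hm1 : 1 ≤ m := by rw [hm]; nlinarith
  have hS : ∀ k ∈ Finset.Icc (-(2 * (r : ℤ) - 1)) 0, |2 * Real.pi * (k : ℝ)| ≤ m := fun k hk => by
    rw [Finset.mem_Icc] at hk
    have h1 : (-(2 * r - 1) : ℝ) ≤ k := by exact_mod_cast hk.1
    have h2 : (k : ℝ) ≤ 0 := by exact_mod_cast hk.2
    rw [hm, abs_of_nonpos (by nlinarith)]
    nlinarith
  set c := fourierCoeff fun φ : UnitAddCircle => (U φ).2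
  have hΛ : resonantPart r U =
      fun θ => (0, trigPoly (Finset.Icc (-(2 * (r : ℤ) - 1)) 0) c θ) := by
    funext θ
    rw [resonantPart, hU0]
    rfl
  have hR : Smooth (U - resonantPart r U) := by
    rw [hΛ]
    exact ContDiff.sub hU (smooth_trigPoly _ c)
  obtain ⟨U', hd⟩ := hU.exists_hasDerivAt
  set R' : UnitAddCircle → SU11Coord := fun θ =>
    U' θ - (0, trigPoly (Finset.Icc (-(2 * (r : ℤ) - 1)) 0)
      (fun k => c k * (2 * Real.pi * k * Complex.I)) θ) with hR'
  have hdR : ∀ (θ : UnitAddCircle) (x : ℝ), HasDerivAt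
      (fun y : ℝ => (U - resonantPart r U) (θ + y)) (R' (θ + x)) x := by
    rw [hΛ]
    refine fun θ x => (hd θ x).sub ((hasDerivAt_const x (0 : ℝ)).prodMk ?_)
    exact hasDerivAt_circle_of_real (hasDerivAt_trigPoly _ c) θ x
  set τ := cNorm s (U - resonantPart r U)
  have hτ0 : 0 ≤ τ := (norm_nonneg _).trans (hR.norm_le_cNorm s 0)
  have hL := sum_normSq_le_of_boundedFiberedProducts hr hm rfl hd
    (fun θ => (hU.norm_le_cNorm 2 θ).trans hUε)
    (fun θ => (hU.norm_deriv_le_cNorm one_le_two hd θ).trans hUε) hbdd c (τ := τ)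
    (fun θ => by
      have h := norm_snd_le' (hR.norm_le_cNorm s θ)
      rwa [Pi.sub_apply, congrFun hΛ θ] at h)
    (fun θ => norm_snd_le' (hR.norm_deriv_le_cNorm hs hdR θ)) hS
  rw [hΛ]
  refine (cNorm_trigPoly_le c hS hm1 s).trans ?_
  rw [mul_assoc]
  refine mul_le_mul_of_nonneg_left ?_ (by positivity)
  rw [← Real.sqrt_sq hτ0, ← Real.sqrt_mul (by positivity)]
  -- Cauchy–Schwarz over the `2r` modes of the band passes from `ℓ²` to `ℓ¹`.
  refine Real.le_sqrt_of_sq_le (sq_sum_le_card_mul_sum_sq.trans ?_)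
  have hcard : ((Finset.Icc (-(2 * (r : ℤ) - 1)) 0).card : ℝ) = 2 * r := by
    have : (Finset.Icc (-(2 * (r : ℤ) - 1)) 0).card = 2 * r := by
      rw [Int.card_Icc]; omega
    rw [this]; push_cast; ring
  rw [hcard, mul_assoc (2 * (r : ℝ))]
  gcongr

end QPCocycle
end

theorem mainTheorem9 (r : ℕ) (hr : 1 ≤ r) :
    ∃ C : ℕ → ℝ, ∀ α : UnitAddCircle, ∃ ε : ℝ, 0 < ε ∧
      ∀ U : UnitAddCircle → QPCocycle.SU11Coord,
        QPCocycle.Smooth U →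
        QPCocycle.meanT U = 0 →
        QPCocycle.cNorm 2 U ≤ ε →
        QPCocycle.BoundedFiberedProducts α (QPCocycle.perturbedE r U) →
        ∀ s : ℕ, 1 ≤ s →
          QPCocycle.cNorm s (QPCocycle.resonantPart r U) ≤
            C s * QPCocycle.cNorm s (U - QPCocycle.resonantPart r U) := by
  -- Unification supplies both witnesses from `cNorm_resonantPart_le`. With `m = 4πr`, the smallness
  -- `1/(104m(1+m²))` depends on `r` alone, and so is uniform in `α`.
  refine ⟨_, fun α => ⟨_, ?_, fun U hU hU0 hUε hbdd s hs =>
    QPCocycle.cNorm_resonantPart_le hr rfl hU hU0 hUε hbdd hs⟩⟩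
  have : (0 : ℝ) < r := by exact_mod_cast hr
  positivity
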